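/- **Setting.** Let $Y=\mathbb R^n$, $P=\mathbb R^m$, $\mathbb Y=\ell_\infty(\mathbb Z;Y)$, $\mathbb P=\ell_\infty(\mathbb Z;P)$, $\Psi=\ell_\infty(\mathbb Z;\mathbb R)$ with the supremum norms, and let $r\ge 1$ be an integer. Let $f_k:Y\to Y$, $g_k:Y\to P$ ($k\in\mathbb Z$) be $C^r$ maps with $\sup_k(|f_k(0)|+|g_k(0)|)<\infty$ whose derivatives of orders $1,\dots,r$ are bounded and uniformly continuous, uniformly in $k$. For each $k$ let $\Lambda_k\subset Y$ be an invariant set of $y'=f_k(y)$; assume that the sets $\Lambda_k$ are bounded uniformly in $k$ and are uniformly hyperbolic: there are $K$ and $\kappa>0$, independent of $k$, and subspaces $N^s(y),N^u(y)$, depending continuously on $y\in\Lambda_k$, such that $Y=N^s(y)\oplus N^u(y)\oplus\mathbb R f_k(y)$ with $|s|+|u|+|c|\le K|s+u+cf_k(y)|$ for $s\in N^s(y)$, $u\in N^u(y)$, $c\in\mathbb R$ (in particular $|f_k|\ge 1/K$ on $\Lambda_k$), the linearized flow along orbits in $\Lambda_k$ preserves $N^s$ and $N^u$, and it satisfies $|v(t)|\le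 Ke^{-\kappa t}|v(0)|$ for $t\ge0$ on $N^s$ and $|v(t)|\le Ke^{\kappa t}|v(0)|$ for $t\le 0$ on $N^u$. For small $|\varepsilon|$ let $\mathbf F_\varepsilon:\mathbb Y\times\mathbb P\to\mathbb Y$ and $\mathbf G_\varepsilon:\mathbb Y\times\mathbb P\to\mathbb P$ be $C^r$ maps whose derivatives of orders $0,\dots,r$ are uniformly continuous and bounded by a constant independent of $\varepsilon$. Consider $$\mathbf y'=\mathbf f(\mathbf y)+\varepsilon\mathbf F_\varepsilon(\mathbf y,\mathbf p),\qquad \mathbf p'=\mathbf g(\mathbf y)+\varepsilon\mathbf G_\varepsilon(\mathbf y,\mathbf p),\qquad \mathbf f=\{f_k\},\ \mathbf g=\{g_k\}. \tag{1}$$ An orbit $\mathbf y^0$ from $\Lambda^\infty$ is a sequence $\{y^0_k(t)\}_{k\in\mathbb Z}$ of orbits $y_k^0(t)\in\Lambda_k$ of $y'=f_k(y)$, $t\in\mathbb R$. For small $\delta>0$, the invariant manifold $\mathbb W_{\mathbf y^0,\varepsilon}$ is the union of all solutions $(\mathbf y(t),\mathbf p(t))$, $t\in\mathbb R$, of (1)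 for which there is a continuous $\Phi=\{\phi_k\}:\mathbb R\to\Psi$ (phases of the solution) with $|y_k(t)-y^0_k(\phi_k(t))|\le\delta$ for all $t\in\mathbb R$, $k\in\mathbb Z$ (this does not depend on the choice of the small $\delta$ when $\varepsilon$ is small enough). A solution on $\mathbb W_{\mathbf y^0,\varepsilon}$ is considered together with its phases. **Theorem.** There exist $\alpha>0$, $\bar\gamma>0$, $\rho>0$, $\delta_0>0$ and a function $C(\sigma,\gamma)$ with $\lim_{\gamma\to0+}C(\sigma,\gamma)=0$ for every $\sigma\ge0$, such that the following holds for every $\delta\in(0,\delta_0]$, all $\varepsilon$ with $|\varepsilon|<\varepsilon_0(\delta)$, all $\gamma\in(0,\bar\gamma)$ and all $t_0\in\mathbb R$. Let $\mathbf y^{0,1},\mathbf y^{0,2}$ be orbits from $\Lambda^\infty$ with $$\sup_{t\ge t_0}\|\mathbf y^{0,1}(t)-\mathbf y^{0,2}(t)\|_{\mathbb Y}\le\gamma .$$ Given any solution $(\mathbf y^1,\mathbf p^1)$ on $\mathbb W_{\mathbf y^{0,1},\varepsilon}$, with phases $\Phi^1$, and any $\sigma\ge0$ such that $\phi^1_k(t_0)\ge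 t_0-\sigma$ for all $k$ (such a $\sigma$ always exists), there exists a solution $(\mathbf y^2,\mathbf p^2)$ on $\mathbb W_{\mathbf y^{0,2},\varepsilon}$, with phases $\Phi^2$ satisfying $\|\Phi^1(t)-\Phi^2(t)\|_\Psi\le\rho$ for all sufficiently large $t$, such that $$\|\mathbf y^1(t)-\mathbf y^2(t)\|_{\mathbb Y}+\|\mathbf p^1(t)-\mathbf p^2(t)\|_{\mathbb P}\le C(\sigma,\gamma)e^{-\alpha(t-t_0)},\qquad t\ge t_0 .$$ This solution is unique: it is the only solution on $\mathbb W_{\mathbf y^{0,2},\varepsilon}$ having phases that are $\rho$-close to $\Phi^1(t)$ for all sufficiently large $t$ and satisfying such an estimate for $t\ge t_0$, with the same $\alpha$ and with any constant in place of $C(\sigma,\gamma)$. The time-reversed statement also holds, with the same constants: if $\sup_{t\le t_0}\|\mathbf y^{0,1}(t)-\mathbf y^{0,2}(t)\|_{\mathbb Y}\le\gamma$, then for any solution $(\mathbf y^1,\mathbf p^1)$ on $\mathbb W_{\mathbf y^{0,1},\varepsilon}$ with $\phi_k^1(t_0)\le t_0+\sigma$ for all $k$ there is a solution $(\mathbf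 y^2,\mathbf p^2)$ on $\mathbb W_{\mathbf y^{0,2},\varepsilon}$, with phases $\rho$-close to $\Phi^1(t)$ for all sufficiently large negative $t$, such that $$\|\mathbf y^1(t)-\mathbf y^2(t)\|_{\mathbb Y}+\|\mathbf p^1(t)-\mathbf p^2(t)\|_{\mathbb P}\le C(\sigma,\gamma)e^{-\alpha|t-t_0|},\qquad t\le t_0,$$ and it is unique in the same sense. -/

import Mathlib

open Filter Topology Set
open scoped ENNReal

/-- The Euclidean space `ℝ^d`. -/
abbrev Vec (d : ℕ) : Type := EuclideanSpace ℝ (Fin d)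

/-- The Banach space of bounded two-sided sequences in `ℝ^d`, with the supremum norm. -/
abbrev SeqVec (d : ℕ) : Type := lp (fun _ : ℤ => Vec d) ∞

/-- The Banach space `Ψ` of bounded two-sided sequences of phases, with the supremum norm. -/
abbrev PhaseSpace : Type := lp (fun _ : ℤ => ℝ) ∞

/-- The data of a coupled lattice dynamical system
`y' = f(y) + ε F_ε(y, p)`, `p' = g(y) + ε G_ε(y, p)`, where `f` and `g` act componentwise. -/
structure LatticeSystem (n m : ℕ) where
  f : ℤ → Vec n → Vec n
  g : ℤ → Vec n → Vec m
  F : ℝ → SeqVec n × SeqVec m → SeqVec n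
  G : ℝ → SeqVec n × SeqVec m → SeqVec m

section Smoothness

variable {E E' : Type*} [NormedAddCommGroup E] [NormedSpace ℝ E]
  [NormedAddCommGroup E'] [NormedSpace ℝ E']

/-- A sequence of `C^r` maps whose derivatives of orders `1, …, r` are bounded and uniformly
continuous, uniformly in the index, and whose values at the origin are bounded (so that the
sequence acts componentwise on bounded sequences). -/
structure UniformlyCr (r : ℕ) (h : ℤ → E → E') : Prop where
  contDiff : ∀ k, ContDiff ℝ r (h k)
  bounded_zero : ∃ C : ℝ, ∀ k, ‖h k 0‖ ≤ C
  bounded : ∃ C : ℝ, ∀ k, ∀ j : ℕ, 1 ≤ j → j ≤ r → ∀ x, ‖iteratedFDeriv ℝ j (h k) x‖ ≤ C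
  equicontinuous : ∀ j : ℕ, 1 ≤ j → j ≤ r →
    UniformEquicontinuous (fun k : ℤ => iteratedFDeriv ℝ j (h k))

/-- `h` is `C^r`, its derivatives of orders `0, …, r` are uniformly continuous, and they are
bounded by `C`. -/
structure CrBoundedBy (r : ℕ) (C : ℝ) (h : E → E') : Prop where
  contDiff : ContDiff ℝ r h
  bounded : ∀ j : ℕ, j ≤ r → ∀ x, ‖iteratedFDeriv ℝ j h x‖ ≤ C
  uniformContinuous : ∀ j : ℕ, j ≤ r → UniformContinuous (iteratedFDeriv ℝ j h)

end Smoothness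

/-- `x` is a (complete) orbit of `x' = f(x)`. -/
def IsOrbit {n : ℕ} (f : Vec n → Vec n) (x : ℝ → Vec n) : Prop :=
  ∀ t, HasDerivAt x (f (x t)) t

/-- `x` is an orbit of `x' = f(x)` that lies in `Λ`. -/
def IsOrbitIn {n : ℕ} (f : Vec n → Vec n) (Λ : Set (Vec n)) (x : ℝ → Vec n) : Prop :=
  IsOrbit f x ∧ ∀ t, x t ∈ Λ

/-- The set `Λ` is invariant under the flow of `x' = f(x)`. -/
def IsInvariantSet {n : ℕ} (f : Vec n → Vec n) (Λ : Set (Vec n)) : Prop :=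
  ∀ x, IsOrbit f x → x 0 ∈ Λ → ∀ t, x t ∈ Λ

/-- `Ns`, `Nu` is a hyperbolic splitting over the invariant set `Λ` of `x' = f(x)`, with
constants `K` and `κ`. -/
structure IsHyperbolicSplitting {n : ℕ} (f : Vec n → Vec n) (Λ : Set (Vec n))
    (Ns Nu : Vec n → Submodule ℝ (Vec n)) (K κ : ℝ) : Prop where
  /-- The subspaces depend continuously on the point. -/
  continuous_s : ContinuousOn (fun y => (Ns y).starProjection) Λ
  continuous_u : ContinuousOn (fun y => (Nu y).starProjection) Λ
  /-- The subspaces and the direction of the flow span the whole space. -/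
  span : ∀ y ∈ Λ, Ns y ⊔ Nu y ⊔ Submodule.span ℝ {f y} = ⊤
  /-- The sum is direct and the components of a vector are bounded by `K` times its norm;
  with `s = 0`, `u = 0`, `c = 1` this says that the speed is at least `1 / K`. -/
  direct : ∀ y ∈ Λ, ∀ s ∈ Ns y, ∀ u ∈ Nu y, ∀ c : ℝ,
    ‖s‖ + ‖u‖ + |c| ≤ K * ‖s + u + c • f y‖
  /-- Invariance under the linearized flow, and contraction in forward time. -/
  stable : ∀ x v : ℝ → Vec n, IsOrbitIn f Λ x →
    (∀ t, HasDerivAt v (fderiv ℝ f (x t) (v t)) t) → v 0 ∈ Ns (x 0) →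
    (∀ t, v t ∈ Ns (x t)) ∧ ∀ t, 0 ≤ t → ‖v t‖ ≤ K * Real.exp (-κ * t) * ‖v 0‖
  /-- Invariance under the linearized flow, and contraction in backward time. -/
  unstable : ∀ x v : ℝ → Vec n, IsOrbitIn f Λ x →
    (∀ t, HasDerivAt v (fderiv ℝ f (x t) (v t)) t) → v 0 ∈ Nu (x 0) →
    (∀ t, v t ∈ Nu (x t)) ∧ ∀ t, t ≤ 0 → ‖v t‖ ≤ K * Real.exp (κ * t) * ‖v 0‖

/-- The sets `Λ k` are hyperbolic for `x' = f k x`, with constants independent of `k`. -/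
def IsUniformlyHyperbolic {n : ℕ} (f : ℤ → Vec n → Vec n) (Λ : ℤ → Set (Vec n)) : Prop :=
  ∃ K κ : ℝ, 0 < κ ∧ ∀ k, ∃ Ns Nu : Vec n → Submodule ℝ (Vec n),
    IsHyperbolicSplitting (f k) (Λ k) Ns Nu K κ

namespace LatticeSystem

variable {n m : ℕ}

/-- The standing assumptions: `C^r` regularity of the uncoupled system, uniformly in `k`; the
coupling terms are `C^r`, with `C^r` norms bounded uniformly for small `ε`; the sets `Λ k` are
invariant, uniformly bounded and uniformly hyperbolic. -/
structure StandingAssumptions (L : LatticeSystem n m) (r : ℕ) (Λ : ℤ → Set (Vec n)) : Prop where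
  one_le : 1 ≤ r
  smooth_f : UniformlyCr r L.f
  smooth_g : UniformlyCr r L.g
  coupling : ∃ ε₁ > (0 : ℝ), ∃ C : ℝ, ∀ ε : ℝ, |ε| < ε₁ →
    CrBoundedBy r C (L.F ε) ∧ CrBoundedBy r C (L.G ε)
  bounded : ∃ R : ℝ, ∀ k, ∀ y ∈ Λ k, ‖y‖ ≤ R
  invariant : ∀ k, IsInvariantSet (L.f k) (Λ k)
  hyperbolic : IsUniformlyHyperbolic L.f Λ

/-- `y0` is an orbit from `Λ^∞`: a sequence of arbitrary orbits, the `k`-th one in `Λ k`. -/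
def IsOrbitOfProduct (L : LatticeSystem n m) (Λ : ℤ → Set (Vec n)) (y0 : ℤ → ℝ → Vec n) : Prop :=
  ∀ k, IsOrbitIn (L.f k) (Λ k) (y0 k)

/-- `(y, p)` is a solution, for all times, of the coupled system with parameter `ε`. -/
def IsSolution (L : LatticeSystem n m) (ε : ℝ) (y : ℝ → SeqVec n) (p : ℝ → SeqVec m) : Prop :=
  ∀ t, ∃ (v : SeqVec n) (w : SeqVec m), HasDerivAt y v t ∧ HasDerivAt p w t ∧
    (∀ k, v k = L.f k (y t k) + ε • (L.F ε (y t, p t)) k) ∧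
    (∀ k, w k = L.g k (y t k) + ε • (L.G ε (y t, p t)) k)

/-- `(y, p)` is a solution that lies on the invariant manifold `W_{y0, ε}`, and `Φ` is a choice
of its phases. The manifold is the union of all solutions that stay, for all times, in the
`δ`-neighbourhood of the unperturbed manifold `{y_k = y0_k(φ_k) for all k, Φ ∈ Ψ}`, the phases
depending continuously on time; for small `δ` and `ε` it does not depend on `δ`. -/
structure IsSolutionOnManifold (L : LatticeSystem n m) (ε δ : ℝ) (y0 : ℤ → ℝ → Vec n)
    (y : ℝ → SeqVec n) (p : ℝ → SeqVec m) (Φ : ℝ → PhaseSpace) : Prop where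
  solution : L.IsSolution ε y p
  continuous_phase : Continuous Φ
  close : ∀ t k, ‖y t k - y0 k (Φ t k)‖ ≤ δ

end LatticeSystem

/-! Along a solution, regard the coupling as a prescribed forcing `H(t)` of size `O(ε)` with a small
Lipschitz constant in time. The system then splits into separate equations `y_k' = f_k(y_k) +
h_k(t)`, each near one hyperbolic orbit and with constants independent of `k`; the variable `p` is
recovered by integration. The argument has three layers.

One orbit. The flow direction is neutral, so solutions are compared not at equal times but at their
crossings of transversal sections (kernels of the phase functional) spaced by a large period `T`.
Deviations in the sections satisfy a recursion that is linear and hyperbolic up to a small Lipschitz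
error: its stable part is estimated from the past and its unstable part from the future, in a
supremum norm with weight `e^{-αt}`, `α = κ/4`. For large `T` the hyperbolicity beats the weight.
Differences of crossing times are summed from `+∞`, where the solutions are asymptotic; this is what
selects a single asymptotic phase. The result is Lipschitz dependence on the forcing
(`norm_sub_le_of_shadows`) and, by the contraction principle, existence (`exists_shadowing`): on the
left the given solution is replaced by the unperturbed orbit, and the approximate two-sided orbit so
obtained is corrected to a true one.

Lattice. The componentwise results assemble into bounded sequences (`exists_comparison_constants`,
`exists_driven_constants`). The coupling is restored by finding a forcing that equals the coupling
evaluated along its own solution; for small `ε` this is a contraction in the weighted norm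
(`exists_self_consistent`), and uniqueness has the same source (`eq_of_asymptotic`).

Smallness in `γ`. Orbits that are `γ`-close for `t ≥ t₀` stay within a fixed distance for a further
time `T'`, of order `log (1/γ)`, before `t₀`, by Grönwall's inequality. Phases advance with speed
between 1/2 and 3/2 up to a bounded error, so the given solution shadows the second family of
orbits, with its own phases, from a time `τ` on, where `τ - t₀ = 2(σ + 1) - T'/2`. The estimate `C
e^{-α(t-τ)}` thus carries the factor `e^{α(τ-t₀)}`, which tends to zero with `γ`. Backward time
follows by reversing time. -/

/-! ### Fixed points in weighted norms, Grönwall estimates, global solutions. -/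

section General

/-- Contraction principle in a weighted supremum distance that may take the value `∞`. -/
theorem exists_fixed_point_of_weighted_contraction {ι E : Type*} [NormedAddCommGroup E]
    [CompleteSpace E] (w : ι → ℝ) (S : Set (ι → E))
    (hS : ∀ (u : ℕ → ι → E) (v : ι → E) (ε : ℕ → ℝ), (∀ n, u n ∈ S) → Tendsto ε atTop (𝓝 0) →
      (∀ n i, ‖u n i - v i‖ ≤ ε n * w i) → v ∈ S)
    (T : (ι → E) → ι → E) (hT : ∀ u ∈ S, T u ∈ S) {β : ℝ} (hβ0 : 0 ≤ β) (hβ1 : β < 1)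
    (hc : ∀ u ∈ S, ∀ v ∈ S, ∀ M : ℝ, 0 ≤ M → (∀ i, ‖u i - v i‖ ≤ M * w i) →
      ∀ i, ‖T u i - T v i‖ ≤ β * M * w i)
    (u₀ : ι → E) (hu₀ : u₀ ∈ S) {M₀ : ℝ} (hM₀ : 0 ≤ M₀)
    (h₀ : ∀ i, ‖T u₀ i - u₀ i‖ ≤ M₀ * w i) :
    ∃ u ∈ S, T u = u ∧ ∀ i, ‖u i - u₀ i‖ ≤ M₀ / (1 - β) * w i := by
  set a : ℕ → ι → E := fun n => T^[n] u₀ with ha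
  have ha_succ : ∀ n, a (n + 1) = T (a n) := fun n => Function.iterate_succ_apply' T n u₀
  have haS : ∀ n, a n ∈ S := by
    intro n
    induction n with
    | zero => exact hu₀
    | succ n ih => rw [ha_succ]; exact hT _ ih
  have hstep : ∀ n i, ‖a (n + 1) i - a n i‖ ≤ M₀ * β ^ n * w i := by
    intro n
    induction n with
    | zero => intro i; simpa [ha] using h₀ i
    | succ n ih =>
      intro i
      rw [ha_succ (n + 1), ha_succ n]
      have := hc (T (a n)) (hT _ (haS n)) (a n) (haS n) (M₀ * β ^ n) (by positivity)
        (fun j => by rw [← ha_succ n]; exact ih j) i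
      refine this.trans (le_of_eq ?_)
      ring
  have hd : ∀ i n, dist (a n i) (a (n + 1) i) ≤ M₀ * w i * β ^ n := by
    intro i n
    rw [dist_comm, dist_eq_norm]
    exact (hstep n i).trans (le_of_eq (by ring))
  have hlim : ∀ i, ∃ x, Tendsto (fun n => a n i) atTop (𝓝 x) := fun i =>
    cauchySeq_tendsto_of_complete (cauchySeq_of_le_geometric β _ hβ1 (hd i))
  choose v hv using hlim
  have hb : ∀ n i, ‖a n i - v i‖ ≤ M₀ * β ^ n / (1 - β) * w i := by
    intro n i
    rw [← dist_eq_norm]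
    exact (dist_le_of_le_geometric_of_tendsto β _ hβ1 (hd i) (hv i) n).trans (le_of_eq (by ring))
  have hε : Tendsto (fun n : ℕ => M₀ * β ^ n / (1 - β)) atTop (𝓝 0) := by
    have := ((tendsto_pow_atTop_nhds_zero_of_lt_one hβ0 hβ1).const_mul M₀).div_const (1 - β)
    simpa using this
  have hvS : v ∈ S := hS a v _ haS hε hb
  have h1 : 0 < 1 - β := by linarith
  refine ⟨v, hvS, ?_, fun i => ?_⟩
  · funext i
    have h2 : Tendsto (fun n => a (n + 1) i) atTop (𝓝 (T v i)) := by
      rw [tendsto_iff_norm_sub_tendsto_zero]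
      refine squeeze_zero (fun _ => norm_nonneg _)
        (g := fun n : ℕ => β * (M₀ * β ^ n / (1 - β)) * w i) (fun n => ?_) ?_
      · rw [ha_succ]
        exact hc _ (haS n) v hvS _ (by positivity) (hb n) i
      · simpa using (hε.const_mul β).mul_const (w i)
    exact tendsto_nhds_unique h2 ((hv i).comp (tendsto_add_atTop_nat 1))
  · have := hb 0 i
    rw [norm_sub_rev]
    simpa [ha] using this

/-- A finite weighted bound that can be improved by a factor `β < 1` up to an additive
constant is at most the constant divided by `1 - β`. -/
theorem weighted_bound_of_self_improving {ι : Type*} (N w : ι → ℝ) (hw : ∀ i, 0 ≤ w i) {β c : ℝ}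
    (hβ0 : 0 ≤ β) (hβ1 : β < 1) (hc : 0 ≤ c) {Z₀ : ℝ} (hZ₀ : ∀ i, N i ≤ Z₀ * w i)
    (h : ∀ Z, 0 ≤ Z → (∀ i, N i ≤ Z * w i) → ∀ i, N i ≤ (β * Z + c) * w i) :
    ∀ i, N i ≤ c / (1 - β) * w i := by
  have h1 : 0 < 1 - β := by linarith
  -- `Z₀` matters only through its finiteness: after `n` improvements its contribution carries the
  -- factor `β ^ n`.
  have key : ∀ n : ℕ, ∀ i, N i ≤ (β ^ n * |Z₀| + c / (1 - β)) * w i := by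
    intro n
    induction n with
    | zero =>
      intro i
      refine (hZ₀ i).trans (mul_le_mul_of_nonneg_right ?_ (hw i))
      have : 0 ≤ c / (1 - β) := by positivity
      simp only [pow_zero, one_mul]
      linarith [le_abs_self Z₀]
    | succ n ih =>
      intro i
      refine (h _ (by positivity) ih i).trans (le_of_eq ?_)
      congr 1
      field_simp
      ring
  intro i
  have hlim : Tendsto (fun n : ℕ => (β ^ n * |Z₀| + c / (1 - β)) * w i) atTop
      (𝓝 ((0 * |Z₀| + c / (1 - β)) * w i)) :=
    (((tendsto_pow_atTop_nhds_zero_of_lt_one hβ0 hβ1).mul_const _).add_const _).mul_const _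
  have := ge_of_tendsto' hlim (fun n => key n i)
  simpa using this

variable {E : Type*} [NormedAddCommGroup E] [NormedSpace ℝ E]

/-- Grönwall's inequality in a simple form. -/
theorem norm_le_exp_mul_of_norm_deriv_le {u u' : ℝ → E} {L ε b : ℝ} (hL : 1 ≤ L) (hε : 0 ≤ ε)
    (hu : ∀ t ∈ Icc 0 b, HasDerivAt u (u' t) t)
    (hb : ∀ t ∈ Icc 0 b, ‖u' t‖ ≤ L * ‖u t‖ + ε) :
    ∀ t ∈ Icc 0 b, ‖u t‖ ≤ Real.exp (L * b) * (‖u 0‖ + ε) := by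
  intro t ht
  have h := norm_le_gronwallBound_of_norm_deriv_right_le (f := u) (f' := u') (δ := ‖u 0‖)
    (K := L) (ε := ε) (a := 0) (b := b)
    (fun t ht => (hu t ht).continuousAt.continuousWithinAt)
    (fun t ht => (hu t ⟨ht.1, ht.2.le⟩).hasDerivWithinAt) le_rfl
    (fun t ht => hb t ⟨ht.1, ht.2.le⟩) t ht
  refine h.trans ?_
  rw [gronwallBound_of_K_ne_0 (by positivity), sub_zero]
  have h1 : Real.exp (L * t) ≤ Real.exp (L * b) :=
    Real.exp_le_exp.2 (mul_le_mul_of_nonneg_left ht.2 (by linarith))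
  have h2 : 1 ≤ Real.exp (L * t) := Real.one_le_exp (mul_nonneg (by linarith) ht.1)
  have h3 : ε / L ≤ ε := div_le_self hε hL
  have h4 : 0 ≤ ε / L := by positivity
  have h5 := norm_nonneg (u 0)
  simp only
  calc ‖u 0‖ * Real.exp (L * t) + ε / L * (Real.exp (L * t) - 1)
      ≤ ‖u 0‖ * Real.exp (L * b) + ε * Real.exp (L * b) := by
        refine add_le_add (mul_le_mul_of_nonneg_left h1 h5)
          (mul_le_mul h3 (by linarith) (by linarith) hε)
    _ = _ := by ring

/-- A curve with speed at most `C` is Lipschitz. -/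
theorem norm_sub_le_of_hasDerivAt_bound {u u' : ℝ → E} {C : ℝ} {s : Set ℝ} (hs : Convex ℝ s)
    (hu : ∀ t ∈ s, HasDerivAt u (u' t) t) (hb : ∀ t ∈ s, ‖u' t‖ ≤ C) {a b : ℝ} (ha : a ∈ s)
    (hb' : b ∈ s) : ‖u b - u a‖ ≤ C * |b - a| :=
  hs.norm_image_sub_le_of_norm_hasDerivWithin_le (fun t ht => (hu t ht).hasDerivWithinAt) hb ha hb'

/-- A curve whose velocity is within `C` of `v` is an affine curve, up to `C` times the time. -/
theorem norm_sub_sub_smul_le_of_hasDerivAt {u u' : ℝ → E} {v : E} {C : ℝ} {s : Set ℝ}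
    (hs : Convex ℝ s) (hu : ∀ t ∈ s, HasDerivAt u (u' t) t) (hb : ∀ t ∈ s, ‖u' t - v‖ ≤ C)
    {a b : ℝ} (ha : a ∈ s) (hb' : b ∈ s) : ‖u b - u a - (b - a) • v‖ ≤ C * |b - a| := by
  have h := norm_sub_le_of_hasDerivAt_bound (u := fun t => u t - t • v) (u' := fun t => u' t - v)
    hs (fun t ht => by
      simpa using (hu t ht).fun_sub ((hasDerivAt_id t).smul_const v)) hb ha hb'
  refine le_trans (le_of_eq ?_) h
  congr 1
  simp only [sub_smul]
  abel

/-- Global existence for a differential equation with a globally Lipschitz right-hand side. -/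
theorem exists_global_solution [CompleteSpace E] {v : ℝ → E → E} {L C : ℝ} (hL : 0 < L)
    (hv : ∀ t x y, ‖v t x - v t y‖ ≤ L * ‖x - y‖)
    (hcont : ∀ u : ℝ → E, Continuous u → Continuous fun t => v t (u t))
    (t₀ : ℝ) (x₀ : E) (hC : ∀ t, ‖v t x₀‖ ≤ C) :
    ∃ y : ℝ → E, y t₀ = x₀ ∧ ∀ t, HasDerivAt y (v t (y t)) t := by
  have hC0 : 0 ≤ C := (norm_nonneg _).trans (hC t₀)
  -- The weight grows at twice the Lipschitz rate, so the Picard map contracts by 1/2 on the whole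
  -- line at once and no local solutions have to be continued.
  set w : ℝ → ℝ := fun t => Real.exp (2 * L * |t - t₀|) with hw
  have hwc : Continuous w := by fun_prop
  have hw0 : ∀ t, 0 < w t := fun t => Real.exp_pos _
  set T : (ℝ → E) → ℝ → E := fun u t => x₀ + ∫ s in t₀..t, v s (u s) with hT
  have hTd : ∀ u, Continuous u → ∀ t, HasDerivAt (T u) (v t (u t)) t := by
    intro u hu t
    have := (hcont u hu).integral_hasStrictDerivAt t₀ t
    exact this.hasDerivAt.const_add x₀
  -- Integrating the weight costs a factor `1 / (2 * L)`, which turns the Lipschitz constant `L`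
  -- into 1/2. The two cases are the two directions of time.
  have hint : ∀ M : ℝ, 0 ≤ M → ∀ φ : ℝ → E, (∀ s, ‖φ s‖ ≤ L * (M * w s)) → ∀ t,
      ‖∫ s in t₀..t, φ s‖ ≤ 1 / 2 * M * w t := by
    intro M hM φ hφ t
    rcases le_total t₀ t with h | h
    · have hd : ∀ s ∈ uIcc t₀ t, HasDerivAt (fun s => M / 2 * Real.exp (2 * L * (s - t₀)))
          (L * (M * Real.exp (2 * L * (s - t₀)))) s := by
        intro s _
        have := ((((hasDerivAt_id s).sub_const t₀).const_mul (2 * L)).exp).const_mul (M / 2)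
        convert! this using 1
        simp only [id]; ring
      have hI := intervalIntegral.integral_eq_sub_of_hasDerivAt hd
        (by apply Continuous.intervalIntegrable; fun_prop)
      have hle := intervalIntegral.norm_integral_le_of_norm_le (μ := MeasureTheory.volume)
        (f := φ) (g := fun s => L * (M * Real.exp (2 * L * (s - t₀)))) h
        (Filter.Eventually.of_forall fun s hs => by
          have := hφ s
          simp only [hw] at this
          rwa [abs_of_nonneg (by linarith [hs.1] : 0 ≤ s - t₀)] at this)
        (by apply Continuous.intervalIntegrable; fun_prop)
      rw [hI] at hle
      refine hle.trans ?_
      simp only [hw, abs_of_nonneg (sub_nonneg.2 h), sub_self, mul_zero, Real.exp_zero]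
      linarith
    · have hd : ∀ s ∈ uIcc t t₀, HasDerivAt (fun s => -(M / 2) * Real.exp (2 * L * (t₀ - s)))
          (L * (M * Real.exp (2 * L * (t₀ - s)))) s := by
        intro s _
        have := ((((hasDerivAt_id s).const_sub t₀).const_mul (2 * L)).exp).const_mul (-(M / 2))
        convert! this using 1
        simp only [id]; ring
      have hI := intervalIntegral.integral_eq_sub_of_hasDerivAt hd
        (by apply Continuous.intervalIntegrable; fun_prop)
      have hle := intervalIntegral.norm_integral_le_of_norm_le (μ := MeasureTheory.volume)
        (f := φ) (g := fun s => L * (M * Real.exp (2 * L * (t₀ - s)))) h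
        (Filter.Eventually.of_forall fun s hs => by
          have := hφ s
          simp only [hw] at this
          rwa [abs_of_nonpos (by linarith [hs.2] : s - t₀ ≤ 0), neg_sub] at this)
        (by apply Continuous.intervalIntegrable; fun_prop)
      rw [hI] at hle
      rw [intervalIntegral.integral_symm, norm_neg]
      refine hle.trans ?_
      simp only [hw, abs_of_nonpos (sub_nonpos.2 h), neg_sub, sub_self, mul_zero, Real.exp_zero]
      linarith
  obtain ⟨y, hyS, hy, -⟩ := exists_fixed_point_of_weighted_contraction w
    {u | Continuous u} (fun u z ε hu hε hb => by
      -- The weight is locally bounded, so weighted convergence is locally uniform and preserves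
      -- continuity.
      have : TendstoLocallyUniformly u z atTop := by
        rw [Metric.tendstoLocallyUniformly_iff]
        intro e he x
        have hε' : Tendsto (fun n => |ε n| * (w x + 1)) atTop (𝓝 0) := by
          simpa using hε.abs.mul_const (w x + 1)
        refine ⟨{t | w t < w x + 1}, (isOpen_lt hwc continuous_const).mem_nhds (by simp), ?_⟩
        filter_upwards [hε'.eventually (gt_mem_nhds he)] with n hn t ht
        rw [dist_comm, dist_eq_norm]
        refine (hb n t).trans_lt (lt_of_le_of_lt ?_ hn)
        exact mul_le_mul (le_abs_self _) (le_of_lt ht) (hw0 t).le (abs_nonneg _)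
      exact this.continuous (Filter.Frequently.of_forall hu))
    T (fun u hu => continuous_iff_continuousAt.2 fun t => (hTd u hu t).continuousAt)
    (β := 1 / 2) (by norm_num) (by norm_num)
    (fun u hu z hz M hM h t => by
      simp only [hT, add_sub_add_left_eq_sub]
      rw [← intervalIntegral.integral_sub ((hcont u hu).intervalIntegrable _ _)
        ((hcont z hz).intervalIntegrable _ _)]
      exact hint M hM _ (fun s => (hv _ _ _).trans (mul_le_mul_of_nonneg_left (h s) hL.le)) t)
    (fun _ => x₀) continuous_const (M₀ := 1 / 2 * (C / L)) (by positivity)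
    (fun t => by
      simp only [hT, add_sub_cancel_left]
      refine hint (C / L) (by positivity) _ (fun s => ?_) t
      rw [← mul_assoc, mul_div_cancel₀ _ hL.ne']
      refine (hC s).trans (le_mul_of_one_le_right hC0 ?_)
      exact Real.one_le_exp (by positivity))
  refine ⟨y, ?_, fun t => ?_⟩
  · rw [← hy]; simp [hT]
  · have := hTd y hyS t
    rwa [hy] at this

/-- Uniqueness for a differential equation with a globally Lipschitz right-hand side. -/
theorem global_solution_unique {v : ℝ → E → E} {L : ℝ} (hL : 0 ≤ L)
    (hv : ∀ t x y, ‖v t x - v t y‖ ≤ L * ‖x - y‖) {y z : ℝ → E}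
    (hy : ∀ t, HasDerivAt y (v t (y t)) t) (hz : ∀ t, HasDerivAt z (v t (z t)) t) {t₀ : ℝ}
    (h : y t₀ = z t₀) : y = z := by
  refine ODE_solution_unique_univ (K := ⟨L, hL⟩) (s := fun _ => univ) (t₀ := t₀) (v := v)
    (fun t => ?_) (fun t => ⟨hy t, trivial⟩) (fun t => ⟨hz t, trivial⟩) h
  exact (LipschitzWith.of_dist_le_mul fun x y => by
    rw [dist_eq_norm, dist_eq_norm]; exact hv t x y).lipschitzOnWith

end General

/-- Constants that control a vector field near a hyperbolic orbit. -/
structure HypData where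
  Lf : ℝ
  B : ℝ
  K : ℝ
  κ : ℝ
  modulus : ℝ → ℝ
  one_le_Lf : 1 ≤ Lf
  one_le_B : 1 ≤ B
  one_le_K : 1 ≤ K
  κ_pos : 0 < κ
  modulus_pos : ∀ ω, 0 < ω → 0 < modulus ω

/-! ### Solutions near one hyperbolic orbit and the linearized flow. -/

section OneOrbit

variable {E : Type*} [NormedAddCommGroup E] [NormedSpace ℝ E]

/-- A hyperbolic orbit `x` of the vector field `f`: the invariant splitting along the orbit is given
by projections `Ps`, `Pu` and the phase functional `ph`, and `U s t` is the linearized flow. -/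
structure HypOrbit (D : HypData) (f : E → E) (x : ℝ → E) where
  differentiable : Differentiable ℝ f
  norm_fderiv_le : ∀ z, ‖fderiv ℝ f z‖ ≤ D.Lf
  fderiv_modulus : ∀ ω, 0 < ω → ∀ y z, ‖y - z‖ ≤ D.modulus ω → ‖fderiv ℝ f y - fderiv ℝ f z‖ ≤ ω
  orbit : ∀ t, HasDerivAt x (f (x t)) t
  norm_vel_le : ∀ t, ‖f (x t)‖ ≤ D.B
  Ps : ℝ → E →L[ℝ] E
  Pu : ℝ → E →L[ℝ] E
  ph : ℝ → E →L[ℝ] ℝ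
  decomp : ∀ t v, Ps t v + Pu t v + ph t v • f (x t) = v
  norm_Pu_le : ∀ t v, ‖Pu t v‖ ≤ D.K * ‖v‖
  norm_ph_le : ∀ t v, |ph t v| ≤ D.K * ‖v‖
  ph_vel : ∀ t, ph t (f (x t)) = 1
  Pu_vel : ∀ t, Pu t (f (x t)) = 0
  Pu_Pu : ∀ t v, Pu t (Pu t v) = Pu t v
  U : ℝ → ℝ → E →L[ℝ] E
  hasDerivAt_U : ∀ s v t, HasDerivAt (fun t => U s t v) (fderiv ℝ f (x t) (U s t v)) t
  U_self : ∀ s v, U s s v = v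
  U_comp : ∀ s t r v, U t r (U s t v) = U s r v
  U_vel : ∀ s t, U s t (f (x s)) = f (x t)
  Pu_U : ∀ s t v, Pu t (U s t v) = U s t (Pu s v)
  ph_U : ∀ s t v, ph t (U s t v) = ph s v
  norm_U_Ps_le : ∀ s t v, s ≤ t → ‖U s t (Ps s v)‖ ≤ D.K * Real.exp (-D.κ * (t - s)) * ‖v‖
  norm_U_Pu_le : ∀ s t v, t ≤ s → ‖U s t (Pu s v)‖ ≤ D.K * Real.exp (-D.κ * (s - t)) * ‖v‖

/-- `y` is a solution of `y' = f(y) + h(t)`. -/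
def IsForced (f : E → E) (h y : ℝ → E) : Prop :=
  ∀ t, HasDerivAt y (f (y t) + h t) t

theorem IsForced.shift {f : E → E} {h y : ℝ → E} (hy : IsForced f h y) (a : ℝ) :
    IsForced f (fun t => h (a + t)) (fun t => y (a + t)) := fun t =>
  (hy (a + t)).comp_const_add a t

theorem IsForced.continuous {f : E → E} {h y : ℝ → E} (hy : IsForced f h y) : Continuous y :=
  continuous_iff_continuousAt.2 fun t => (hy t).continuousAt

namespace HypOrbit

variable {D : HypData} {f : E → E} {x : ℝ → E} (H : HypOrbit D f x)

include H

theorem norm_vel_sub_le (y z : E) : ‖f y - f z‖ ≤ D.Lf * ‖y - z‖ :=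
  convex_univ.norm_image_sub_le_of_norm_fderiv_le (fun w _ => H.differentiable w)
    (fun w _ => H.norm_fderiv_le w) trivial trivial

theorem norm_orbit_sub_le (a b : ℝ) : ‖x b - x a‖ ≤ D.B * |b - a| :=
  norm_sub_le_of_hasDerivAt_bound convex_univ (fun t _ => H.orbit t) (fun t _ => H.norm_vel_le t)
    trivial trivial

theorem norm_vel_le_of_near {t : ℝ} {y : E} : ‖f y‖ ≤ D.B + D.Lf * ‖y - x t‖ := by
  have h1 := H.norm_vel_sub_le y (x t)
  have h2 := H.norm_vel_le t
  have h3 : f y = (f y - f (x t)) + f (x t) := by abel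
  rw [h3]
  exact (norm_add_le _ _).trans (by linarith)

theorem isForced_orbit (s : ℝ) : IsForced f (fun _ => 0) (fun t => x (s + t)) := fun t => by
  simpa using (H.orbit (s + t)).comp_const_add s t

/-- Solutions with nearby forcings stay close for bounded times. -/
theorem norm_sub_le_of_forced {h h' y y' : ℝ → E} (hy : IsForced f h y) (hy' : IsForced f h' y')
    {b μ : ℝ} (hμ : 0 ≤ μ) (hh : ∀ r ∈ Icc 0 b, ‖h r - h' r‖ ≤ μ) :
    ∀ r ∈ Icc 0 b, ‖y r - y' r‖ ≤ Real.exp (D.Lf * b) * (‖y 0 - y' 0‖ + μ) := by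
  refine norm_le_exp_mul_of_norm_deriv_le (u := fun r => y r - y' r) D.one_le_Lf hμ
    (fun t _ => (hy t).sub (hy' t)) (fun t ht => ?_)
  have : f (y t) + h t - (f (y' t) + h' t) = (f (y t) - f (y' t)) + (h t - h' t) := by abel
  rw [this]
  exact (norm_add_le _ _).trans (add_le_add (H.norm_vel_sub_le _ _) (hh t ht))

theorem norm_sub_orbit_le {h y : ℝ → E} (hy : IsForced f h y) {s b μ : ℝ} (hμ : 0 ≤ μ)
    (hh : ∀ r ∈ Icc 0 b, ‖h r‖ ≤ μ) :
    ∀ r ∈ Icc 0 b, ‖y r - x (s + r)‖ ≤ Real.exp (D.Lf * b) * (‖y 0 - x s‖ + μ) := by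
  have := H.norm_sub_le_of_forced hy (H.isForced_orbit s) hμ (b := b)
    (fun r hr => by simpa using hh r hr)
  simpa using this

omit H in
/-- The differences of two solutions near a hyperbolic orbit, after flight times close to `T`, are
given by the linearized flow, up to a small Lipschitz error. -/
theorem step (D : HypData) {T κ₀ : ℝ} (hT : 1 ≤ T) (hκ : 0 < κ₀) :
    ∃ δ > 0, δ ≤ 1 ∧ ∃ C ≥ 1, ∀ (f : E → E) (x : ℝ → E) (H : HypOrbit D f x) (s : ℝ)
      (h h' y y' : ℝ → E), IsForced f h y → IsForced f h' y' → (∀ r, ‖h r‖ ≤ δ) →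
      (∀ r, ‖h' r‖ ≤ δ) → ‖y 0 - x s‖ ≤ δ → ‖y' 0 - x s‖ ≤ δ → ∀ θ θ' : ℝ, |θ| ≤ δ → |θ'| ≤ δ →
      ∀ μ : ℝ, (∀ r ∈ Icc 0 (T + 1), ‖h r - h' r‖ ≤ μ) →
      ‖(y (T + θ) - y' (T + θ')) - H.U s (s + T) (y 0 - y' 0) - (θ - θ') • f (x (s + T))‖
        ≤ κ₀ * (‖y 0 - y' 0‖ + |θ - θ'|) + C * μ := by
  have hL := D.one_le_Lf
  have hB := D.one_le_B
  set L := D.Lf with hLdef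
  set G := Real.exp (L * (T + 1)) with hG
  have hG1 : 1 ≤ G := Real.one_le_exp (by positivity)
  -- Two Grönwall factors turn the oscillation `ω` of the derivative into `G * ω * G = κ₀ / 2`; the
  -- other half of `κ₀` is spent on the drift during the time `θ`.
  set ω := κ₀ / (2 * G ^ 2) with hω
  have hωpos : 0 < ω := by positivity
  -- In this order the bounds give: time corrections of at most 1; a tube of radius `2 * G * δ` in
  -- which the derivative varies by at most `ω`; a change of the difference during `θ` by at most
  -- `κ₀ / 2` of its initial size, up to forcing terms; a velocity of `y'` near time `T` that is
  -- within `κ₀` of `f (x (s + T))`.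
  set δ := min 1 (min (D.modulus ω / (2 * G)) (min (κ₀ / (2 * L * G)) (κ₀ / (L * (2 * G + D.B) + 1))))
    with hδ
  have hmod := D.modulus_pos ω hωpos
  have hδpos : 0 < δ := by
    have : 0 < L * (2 * G + D.B) + 1 := by positivity
    simp only [hδ, lt_min_iff]
    refine ⟨one_pos, ?_, ?_, ?_⟩ <;> positivity
  have hδ1 : δ ≤ 1 := min_le_left _ _
  have hδ2 : 2 * G * δ ≤ D.modulus ω := by
    have : δ ≤ D.modulus ω / (2 * G) := (min_le_right _ _).trans (min_le_left _ _)
    rw [le_div_iff₀ (by positivity)] at this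
    linarith
  have hδ3 : L * G * δ ≤ κ₀ / 2 := by
    have : δ ≤ κ₀ / (2 * L * G) :=
      (min_le_right _ _).trans ((min_le_right _ _).trans (min_le_left _ _))
    rw [le_div_iff₀ (by positivity)] at this
    linarith
  have hδ4 : (L * (2 * G + D.B) + 1) * δ ≤ κ₀ := by
    have : δ ≤ κ₀ / (L * (2 * G + D.B) + 1) :=
      (min_le_right _ _).trans ((min_le_right _ _).trans (min_le_right _ _))
    rw [le_div_iff₀ (by positivity)] at this
    linarith
  refine ⟨δ, hδpos, hδ1, G * (ω * G + 1) + L * G + 1, ?_, ?_⟩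
  · have : 0 ≤ G * (ω * G + 1) + L * G := by positivity
    linarith
  intro f x H s h h' y y' hy hy' hh hh' h0 h0' θ θ' hθ hθ' μ hμ
  have hμ0 : 0 ≤ μ := (norm_nonneg _).trans (hμ 0 ⟨le_rfl, by linarith⟩)
  have near : ∀ r ∈ Icc 0 (T + 1), ‖y r - x (s + r)‖ ≤ 2 * G * δ := fun r hr => by
    refine (H.norm_sub_orbit_le hy hδpos.le (fun r _ => hh r) r hr).trans ?_
    calc _ ≤ G * (δ + δ) := mul_le_mul_of_nonneg_left (by linarith) (by positivity)
      _ = _ := by ring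
  have near' : ∀ r ∈ Icc 0 (T + 1), ‖y' r - x (s + r)‖ ≤ 2 * G * δ := fun r hr => by
    refine (H.norm_sub_orbit_le hy' hδpos.le (fun r _ => hh' r) r hr).trans ?_
    calc _ ≤ G * (δ + δ) := mul_le_mul_of_nonneg_left (by linarith) (by positivity)
      _ = _ := by ring
  set Δ := ‖y 0 - y' 0‖ with hΔ
  have hΔ0 : 0 ≤ Δ := norm_nonneg _
  have hdiff := H.norm_sub_le_of_forced hy hy' hμ0 hμ
  -- comparison with the linearized flow
  have hlin : ‖(y T - y' T) - H.U s (s + T) (y 0 - y' 0)‖ ≤ G * (ω * (G * (Δ + μ)) + μ) := by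
    have key := norm_le_exp_mul_of_norm_deriv_le
      (u := fun r => (y r - y' r) - H.U s (s + r) (y 0 - y' 0))
      (u' := fun r => (f (y r) + h r - (f (y' r) + h' r))
        - fderiv ℝ f (x (s + r)) (H.U s (s + r) (y 0 - y' 0)))
      (L := L) (ε := ω * (G * (Δ + μ)) + μ) (b := T + 1) hL (by positivity)
      (fun r _ => ((hy r).fun_sub (hy' r)).fun_sub
        ((H.hasDerivAt_U s (y 0 - y' 0) (s + r)).comp_const_add s r))
      (fun r hr => by
        have e : f (y r) + h r - (f (y' r) + h' r)
            - fderiv ℝ f (x (s + r)) (H.U s (s + r) (y 0 - y' 0))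
            = fderiv ℝ f (x (s + r)) ((y r - y' r) - H.U s (s + r) (y 0 - y' 0))
              + ((f (y r) - f (y' r) - fderiv ℝ f (x (s + r)) (y r - y' r)) + (h r - h' r)) := by
          simp only [map_sub]; abel
        rw [e]
        have e1 : ‖f (y r) - f (y' r) - fderiv ℝ f (x (s + r)) (y r - y' r)‖ ≤ ω * ‖y r - y' r‖ := by
          refine (convex_closedBall (x (s + r)) (2 * G * δ)).norm_image_sub_le_of_norm_hasFDerivWithin_le'
            (f' := fun z => fderiv ℝ f z)
            (fun z _ => (H.differentiable z).hasFDerivAt.hasFDerivWithinAt) (fun z hz => ?_) ?_ ?_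
          · refine H.fderiv_modulus ω hωpos _ _ ?_
            rw [mem_closedBall_iff_norm] at hz
            exact hz.trans hδ2
          · rw [mem_closedBall_iff_norm]; exact near' r hr
          · rw [mem_closedBall_iff_norm]; exact near r hr
        refine (norm_add_le _ _).trans (add_le_add ?_ ((norm_add_le _ _).trans
          (add_le_add (e1.trans ?_) (hμ r hr))))
        · exact (ContinuousLinearMap.le_opNorm _ _).trans
            (mul_le_mul_of_nonneg_right (H.norm_fderiv_le _) (norm_nonneg _))
        · exact mul_le_mul_of_nonneg_left (hdiff r hr) hωpos.le)
      T ⟨by linarith, by linarith⟩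
    simpa [H.U_self] using key
  have hθ1 := abs_le.1 (hθ.trans hδ1)
  have hθ1' := abs_le.1 (hθ'.trans hδ1)
  have hTI : T ∈ Icc (0 : ℝ) (T + 1) := ⟨by linarith, by linarith⟩
  have hTθ : T + θ ∈ Icc (0 : ℝ) (T + 1) := ⟨by linarith, by linarith⟩
  -- the difference changes little during the time `θ`
  have hA : ‖(y (T + θ) - y' (T + θ)) - (y T - y' T)‖ ≤ (L * (G * (Δ + μ)) + μ) * |θ| := by
    have := norm_sub_le_of_hasDerivAt_bound (u := fun r => y r - y' r)
      (u' := fun r => f (y r) + h r - (f (y' r) + h' r)) (convex_Icc (0 : ℝ) (T + 1))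
      (fun r _ => (hy r).fun_sub (hy' r)) (C := L * (G * (Δ + μ)) + μ) (fun r hr => by
        have e : f (y r) + h r - (f (y' r) + h' r) = (f (y r) - f (y' r)) + (h r - h' r) := by abel
        rw [e]
        refine (norm_add_le _ _).trans (add_le_add ((H.norm_vel_sub_le _ _).trans ?_) (hμ r hr))
        exact mul_le_mul_of_nonneg_left (hdiff r hr) (by linarith)) hTI hTθ
    simpa using this
  -- Unequal flight times shift `y'` along the velocity of the orbit, up to a small multiple of `|θ
  -- - θ'|`. This is the neutral direction that the later choice of sections eliminates.
  have hBd : ‖y' (T + θ) - y' (T + θ') - (θ - θ') • f (x (s + T))‖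
      ≤ ((L * (2 * G + D.B) + 1) * δ) * |θ - θ'| := by
    have := norm_sub_sub_smul_le_of_hasDerivAt (u := y') (u' := fun r => f (y' r) + h' r)
      (v := f (x (s + T))) (convex_Icc (T - δ) (T + δ))
      (fun r _ => hy' r) (C := (L * (2 * G + D.B) + 1) * δ) (fun r hr => by
        have hr1 : r ∈ Icc (0 : ℝ) (T + 1) := ⟨by linarith [hr.1], by linarith [hr.2]⟩
        have e : f (y' r) + h' r - f (x (s + T))
          = (f (y' r) - f (x (s + T))) + h' r := by abel
        rw [e]
        have e1 : ‖y' r - x (s + T)‖ ≤ 2 * G * δ + D.B * δ := by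
          have e2 : y' r - x (s + T) = (y' r - x (s + r)) + (x (s + r) - x (s + T)) := by abel
          rw [e2]
          refine (norm_add_le _ _).trans (add_le_add (near' r hr1) ?_)
          refine (H.norm_orbit_sub_le _ _).trans (mul_le_mul_of_nonneg_left ?_ (by linarith))
          rw [abs_le]; constructor <;> linarith [hr.1, hr.2]
        refine (norm_add_le _ _).trans ?_
        have e3 := (H.norm_vel_sub_le (y' r) (x (s + T))).trans
          (mul_le_mul_of_nonneg_left e1 (by linarith : 0 ≤ L))
        have e4 := hh' r
        nlinarith)
      (a := T + θ') (b := T + θ) ⟨by linarith [(abs_le.1 hθ').1], by linarith [(abs_le.1 hθ').2]⟩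
      ⟨by linarith [(abs_le.1 hθ).1], by linarith [(abs_le.1 hθ).2]⟩
    simpa using this
  have e : (y (T + θ) - y' (T + θ')) - H.U s (s + T) (y 0 - y' 0) - (θ - θ') • f (x (s + T))
      = ((y T - y' T) - H.U s (s + T) (y 0 - y' 0))
        + ((y (T + θ) - y' (T + θ)) - (y T - y' T))
        + (y' (T + θ) - y' (T + θ') - (θ - θ') • f (x (s + T))) := by abel
  rw [e]
  refine (norm_add₃_le).trans ((add_le_add (add_le_add hlin hA) hBd).trans ?_)
  have hωG : G * (ω * G) = κ₀ / 2 := by rw [hω]; field_simp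
  have hA1 : (L * (G * (Δ + μ)) + μ) * |θ| ≤ κ₀ / 2 * Δ + (L * G + 1) * μ := by
    have i1 : L * (G * Δ) * |θ| ≤ κ₀ / 2 * Δ := by
      calc L * (G * Δ) * |θ| ≤ L * (G * Δ) * δ := mul_le_mul_of_nonneg_left hθ (by positivity)
        _ = (L * G * δ) * Δ := by ring
        _ ≤ _ := mul_le_mul_of_nonneg_right hδ3 hΔ0
    have i2 : (L * (G * μ) + μ) * |θ| ≤ (L * (G * μ) + μ) * 1 :=
      mul_le_mul_of_nonneg_left (hθ.trans hδ1) (by positivity)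
    calc _ = L * (G * Δ) * |θ| + (L * (G * μ) + μ) * |θ| := by ring
      _ ≤ _ := by linarith
  have hB1 := mul_le_mul_of_nonneg_right hδ4 (abs_nonneg (θ - θ'))
  have hC1 : G * (ω * (G * (Δ + μ)) + μ) = κ₀ / 2 * Δ + G * (ω * G + 1) * μ := by
    calc _ = (G * (ω * G)) * Δ + G * (ω * G + 1) * μ := by ring
      _ = _ := by rw [hωG]
  rw [hC1]
  linarith

end HypOrbit

end OneOrbit

/-! ### Phases of shadowing solutions and crossings of sections. -/

section Phases

variable {E : Type*} [NormedAddCommGroup E] [NormedSpace ℝ E]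

/-- From time `τ` on, the forced solution `y` is `δ`-close to the orbit `x` with phase `φ`. -/
structure Shadows (f : E → E) (x : ℝ → E) (h y : ℝ → E) (φ : ℝ → ℝ) (δ τ : ℝ) : Prop where
  forced : IsForced f h y
  bound : ∀ t, ‖h t‖ ≤ δ
  continuous : Continuous φ
  near : ∀ t, τ ≤ t → ‖y t - x (φ t)‖ ≤ δ

theorem Shadows.nonneg {f : E → E} {x h y : ℝ → E} {φ : ℝ → ℝ} {δ τ : ℝ}
    (S : Shadows f x h y φ δ τ) : 0 ≤ δ := (norm_nonneg _).trans (S.bound 0)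

/-- Quantitative control of the phases of a solution that shadows `x`, with error constant `C`
for time intervals of length at most `N`. -/
structure PhaseControl (x y : ℝ → E) (ph : ℝ → E →L[ℝ] ℝ) (φ : ℝ → ℝ) (C N δ τ : ℝ) : Prop where
  increment : ∀ t, τ ≤ t → ∀ r ∈ Icc 0 N, |φ (t + r) - φ t - r| ≤ C * δ
  growth : ∀ t, τ ≤ t → ∀ r, 0 ≤ r → r / 2 - 1 ≤ φ (t + r) - φ t ∧ φ (t + r) - φ t ≤ 3 / 2 * r + 1
  exists_section : ∀ s, φ (τ + 1) ≤ s → ∃ t, τ ≤ t ∧ ph s (y t - x s) = 0 ∧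
    ‖y t - x s‖ ≤ C * δ ∧ |φ t - s| ≤ C * δ

/-- By `growth`, a phase difference of at most `S` forces a time difference of at most `2 * S + 2`,
which is short enough for `increment` to apply. -/
theorem PhaseControl.abs_sub_sub_le {x y : ℝ → E} {ph : ℝ → E →L[ℝ] ℝ} {φ : ℝ → ℝ}
    {C N δ τ : ℝ} (P : PhaseControl x y ph φ C N δ τ) {t t' S : ℝ} (ht : τ ≤ t) (ht' : τ ≤ t')
    (hS : |φ t' - φ t| ≤ S) (hN : 2 * S + 2 ≤ N) :
    |(t' - t) - (φ t' - φ t)| ≤ C * δ := by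
  have hS' := abs_le.1 hS
  rcases le_total t t' with h | h
  · have h1 := P.growth t ht (t' - t) (by linarith)
    rw [add_sub_cancel] at h1
    have h2 := P.increment t ht (t' - t) ⟨by linarith, by linarith⟩
    rw [add_sub_cancel] at h2
    rwa [abs_sub_comm]
  · have h1 := P.growth t' ht' (t - t') (by linarith)
    rw [add_sub_cancel] at h1
    have h2 := P.increment t' ht' (t - t') ⟨by linarith, by linarith⟩
    rw [add_sub_cancel] at h2
    refine le_trans (le_of_eq ?_) h2
    congr 1; ring

namespace HypOrbit

variable {D : HypData} {f : E → E} {x : ℝ → E} (H : HypOrbit D f x)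

include H

/-- A hyperbolic orbit is locally injective, in a quantitative way. -/
theorem abs_sub_le_of_close {a b : ℝ} (hab : |a - b| ≤ 1 / (2 * D.K * D.Lf * D.B)) :
    |a - b| ≤ 2 * D.K * ‖x a - x b‖ := by
  have hL := D.one_le_Lf
  have hB := D.one_le_B
  have hK := D.one_le_K
  have h1 : ‖x a - x b - (a - b) • f (x b)‖ ≤ (D.Lf * (D.B * |a - b|)) * |a - b| := by
    refine norm_sub_sub_smul_le_of_hasDerivAt (convex_uIcc b a) (fun t _ => H.orbit t)
      (fun t ht => ?_) left_mem_uIcc right_mem_uIcc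
    refine (H.norm_vel_sub_le _ _).trans (mul_le_mul_of_nonneg_left ?_ (by linarith))
    refine (H.norm_orbit_sub_le _ _).trans (mul_le_mul_of_nonneg_left ?_ (by linarith))
    exact abs_sub_left_of_mem_uIcc ht
  -- The phase functional takes the value 1 on the velocity, so it reads off the parameter
  -- difference; the quadratic error is absorbed because `|a - b|` is small.
  have h2 : |H.ph b (x a - x b) - (a - b)| ≤ 1 / 2 * |a - b| := by
    have e : H.ph b (x a - x b) - (a - b) = H.ph b (x a - x b - (a - b) • f (x b)) := by
      rw [map_sub _ (x a - x b), map_smul, H.ph_vel, smul_eq_mul, mul_one]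
    rw [e]
    refine (H.norm_ph_le _ _).trans ((mul_le_mul_of_nonneg_left h1 (by linarith)).trans ?_)
    rw [le_div_iff₀ (by positivity)] at hab
    nlinarith [abs_nonneg (a - b)]
  have h3 := H.norm_ph_le b (x a - x b)
  have h4 := abs_sub_abs_le_abs_sub (a - b) (H.ph b (x a - x b))
  rw [abs_sub_comm (a - b)] at h4
  linarith

-- Each unit of time contributes an increment between 1/2 and 3/2; the remaining fraction of a unit
-- is covered by the additive constant.
omit [NormedAddCommGroup E] [NormedSpace ℝ E] H in
theorem phase_growth {φ : ℝ → ℝ} {τ : ℝ}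
    (hinc : ∀ t, τ ≤ t → ∀ r ∈ Icc (0 : ℝ) 1, |φ (t + r) - φ t - r| ≤ 1 / 2) :
    ∀ t, τ ≤ t → ∀ r, 0 ≤ r → r / 2 - 1 ≤ φ (t + r) - φ t ∧ φ (t + r) - φ t ≤ 3 / 2 * r + 1 := by
  have hn : ∀ t, τ ≤ t → ∀ n : ℕ, (n : ℝ) / 2 ≤ φ (t + n) - φ t ∧ φ (t + n) - φ t ≤ 3 / 2 * n := by
    intro t ht n
    induction n with
    | zero => simp
    | succ n ih =>
      have h1 := abs_le.1 (hinc (t + n) (by have := n.cast_nonneg (α := ℝ); linarith) 1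
        ⟨zero_le_one, le_rfl⟩)
      push_cast
      rw [← add_assoc]
      constructor <;> linarith
  intro t ht r hr
  have h1 := hn t ht ⌊r⌋₊
  have hf := Nat.floor_le hr
  have hf' := (Nat.lt_floor_add_one r).le
  have h2 := abs_le.1 (hinc (t + ⌊r⌋₊) (by have := (⌊r⌋₊).cast_nonneg (α := ℝ); linarith)
    (r - ⌊r⌋₊) ⟨by linarith, by linarith⟩)
  have e : t + (⌊r⌋₊ : ℝ) + (r - ⌊r⌋₊) = t + r := by ring
  rw [e] at h2
  constructor <;> linarith

-- The drift of the phase is controlled by a continuity argument: both `x (φ (t + r))` and `x (φ t +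
-- r)` are near `y (t + r)`, and `x` is locally injective, so a drift below a fixed threshold is in
-- fact of order `δ`. Starting from zero, the drift can never reach the threshold. For the sections,
-- the phase component of `y - x s` has slope close to 1 in time and hence a zero near the time when
-- the phase equals `s`.
omit H in
theorem phaseControl (D : HypData) (N : ℝ) (hN : 1 ≤ N) :
    ∃ δ₁ > 0, δ₁ ≤ 1 ∧ ∃ C ≥ 1, C * δ₁ ≤ 1 / 16 ∧ ∀ (f : E → E) (x : ℝ → E) (H : HypOrbit D f x)
      (h y : ℝ → E) (φ : ℝ → ℝ) (δ τ : ℝ), Shadows f x h y φ δ τ → δ ≤ δ₁ →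
      PhaseControl x y H.ph φ C N δ τ := by
  have hL := D.one_le_Lf
  have hB := D.one_le_B
  have hK := D.one_le_K
  set G := Real.exp (D.Lf * N) with hG
  have hG1 : 1 ≤ G := Real.one_le_exp (by positivity)
  set r₀ := 1 / (2 * D.K * D.Lf * D.B) with hr₀
  have hr₀pos : 0 < r₀ := by positivity
  set C₁ := 2 * D.K * (2 * G + 1) with hC₁
  have hC₁pos : 0 < C₁ := by positivity
  set C₀ := 1 + (D.B + 2 * D.Lf) * (4 * D.K) with hC₀
  have hC₀pos : 1 ≤ C₀ := by
    have : 0 ≤ (D.B + 2 * D.Lf) * (4 * D.K) := by positivity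
    linarith
  set C := C₁ + C₀ + 4 * D.K with hC
  have hC1 : 1 ≤ C := by linarith
  -- The first bound leaves a gap below the threshold `r₀`, the second keeps all time shifts below
  -- 1/16, and the third makes the slope error of the phase component at most 1/2.
  set δ₁ := min (r₀ / (2 * C)) (min (1 / (16 * C)) (1 / (2 * D.K * (D.Lf * C₀ + 1)))) with hδ₁
  have hδ₁pos : 0 < δ₁ := by
    simp only [hδ₁, lt_min_iff]
    refine ⟨?_, ?_, ?_⟩ <;> positivity
  have hδa : C * δ₁ ≤ r₀ / 2 := by
    have : δ₁ ≤ r₀ / (2 * C) := min_le_left _ _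
    rw [le_div_iff₀ (by positivity)] at this
    linarith
  have hδb : C * δ₁ ≤ 1 / 16 := by
    have : δ₁ ≤ 1 / (16 * C) := (min_le_right _ _).trans (min_le_left _ _)
    rw [le_div_iff₀ (by positivity)] at this
    linarith
  have hδc : D.K * (D.Lf * C₀ + 1) * δ₁ ≤ 1 / 2 := by
    have : δ₁ ≤ 1 / (2 * D.K * (D.Lf * C₀ + 1)) := (min_le_right _ _).trans (min_le_right _ _)
    rw [le_div_iff₀ (by positivity)] at this
    linarith
  have hδ1 : δ₁ ≤ 1 := by nlinarith
  refine ⟨δ₁, hδ₁pos, hδ1, C, hC1, hδb, ?_⟩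
  intro f x H h y φ δ τ S hδ
  have hδ0 := S.nonneg
  have inc : ∀ t, τ ≤ t → ∀ r ∈ Icc 0 N, |φ (t + r) - φ t - r| ≤ C₁ * δ := by
    intro t ht r hr
    set u : ℝ → ℝ := fun r => |φ (t + r) - φ t - r| with hu
    have huc : Continuous u := by
      have := S.continuous
      fun_prop
    have key : ∀ r ∈ Icc 0 N, u r ≤ r₀ → u r ≤ C₁ * δ := by
      intro r hr hur
      have h1 := H.norm_sub_orbit_le (S.forced.shift t) (s := φ t) (b := N) hδ0
        (fun r _ => S.bound (t + r)) r hr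
      simp only [add_zero] at h1
      have h2 := S.near t ht
      have h3 := S.near (t + r) (by linarith [hr.1])
      have h4 : ‖x (φ (t + r)) - x (φ t + r)‖ ≤ (2 * G + 1) * δ := by
        have e : x (φ (t + r)) - x (φ t + r)
          = (y (t + r) - x (φ t + r)) - (y (t + r) - x (φ (t + r))) := by abel
        rw [e]
        refine (norm_sub_le _ _).trans ?_
        have : G * (‖y t - x (φ t)‖ + δ) ≤ G * (δ + δ) :=
          mul_le_mul_of_nonneg_left (by linarith) (by positivity)
        linarith
      have e : u r = |φ (t + r) - (φ t + r)| := by simp only [hu]; congr 1; ring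
      rw [e] at hur ⊢
      refine (H.abs_sub_le_of_close hur).trans ?_
      rw [hC₁, mul_assoc (2 * D.K) (2 * G + 1) δ]
      exact mul_le_mul_of_nonneg_left h4 (by positivity)
    by_contra hcon
    push Not at hcon
    have hCδ : C₁ * δ < r₀ := by
      have : C₁ * δ ≤ C * δ₁ := mul_le_mul (by linarith) hδ hδ0 (by linarith)
      linarith
    -- If the drift exceeded `C₁ * δ`, it would take the value `min (u r) r₀` at some earlier time,
    -- a value in the forbidden gap.
    have hmem : min (u r) r₀ ∈ Icc (u 0) (u r) := by
      refine ⟨?_, min_le_left _ _⟩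
      have : u 0 = 0 := by simp [hu]
      rw [this]
      exact le_min (abs_nonneg _) hr₀pos.le
    obtain ⟨r', hr', hur'⟩ := intermediate_value_Icc hr.1 huc.continuousOn hmem
    have := key r' ⟨hr'.1, hr'.2.trans hr.2⟩ (hur'.le.trans (min_le_right _ _))
    rw [hur'] at this
    exact absurd this (not_le.2 (lt_min hcon hCδ))
  have inc' : ∀ t, τ ≤ t → ∀ r ∈ Icc 0 N, |φ (t + r) - φ t - r| ≤ C * δ := fun t ht r hr =>
    (inc t ht r hr).trans (mul_le_mul_of_nonneg_right (by linarith) hδ0)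
  have hCδ : C * δ ≤ 1 / 16 := (mul_le_mul_of_nonneg_left hδ (by linarith)).trans hδb
  have gr := phase_growth (φ := φ) (τ := τ) (fun t ht r hr =>
    (inc' t ht r ⟨hr.1, hr.2.trans hN⟩).trans (by linarith))
  refine ⟨inc', gr, ?_⟩
  intro s hs
  -- a time at which the phase is `s`
  obtain ⟨t, ht, hts⟩ : ∃ t, τ + 1 ≤ t ∧ φ t = s := by
    set R := 2 * (s - φ (τ + 1) + 1) with hR
    have hR0 : 0 ≤ R := by linarith
    have h1 := (gr (τ + 1) (by linarith) R hR0).1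
    obtain ⟨t, ht, hts⟩ := intermediate_value_Icc (by linarith : τ + 1 ≤ τ + 1 + R)
      S.continuous.continuousOn (show s ∈ Icc (φ (τ + 1)) (φ (τ + 1 + R)) from ⟨hs, by linarith⟩)
    exact ⟨t, ht.1, hts⟩
  -- At time `t` the phase component is at most `D.K * δ` in absolute value and its slope is at
  -- least 1/2, so it changes sign within `4 * D.K * δ`. Since `ϱ ≤ 1 / 16`, the margin of 1 in `τ +
  -- 1` keeps the crossing time above `τ`.
  set ϱ := 4 * D.K * δ with hϱ
  have hϱ0 : 0 ≤ ϱ := by positivity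
  have hϱ1 : ϱ ≤ 1 / 16 := by
    refine le_trans ?_ hCδ
    exact mul_le_mul_of_nonneg_right (by linarith) hδ0
  have hnear : ∀ r ∈ Icc (t - ϱ) (t + ϱ), ‖y r - x s‖ ≤ C₀ * δ := by
    intro r hr
    have h1 := norm_sub_le_of_hasDerivAt_bound (u := y) (C := D.B + 2 * D.Lf)
      (convex_Icc (t - ϱ) (t + ϱ)) (fun t _ => S.forced t) (fun q hq => by
        have h2 := S.near q (by linarith [hq.1])
        have h3 := H.norm_vel_le_of_near (t := φ q) (y := y q)
        have h4 := S.bound q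
        have h5 : D.Lf * ‖y q - x (φ q)‖ ≤ D.Lf * 1 :=
          mul_le_mul_of_nonneg_left (by linarith) (by linarith)
        exact (norm_add_le _ _).trans (by linarith))
      (a := t) (b := r) ⟨by linarith, by linarith⟩ hr
    have h2 := S.near t (by linarith)
    rw [hts] at h2
    have h3 : |r - t| ≤ ϱ := by rw [abs_le]; constructor <;> linarith [hr.1, hr.2]
    have e : y r - x s = (y r - y t) + (y t - x s) := by abel
    rw [e]
    refine (norm_add_le _ _).trans ((add_le_add (h1.trans
      (mul_le_mul_of_nonneg_left h3 (by positivity))) h2).trans (le_of_eq ?_))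
    rw [hϱ, hC₀]; ring
  set c : ℝ → ℝ := fun r => H.ph s (y r - x s) with hc
  have hcc : Continuous c := (H.ph s).continuous.comp (S.forced.continuous.sub continuous_const)
  have hlin : ∀ r ∈ Icc (t - ϱ) (t + ϱ), |c r - c t - (r - t)| ≤ 1 / 2 * |r - t| := by
    intro r hr
    have h1 := norm_sub_sub_smul_le_of_hasDerivAt (u := y) (v := f (x s)) (C := (D.Lf * C₀ + 1) * δ)
      (convex_Icc (t - ϱ) (t + ϱ)) (fun t _ => S.forced t) (fun q hq => by
        have e : f (y q) + h q - f (x s) = (f (y q) - f (x s)) + h q := by abel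
        rw [e]
        have h2 := (H.norm_vel_sub_le (y q) (x s)).trans
          (mul_le_mul_of_nonneg_left (hnear q hq) (by linarith))
        exact (norm_add_le _ _).trans ((add_le_add h2 (S.bound q)).trans (le_of_eq (by ring))))
      (a := t) (b := r) ⟨by linarith, by linarith⟩ hr
    have e : c r - c t - (r - t) = H.ph s (y r - y t - (r - t) • f (x s)) := by
      simp only [hc, map_sub, map_smul, H.ph_vel, smul_eq_mul]; ring
    rw [e]
    refine (H.norm_ph_le _ _).trans ((mul_le_mul_of_nonneg_left h1 (by linarith)).trans ?_)
    rw [← mul_assoc]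
    refine mul_le_mul_of_nonneg_right ?_ (abs_nonneg _)
    refine le_trans ?_ hδc
    rw [← mul_assoc]
    exact mul_le_mul_of_nonneg_left hδ (by positivity)
  have hct : |c t| ≤ D.K * δ := by
    have h2 := S.near t (by linarith)
    rw [hts] at h2
    exact (H.norm_ph_le _ _).trans (mul_le_mul_of_nonneg_left h2 (by linarith))
  have hct' := abs_le.1 hct
  have hup : 0 ≤ c (t + ϱ) := by
    have := abs_le.1 (hlin (t + ϱ) ⟨by linarith, le_rfl⟩)
    rw [add_sub_cancel_left, abs_of_nonneg hϱ0] at this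
    linarith [mul_nonneg (show 0 ≤ D.K by linarith) hδ0]
  have hlo : c (t - ϱ) ≤ 0 := by
    have := abs_le.1 (hlin (t - ϱ) ⟨le_rfl, by linarith⟩)
    rw [sub_sub_cancel_left, abs_neg, abs_of_nonneg hϱ0] at this
    linarith [mul_nonneg (show 0 ≤ D.K by linarith) hδ0]
  obtain ⟨t', ht', hct0⟩ := intermediate_value_Icc (by linarith : t - ϱ ≤ t + ϱ)
    hcc.continuousOn (show (0 : ℝ) ∈ Icc (c (t - ϱ)) (c (t + ϱ)) from ⟨hlo, hup⟩)
  have ht'τ : τ ≤ t' := by linarith [ht'.1]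
  refine ⟨t', ht'τ, hct0, (hnear t' ht').trans ?_, ?_⟩
  · exact mul_le_mul_of_nonneg_right (by linarith) hδ0
  · have hd : |t' - t| ≤ ϱ := by rw [abs_le]; constructor <;> linarith [ht'.1, ht'.2]
    have hfin : |φ t' - φ t - (t' - t)| ≤ C₁ * δ := by
      rcases le_total t t' with hle | hle
      · have := inc t (by linarith) (t' - t) ⟨by linarith, by linarith [ht'.2]⟩
        rwa [add_sub_cancel] at this
      · have := inc t' ht'τ (t - t') ⟨by linarith, by linarith [ht'.1]⟩
        rw [add_sub_cancel] at this
        refine le_trans (le_of_eq ?_) this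
        rw [← abs_neg]; congr 1; ring
    rw [← hts]
    have e : φ t' - φ t = (φ t' - φ t - (t' - t)) + (t' - t) := by ring
    rw [e]
    refine (abs_add_le _ _).trans ((add_le_add hfin hd).trans ?_)
    have : 0 ≤ C₀ * δ := by positivity
    have e : C * δ = C₁ * δ + C₀ * δ + 4 * D.K * δ := by rw [hC]; ring
    rw [hϱ, e]; linarith

end HypOrbit

end Phases

/-! ### From crossing times to a phase function. -/

section Grid

/-- A two-sided sequence whose increments are within `b` of `T`. -/
theorem grid_sub_bounds {t : ℤ → ℝ} {T b : ℝ} (ht : ∀ j, |t (j + 1) - t j - T| ≤ b) (j : ℤ) (n : ℕ) :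
    (T - b) * n ≤ t (j + n) - t j ∧ t (j + n) - t j ≤ (T + b) * n := by
  induction n with
  | zero => simp
  | succ n ih =>
    have h := abs_le.1 (ht (j + n))
    push_cast
    rw [← add_assoc]
    constructor <;> linarith

theorem exists_grid_cell {t : ℤ → ℝ} {T b : ℝ} (ht : ∀ j, |t (j + 1) - t j - T| ≤ b) (hb : b < T)
    (r : ℝ) : ∃ j, t j ≤ r ∧ r < t (j + 1) := by
  have hT : 0 < T - b := by linarith
  obtain ⟨n, hn⟩ := exists_nat_gt (|r - t 0| / (T - b))
  rw [div_lt_iff₀ hT] at hn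
  have hr := abs_le.1 (le_refl |r - t 0|)
  obtain ⟨j, hj, hmax⟩ := Int.exists_greatest_of_bdd (P := fun j => t j ≤ r)
    ⟨n, fun z hz => by
      by_contra hcon
      push Not at hcon
      obtain ⟨k, hk⟩ := Int.eq_ofNat_of_zero_le (by omega : 0 ≤ z - 0)
      have := (grid_sub_bounds ht 0 k).1
      have hkn : (n : ℝ) ≤ k := by
        have : (n : ℤ) ≤ k := by omega
        exact_mod_cast this
      have e : (0 : ℤ) + k = z := by omega
      rw [e] at this
      nlinarith⟩
    ⟨-n, by
      have := (grid_sub_bounds ht (-n) n).1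
      rw [neg_add_cancel] at this
      linarith⟩
  refine ⟨j, hj, ?_⟩
  by_contra hcon
  push Not at hcon
  have := hmax (j + 1) hcon
  omega

variable {E : Type*} [NormedAddCommGroup E] [NormedSpace ℝ E]

/-- Phases of a solution that is close to the points `x (s₀ + j T)` at times `t j`. -/
theorem exists_phases_of_times (D : HypData) {T : ℝ} (hT : 4 ≤ T) :
    ∃ C ≥ 1, ∀ (f : E → E) (x : ℝ → E), HypOrbit D f x → ∀ (h y : ℝ → E) (η : ℝ), IsForced f h y →
      (∀ r, ‖h r‖ ≤ η) → ∀ (t : ℤ → ℝ) (s₀ b d : ℝ), b ≤ 1 → (∀ j, |t (j + 1) - t j - T| ≤ b) →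
      (∀ j : ℤ, ‖y (t j) - x (s₀ + j * T)‖ ≤ d) →
      ∃ φ : ℝ → ℝ, LipschitzWith 2 φ ∧ ∀ r, ∃ j : ℤ, t j ≤ r ∧ r < t (j + 1) ∧
        |φ r - (s₀ + j * T) - (r - t j)| ≤ 4 * b ∧ ‖y r - x (φ r)‖ ≤ C * (d + b + η) := by
  have hL := D.one_le_Lf
  have hB := D.one_le_B
  set G := Real.exp (D.Lf * (T + 1)) with hG
  have hG1 : 1 ≤ G := Real.one_le_exp (by positivity)
  refine ⟨G + 4 * D.B, by linarith, ?_⟩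
  intro f x H h y η hy hh t s₀ b d hb ht hd
  have hb0 : 0 ≤ b := (abs_nonneg _).trans (ht 0)
  have hd0 : 0 ≤ d := (norm_nonneg _).trans (hd 0)
  have hη0 : 0 ≤ η := (norm_nonneg _).trans (hh 0)
  have hTb : 0 < T - b := by linarith
  -- `q` is the Lipschitz constant of the assignment of the phase `s₀ + j * T` to the time `t j`,
  -- since neighbouring times are at least `T - b` apart.
  set q := T / (T - b) with hq
  have hq0 : 0 ≤ q := by positivity
  have hqT : q * (T - b) = T := div_mul_cancel₀ _ hTb.ne'
  have hq2 : q ≤ 2 := by rw [hq, div_le_iff₀ hTb]; linarith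
  have hmono : ∀ (i : ℤ) (n : ℕ), T * n ≤ q * |t (i + n) - t i| := by
    intro i n
    have h1 := (grid_sub_bounds ht i n).1
    calc T * n = q * ((T - b) * n) := by rw [← mul_assoc, hqT]
      _ ≤ _ := mul_le_mul_of_nonneg_left (h1.trans (le_abs_self _)) hq0
  have hpair : ∀ i j : ℤ, |((j : ℝ) - i) * T| ≤ q * |t j - t i| := by
    intro i j
    rcases le_total i j with hij | hij
    · obtain ⟨n, rfl⟩ := Int.le.dest hij
      have := hmono i n
      push_cast
      rw [add_sub_cancel_left, abs_of_nonneg (by positivity)]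
      linarith
    · obtain ⟨n, rfl⟩ := Int.le.dest hij
      have := hmono j n
      push_cast
      rw [abs_sub_comm (t j), sub_add_cancel_left, neg_mul, abs_neg, abs_of_nonneg (by positivity)]
      linarith
  have hinj : ∀ i j, t i = t j → i = j := by
    intro i j hij
    have := hpair i j
    rw [hij, sub_self, abs_zero, mul_zero] at this
    have h0 := abs_nonpos_iff.1 this
    have h1 : ((j : ℝ) - i) = 0 := by
      rcases mul_eq_zero.1 h0 with h | h
      · exact h
      · linarith
    have : (j : ℝ) = i := by linarith
    exact_mod_cast this.symm
  -- The phase is prescribed only at the grid times; a Lipschitz extension to the line takes the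
  -- place of interpolation.
  set g : ℝ → ℝ := fun r => s₀ + (Function.invFun t r : ℤ) * T with hg
  have hgt : ∀ j, g (t j) = s₀ + j * T := fun j => by
    simp only [hg, Function.leftInverse_invFun (fun i j => hinj i j) j]
  have hlip : LipschitzOnWith ⟨q, hq0⟩ g (range t) := by
    refine LipschitzOnWith.of_dist_le_mul ?_
    rintro _ ⟨i, rfl⟩ _ ⟨j, rfl⟩
    rw [hgt, hgt, Real.dist_eq, Real.dist_eq]
    have := hpair j i
    refine le_trans (le_of_eq ?_) this
    congr 1; ring
  obtain ⟨φ, hφ, hφg⟩ := hlip.extend_real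
  have hφt : ∀ j, φ (t j) = s₀ + j * T := fun j => by rw [← hφg (mem_range_self j), hgt]
  refine ⟨φ, hφ.weaken (by exact_mod_cast hq2), fun r => ?_⟩
  obtain ⟨j, hj, hj'⟩ := exists_grid_cell ht (by linarith) r
  have hlen := abs_le.1 (ht j)
  -- The Lipschitz bound from the left end of the cell limits the phase from above, the one from the
  -- right end limits it from below.
  have hφd : |φ r - (s₀ + j * T) - (r - t j)| ≤ 4 * b := by
    have h1 := hφ.dist_le_mul r (t j)
    have h2 := hφ.dist_le_mul (t (j + 1)) r
    rw [Real.dist_eq, Real.dist_eq, hφt] at h1 h2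
    change _ ≤ q * _ at h1
    change _ ≤ q * _ at h2
    rw [abs_of_nonneg (by linarith : 0 ≤ r - t j)] at h1
    rw [abs_of_nonneg (by linarith : 0 ≤ t (j + 1) - r)] at h2
    have h1' := (abs_le.1 h1).2
    have h2' := (abs_le.1 h2).2
    push_cast at h2'
    have hq1 : 0 ≤ q - 1 := by
      have : 1 ≤ q := by rw [hq, le_div_iff₀ hTb]; linarith
      linarith
    have hqb : (q - 1) * (T - b) = b := by rw [sub_mul, hqT]; ring
    have h5 : (q - 1) * (r - t j) ≤ (q - 1) * (2 * (T - b)) :=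
      mul_le_mul_of_nonneg_left (by linarith) hq1
    have h6 : q * (t (j + 1) - t j) ≤ q * ((T - b) + 2 * b) :=
      mul_le_mul_of_nonneg_left (by linarith) hq0
    have h7 : q * (2 * b) ≤ 2 * (2 * b) := mul_le_mul_of_nonneg_right hq2 (by linarith)
    have h8 : 0 ≤ (q - 1) * (r - t j) := mul_nonneg hq1 (by linarith)
    rw [abs_le]
    constructor
    · linarith
    · linarith
  refine ⟨j, hj, hj', hφd, ?_⟩
  have h1 := H.norm_sub_orbit_le (hy.shift (t j)) (s := s₀ + j * T) (b := T + 1) hη0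
    (fun r _ => hh _) (r - t j) ⟨by linarith, by linarith⟩
  simp only [add_zero, add_sub_cancel] at h1
  have h2 := H.norm_orbit_sub_le (φ r) (s₀ + j * T + (r - t j))
  have h3 : |s₀ + j * T + (r - t j) - φ r| ≤ 4 * b := by
    rw [abs_sub_comm]; refine le_trans (le_of_eq ?_) hφd; congr 1; ring
  have e : y r - x (φ r) = (y r - x (s₀ + j * T + (r - t j))) + (x (s₀ + j * T + (r - t j)) - x (φ r)) := by
    abel
  rw [e]
  refine (norm_add_le _ _).trans ?_
  have h4 : G * (‖y (t j) - x (s₀ + j * T)‖ + η) ≤ G * (d + η) :=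
    mul_le_mul_of_nonneg_left (by linarith [hd j]) (by linarith)
  have h5 : D.B * |s₀ + j * T + (r - t j) - φ r| ≤ D.B * (4 * b) :=
    mul_le_mul_of_nonneg_left h3 (by linarith)
  linarith [mul_nonneg (show 0 ≤ D.B by linarith) hd0, mul_nonneg (show 0 ≤ D.B by linarith) hη0,
    mul_nonneg (show 0 ≤ G by linarith) hb0]

end Grid

/-- With `α = κ / 4`, the first inequality says that contraction over `T` beats a loss `e^{2αT}` of
the weight, the second that the weight drops by a factor 4 over `T / 2`. The spread from `T / 2` to
`2 * T` leaves room for actual flight times, which are only close to `T`. -/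
theorem HypData.exists_period (D : HypData) : ∃ T : ℝ, 4 ≤ T ∧
    D.K * Real.exp (-D.κ * T) * Real.exp (2 * (D.κ / 4) * T) ≤ 1 / 16 ∧
    Real.exp (-(D.κ / 4) * (T / 2)) ≤ 1 / 4 := by
  have hκ := D.κ_pos
  have h1 : Tendsto (fun T : ℝ => Real.exp (-(D.κ / 8 * T))) atTop (𝓝 0) :=
    Real.tendsto_exp_neg_atTop_nhds_zero.comp (tendsto_id.const_mul_atTop (by positivity))
  have h2 : Tendsto (fun T : ℝ => D.K * Real.exp (-(D.κ / 2 * T))) atTop (𝓝 0) := by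
    simpa using (Real.tendsto_exp_neg_atTop_nhds_zero.comp
      ((tendsto_id (α := ℝ)).const_mul_atTop (by positivity : 0 < D.κ / 2))).const_mul D.K
  obtain ⟨T, hT, hT1, hT2⟩ := ((eventually_ge_atTop (4 : ℝ)).and
    ((h1.eventually (ge_mem_nhds (by norm_num : (0 : ℝ) < 1 / 4))).and
      (h2.eventually (ge_mem_nhds (by norm_num : (0 : ℝ) < 1 / 16))))).exists
  refine ⟨T, hT, ?_, ?_⟩
  · rw [mul_assoc, ← Real.exp_add]
    refine le_trans (le_of_eq ?_) hT2
    congr 2; ring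
  · refine le_trans (le_of_eq ?_) hT1
    congr 1; ring

/-! ### Hyperbolic estimates for the recursion between sections. -/

section Difference

variable {E : Type*} [NormedAddCommGroup E] [NormedSpace ℝ E]

theorem Shadows.norm_velocity_le {D : HypData} {f : E → E} {x : ℝ → E} (H : HypOrbit D f x)
    {h y : ℝ → E} {φ : ℝ → ℝ} {δ τ : ℝ} (S : Shadows f x h y φ δ τ) (hδ : δ ≤ 1) (t : ℝ)
    (ht : τ ≤ t) : ‖f (y t) + h t‖ ≤ D.B + 2 * D.Lf := by
  have hL := D.one_le_Lf
  have h2 := S.near t ht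
  have h3 := H.norm_vel_le_of_near (t := φ t) (y := y t)
  have h4 := S.bound t
  have h5 : D.Lf * ‖y t - x (φ t)‖ ≤ D.Lf * 1 :=
    mul_le_mul_of_nonneg_left (by linarith) (by linarith)
  exact (norm_add_le _ _).trans (by linarith)

theorem Shadows.norm_sub_le {D : HypData} {f : E → E} {x : ℝ → E} (H : HypOrbit D f x)
    {h y : ℝ → E} {φ : ℝ → ℝ} {δ τ : ℝ} (S : Shadows f x h y φ δ τ) (hδ : δ ≤ 1) {a b : ℝ}
    (ha : τ ≤ a) (hb : τ ≤ b) : ‖y b - y a‖ ≤ (D.B + 2 * D.Lf) * |b - a| :=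
  norm_sub_le_of_hasDerivAt_bound (convex_Ici τ) (fun t _ => S.forced t)
    (fun t ht => S.norm_velocity_le H hδ t ht) ha hb

namespace HypOrbit

variable {D : HypData} {f : E → E} {x : ℝ → E} (H : HypOrbit D f x)

include H

/-- The hyperbolic estimate for one step of a two-sided sequence in the sections `ker (ph s)`. -/
theorem norm_le_of_discrete {T Λ κ₀ Z e : ℝ} (hT : 0 ≤ T) (hΛ : 1 ≤ Λ)
    (hq : D.K * Real.exp (-D.κ * T) * Λ ≤ 1 / 16) (hκ₀ : 0 ≤ κ₀)
    (hκΛ : 32 * Λ * (D.B * D.K + 1 + D.K) * κ₀ ≤ 1) (s : ℤ → ℝ) (hs : ∀ j, s (j + 1) = s j + T)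
    (z : ℤ → E) (θ w e' : ℤ → ℝ) (hw : ∀ j, 0 ≤ w j) (hw1 : ∀ j, w (j + 1) ≤ w j)
    (hwΛ : ∀ j, w j ≤ Λ * w (j + 1)) (hph : ∀ j, H.ph (s j) (z j) = 0)
    (hr : ∀ j, ‖z (j + 1) - H.U (s j) (s (j + 1)) (z j) - θ j • f (x (s (j + 1)))‖
      ≤ κ₀ * (‖z j‖ + |θ j|) + e' j)
    (he : ∀ j, e' j ≤ e * w j) (hZ0 : 0 ≤ Z) (he0 : 0 ≤ e) (hZ : ∀ j, ‖z j‖ ≤ Z * w j) (j : ℤ) :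
    ‖z j‖ ≤ (Z / 4 + 4 * Λ * (D.B * D.K + 1 + D.K) * e) * w j ∧
    |θ j| ≤ (Z / 4 + 4 * Λ * (D.B * D.K + 1 + D.K) * e) * w j := by
  have hB := D.one_le_B
  have hK := D.one_le_K
  set A := D.B * D.K + 1 + D.K with hA
  have hA1 : 1 ≤ A := by rw [hA]; nlinarith
  have hKA : D.K ≤ A := by rw [hA]; nlinarith
  set q := D.K * Real.exp (-D.κ * T) with hqdef
  have hq0 : 0 ≤ q := by positivity
  set r : ℤ → E := fun j => z (j + 1) - H.U (s j) (s (j + 1)) (z j) - θ j • f (x (s (j + 1)))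
    with hrdef
  have hz : ∀ j, z (j + 1) = H.U (s j) (s (j + 1)) (z j) + θ j • f (x (s (j + 1))) + r j := by
    intro j; simp only [hrdef]; abel
  have hr' : ∀ j, ‖r j‖ ≤ κ₀ * (‖z j‖ + |θ j|) + e' j := hr
  clear_value r
  have hKκ : D.K * κ₀ ≤ 1 / 32 := by
    have : 32 * 1 * D.K * κ₀ ≤ 32 * Λ * A * κ₀ := by gcongr
    linarith
  -- Both `z j` and `z (j + 1)` have phase zero and the linearized flow preserves the phase, so the
  -- shift along the velocity can only compensate the phase of the remainder `r j`.
  have hθ : ∀ j, |θ j| ≤ D.K * ‖r j‖ := by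
    intro j
    have h1 := hph (j + 1)
    rw [hz j, map_add, map_add, H.ph_U, hph j, map_smul, H.ph_vel, smul_eq_mul, mul_one,
      zero_add] at h1
    have : θ j = -H.ph (s (j + 1)) (r j) := by linarith
    rw [this, abs_neg]
    exact H.norm_ph_le _ _
  -- The remainder contains `|θ j|`, which is itself bounded by the remainder; as `D.K * κ₀` is
  -- small, this part is absorbed on the left.
  have hrb : ∀ j, ‖r j‖ ≤ (2 * κ₀ * Z + 2 * e) * w j := by
    intro j
    have h1 := hr' j
    have h2 : κ₀ * |θ j| ≤ 1 / 32 * ‖r j‖ := by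
      calc κ₀ * |θ j| ≤ κ₀ * (D.K * ‖r j‖) := mul_le_mul_of_nonneg_left (hθ j) hκ₀
        _ = (D.K * κ₀) * ‖r j‖ := by ring
        _ ≤ _ := mul_le_mul_of_nonneg_right hKκ (norm_nonneg _)
    have h3 : κ₀ * ‖z j‖ ≤ κ₀ * (Z * w j) := mul_le_mul_of_nonneg_left (hZ j) hκ₀
    have h4 := he j
    have h5 : 0 ≤ κ₀ * (Z * w j) := mul_nonneg hκ₀ (mul_nonneg hZ0 (hw j))
    have h6 : 0 ≤ e * w j := mul_nonneg he0 (hw j)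
    nlinarith
  have hsT : ∀ j, s (j + 1) - s j = T := fun j => by rw [hs]; ring
  have hsle : ∀ j, s j ≤ s (j + 1) := fun j => by rw [hs]; linarith
  -- The part outside the unstable directions comes from the previous section by contraction; the
  -- velocity terms pass through `Pu` without effect.
  have hstable : ∀ j, ‖z (j + 1) - H.Pu (s (j + 1)) (z (j + 1))‖ ≤ q * ‖z j‖ + A * ‖r j‖ := by
    intro j
    have h1 : z (j + 1) - H.Pu (s (j + 1)) (z (j + 1)) = H.U (s j) (s (j + 1)) (H.Ps (s j) (z j))
        + θ j • f (x (s (j + 1))) + (r j - H.Pu (s (j + 1)) (r j)) := by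
      have h2 : H.Ps (s j) (z j) = z j - H.Pu (s j) (z j) := by
        have := H.decomp (s j) (z j)
        rw [hph j, zero_smul, add_zero] at this
        exact eq_sub_of_add_eq this
      rw [h2, hz j, map_add, map_add, map_sub, map_smul, H.Pu_vel, smul_zero, H.Pu_U]
      abel
    rw [h1]
    have h3 := H.norm_U_Ps_le (s j) (s (j + 1)) (z j) (hsle j)
    rw [hsT] at h3
    have h4 : ‖θ j • f (x (s (j + 1)))‖ ≤ D.K * ‖r j‖ * D.B := by
      rw [norm_smul, Real.norm_eq_abs]
      exact mul_le_mul (hθ j) (H.norm_vel_le _) (norm_nonneg _) (by positivity)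
    have h5 := H.norm_Pu_le (s (j + 1)) (r j)
    refine (norm_add₃_le).trans ((add_le_add (add_le_add h3 h4)
      ((norm_sub_le _ _).trans (add_le_add_right h5 _))).trans (le_of_eq ?_))
    rw [hA]; ring
  -- The unstable part is recovered from the next section, flowing backward.
  have hunstable : ∀ j, ‖H.Pu (s j) (z j)‖ ≤ q * (‖z (j + 1)‖ + ‖r j‖) := by
    intro j
    have h1 : H.Pu (s j) (z j)
        = H.U (s (j + 1)) (s j) (H.Pu (s (j + 1)) (z (j + 1) - r j)) := by
      have h2 : z (j + 1) - r j = H.U (s j) (s (j + 1)) (z j) + θ j • f (x (s (j + 1))) := by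
        rw [hz j]; abel
      rw [h2, map_add, map_smul, H.Pu_vel, smul_zero, add_zero, H.Pu_U, H.U_comp, H.U_self]
    rw [h1]
    have h3 := H.norm_U_Pu_le (s (j + 1)) (s j) (z (j + 1) - r j) (hsle j)
    rw [hsT] at h3
    exact h3.trans (mul_le_mul_of_nonneg_left (norm_sub_le _ _) hq0)
  have hcoef : 32 * Λ * A * κ₀ ≤ 1 := hκΛ
  have hq16 : q ≤ 1 / 16 := by nlinarith
  constructor
  · obtain ⟨i, rfl⟩ : ∃ i, j = i + 1 := ⟨j - 1, by ring⟩
    have h1 : ‖z (i + 1)‖ ≤ (q * ‖z i‖ + A * ‖r i‖) + q * (‖z (i + 1 + 1)‖ + ‖r (i + 1)‖) := by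
      have e : z (i + 1) = (z (i + 1) - H.Pu (s (i + 1)) (z (i + 1)))
        + H.Pu (s (i + 1)) (z (i + 1)) := by abel
      conv_lhs => rw [e]
      exact (norm_add_le _ _).trans (add_le_add (hstable i) (hunstable (i + 1)))
    set W := w (i + 1) with hW
    have hW0 : 0 ≤ W := hw _
    have b1 : q * ‖z i‖ ≤ 1 / 16 * (Z * W) := by
      calc q * ‖z i‖ ≤ q * (Z * (Λ * W)) := mul_le_mul_of_nonneg_left
            ((hZ i).trans (mul_le_mul_of_nonneg_left (hwΛ i) hZ0)) hq0
        _ = (q * Λ) * (Z * W) := by ring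
        _ ≤ _ := mul_le_mul_of_nonneg_right hq (by positivity)
    have b2 : A * ‖r i‖ ≤ (1 / 16 * Z + 2 * Λ * A * e) * W := by
      calc A * ‖r i‖ ≤ A * ((2 * κ₀ * Z + 2 * e) * (Λ * W)) := mul_le_mul_of_nonneg_left
            ((hrb i).trans (mul_le_mul_of_nonneg_left (hwΛ i) (by positivity))) (by linarith)
        _ = (32 * Λ * A * κ₀) * (1 / 16 * Z * W) + 2 * Λ * A * e * W := by ring
        _ ≤ 1 * (1 / 16 * Z * W) + 2 * Λ * A * e * W := by
            have : 0 ≤ 1 / 16 * Z * W := by positivity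
            nlinarith
        _ = _ := by ring
    have b3 : q * ‖z (i + 1 + 1)‖ ≤ 1 / 16 * (Z * W) :=
      mul_le_mul hq16 ((hZ _).trans (mul_le_mul_of_nonneg_left (hw1 _) hZ0)) (norm_nonneg _)
        (by norm_num)
    have b4 : q * ‖r (i + 1)‖ ≤ 1 / 16 * ((2 * κ₀ * Z + 2 * e) * W) :=
      mul_le_mul hq16 (hrb _) (norm_nonneg _) (by norm_num)
    have b5 : κ₀ ≤ 1 / 32 := by nlinarith
    have b6 : e * W ≤ Λ * A * e * W := by
      have h6 : 1 ≤ Λ * A := by nlinarith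
      have h7 : 0 ≤ e * W := by positivity
      nlinarith
    have b7 : κ₀ * (Z * W) ≤ 1 / 32 * (Z * W) := mul_le_mul_of_nonneg_right b5 (by positivity)
    have b8 : 0 ≤ Z * W := by positivity
    have b9 : 0 ≤ e * W := by positivity
    calc _ ≤ _ := h1
      _ ≤ 1 / 16 * (Z * W) + (1 / 16 * Z + 2 * Λ * A * e) * W + 1 / 16 * (Z * W)
          + 1 / 16 * ((2 * κ₀ * Z + 2 * e) * W) := by linarith
      _ = 3 / 16 * (Z * W) + 2 * (Λ * A * e * W) + 1 / 8 * (κ₀ * (Z * W)) + 1 / 8 * (e * W) := by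
          ring
      _ ≤ 1 / 4 * (Z * W) + 4 * (Λ * A * e * W) := by linarith
      _ = _ := by ring
  · refine (hθ j).trans ?_
    have h1 := mul_le_mul_of_nonneg_left (hrb j) (by linarith : 0 ≤ D.K)
    have h2 : D.K * κ₀ * (Z * w j) ≤ 1 / 32 * (Z * w j) :=
      mul_le_mul_of_nonneg_right hKκ (mul_nonneg hZ0 (hw j))
    have h3 : D.K * (e * w j) ≤ Λ * A * (e * w j) := by
      refine mul_le_mul_of_nonneg_right ?_ (mul_nonneg he0 (hw j))
      nlinarith
    have h4 : 0 ≤ Z * w j := mul_nonneg hZ0 (hw j)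
    have h5 : 0 ≤ D.K * (e * w j) := mul_nonneg (by linarith) (mul_nonneg he0 (hw j))
    calc _ ≤ _ := h1
      _ = 2 * (D.K * κ₀ * (Z * w j)) + 2 * (D.K * (e * w j)) := by ring
      _ ≤ 1 / 4 * (Z * w j) + 4 * (Λ * A * (e * w j)) := by linarith
      _ = _ := by ring

end HypOrbit

/-- Times at which a solution that shadows an orbit crosses the sections at the points `s j`. -/
structure SectionTimes (x y : ℝ → E) (ph : ℝ → E →L[ℝ] ℝ) (φ : ℝ → ℝ) (s t : ℤ → ℝ)
    (T a : ℝ) : Prop where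
  ph_eq_zero : ∀ j, ph (s j) (y (t j) - x (s j)) = 0
  near : ∀ j, ‖y (t j) - x (s j)‖ ≤ a
  phase : ∀ j, |φ (t j) - s j| ≤ a
  spacing : ∀ j, |t (j + 1) - t j - T| ≤ 3 * a

/-- Phase control from every initial time makes the phases tend to `-∞` in the past, so every
section is reached. The spacing error `3 * a` collects the phase errors at both ends and the drift
between them. -/
theorem exists_sectionTimes {x y : ℝ → E} {ph : ℝ → E →L[ℝ] ℝ} {φ : ℝ → ℝ} {C T δ : ℝ}
    (hT : 0 ≤ T) (hC : C * δ ≤ 1 / 16) (P : ∀ τ, PhaseControl x y ph φ C (2 * T + 4) δ τ) (s : ℤ → ℝ)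
    (hs : ∀ j, s (j + 1) = s j + T) : ∃ t : ℤ → ℝ, SectionTimes x y ph φ s t T (C * δ) := by
  have hsec : ∀ j, ∃ t, ph (s j) (y t - x (s j)) = 0 ∧
      ‖y t - x (s j)‖ ≤ C * δ ∧ |φ t - s j| ≤ C * δ := by
    intro j
    -- By the growth bound the phase at `τ + 1` is at least `|φ 0 - s j| + 1` below `φ 0`, hence
    -- below `s j`.
    set τ := -(2 * |φ 0 - s j| + 5) with hτ
    have h0 := abs_nonneg (φ 0 - s j)
    have h1 := ((P τ).growth (τ + 1) (by linarith) (-(τ + 1)) (by linarith)).1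
    rw [add_neg_cancel] at h1
    have h2 := le_abs_self (φ 0 - s j)
    obtain ⟨t, -, ht⟩ := (P τ).exists_section (s j) (by linarith)
    exact ⟨t, ht⟩
  choose t h1 h2 h3 using hsec
  refine ⟨t, h1, h2, h3, fun j => ?_⟩
  have a1 := abs_le.1 (h3 j)
  have a2 := abs_le.1 (h3 (j + 1))
  rw [hs j] at a2
  have key := (P (min (t j) (t (j + 1)))).abs_sub_sub_le (t := t j) (t' := t (j + 1)) (S := T + 1)
    (min_le_left _ _) (min_le_right _ _) (abs_le.2 ⟨by linarith, by linarith⟩) (by linarith)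
  have a3 := abs_le.1 key
  rw [abs_le]
  constructor <;> linarith

variable (E) in
/-- A solution that shadows a hyperbolic orbit for all times is as close to it as the size of the
forcing allows, for a suitable choice of the phases. -/
theorem exists_phases_of_shadows (D : HypData) : ∃ δ₁ > 0, δ₁ ≤ 1 ∧ ∃ C ≥ 1,
    ∀ (f : E → E) (x : ℝ → E), HypOrbit D f x → ∀ (h y : ℝ → E) (φ : ℝ → ℝ) (δ η : ℝ),
      (∀ τ, Shadows f x h y φ δ τ) → δ ≤ δ₁ → η ≤ δ → (∀ t, ‖h t‖ ≤ η) →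
      ∃ φ' : ℝ → ℝ, LipschitzWith 2 φ' ∧
        ∀ t, ‖y t - x (φ' t)‖ ≤ C * η ∧ |φ' t - φ t| ≤ C * δ := by
  obtain ⟨T, hT4, hTq, -⟩ := D.exists_period
  have hB := D.one_le_B
  have hK := D.one_le_K
  set A := D.B * D.K + 1 + D.K with hA
  have hA1 : 1 ≤ A := by rw [hA]; nlinarith
  -- Here the weight is constant, so the recursion is used with `Λ = 1`.
  have hq : D.K * Real.exp (-D.κ * T) * 1 ≤ 1 / 16 := by
    rw [mul_one]
    refine le_trans ?_ hTq
    refine le_mul_of_one_le_right (by positivity) (Real.one_le_exp ?_)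
    have := D.κ_pos
    positivity
  obtain ⟨δs, hδs, hδs1, Cs, hCs, hstep⟩ := HypOrbit.step (E := E) D (T := T) (κ₀ := 1 / (32 * A))
    (by linarith) (by positivity)
  obtain ⟨δp, hδp, hδp1, Cp, hCp, hCδp, hphase⟩ := HypOrbit.phaseControl (E := E) D (2 * T + 4)
    (by linarith)
  obtain ⟨Cm, hCm, hMc⟩ := exists_phases_of_times (E := E) D hT4
  set C₁ := 4 * 1 * A * Cs with hC₁
  have hC₁1 : 1 ≤ C₁ := by nlinarith [mul_le_mul hA1 hCs zero_le_one (by linarith)]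
  set δ₁ := min δp (δs / (3 * Cp)) with hδ₁
  have hδ₁s : 3 * (Cp * δ₁) ≤ δs := by
    have : δ₁ ≤ δs / (3 * Cp) := min_le_right _ _
    rw [le_div_iff₀ (by positivity)] at this
    linarith
  refine ⟨δ₁, lt_min hδp (by positivity), (min_le_left _ _).trans hδp1,
    5 * Cm * C₁ + 18 * Cp, by nlinarith, ?_⟩
  intro f x H h y φ δ η S hδ hη hh
  have hη0 : 0 ≤ η := (norm_nonneg _).trans (hh 0)
  have hδ0 : 0 ≤ δ := hη0.trans hη
  have P : ∀ τ, PhaseControl x y H.ph φ Cp (2 * T + 4) δ τ := fun τ =>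
    hphase f x H h y φ δ τ (S τ) (hδ.trans (min_le_left _ _))
  have hCδ1 : Cp * δ ≤ Cp * δ₁ := mul_le_mul_of_nonneg_left hδ (by linarith)
  have hCδ : Cp * δ ≤ 1 / 16 := hCδ1.trans
    ((mul_le_mul_of_nonneg_left (min_le_left _ _) (by linarith)).trans hCδp)
  have hCδs : 3 * (Cp * δ) ≤ δs := by linarith
  have hCpδ0 : 0 ≤ Cp * δ := by positivity
  have hδCp : δ ≤ Cp * δ := le_mul_of_one_le_left hδ0 hCp
  set s : ℤ → ℝ := fun j => 0 + j * T with hs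
  have hs1 : ∀ j, s (j + 1) = s j + T := fun j => by simp only [hs]; push_cast; ring
  obtain ⟨t, Q⟩ := exists_sectionTimes (by linarith) hCδ P s hs1
  have hres : ∀ j, ‖(y (t (j + 1)) - x (s (j + 1))) - H.U (s j) (s (j + 1)) (y (t j) - x (s j))
      - (t (j + 1) - t j - T) • f (x (s (j + 1)))‖
      ≤ 1 / (32 * A) * (‖y (t j) - x (s j)‖ + |t (j + 1) - t j - T|) + Cs * η := by
    intro j
    -- The second solution is the orbit itself with zero forcing and flight time exactly `T`.
    have := hstep f x H (s j) (fun r => h (t j + r)) (fun _ => 0) (fun r => y (t j + r))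
      (fun r => x (s j + r)) ((S 0).forced.shift _) (H.isForced_orbit _)
      (fun r => (hh _).trans (by linarith)) (fun r => by simpa using hδs.le)
      (by simpa using (Q.near j).trans (by linarith)) (by simpa using hδs.le)
      (t (j + 1) - t j - T) 0 ((Q.spacing j).trans hCδs) (by simpa using hδs.le) η
      (fun r _ => by simpa using hh (t j + r))
    simp only [add_zero, sub_zero] at this
    rw [hs1]
    rwa [show t j + (T + (t (j + 1) - t j - T)) = t (j + 1) by ring] at this
  -- The a priori bound of order `δ` only supplies finiteness; the recursion improves it to the
  -- order `η` of the forcing.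
  have himp := weighted_bound_of_self_improving
    (fun j => ‖y (t j) - x (s j)‖) (fun _ => 1) (fun _ => zero_le_one) (β := 1 / 4)
    (c := 4 * 1 * A * (Cs * η)) (by norm_num) (by norm_num) (by positivity) (Z₀ := Cp * δ)
    (fun j => by simpa using Q.near j) (fun Z hZ0 hZ j => by
      have := (H.norm_le_of_discrete (Z := Z) (e := Cs * η) (by linarith) le_rfl hq
        (by positivity) (by
          rw [← hA]; refine le_of_eq ?_; field_simp) s hs1
        (fun j => y (t j) - x (s j)) (fun j => t (j + 1) - t j - T) (fun _ => 1) (fun _ => Cs * η)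
        (fun _ => zero_le_one) (fun _ => le_rfl) (fun _ => by norm_num) Q.ph_eq_zero hres
        (fun _ => by simp) hZ0 (by positivity) hZ j).1
      rw [← hA] at this
      refine this.trans (le_of_eq ?_)
      ring)
  have hz : ∀ j, ‖y (t j) - x (s j)‖ ≤ 2 * C₁ * η := by
    intro j
    refine (himp j).trans ?_
    have h0 : 0 ≤ C₁ * η := by positivity
    have h1 : 4 * 1 * A * (Cs * η) / (1 - 1 / 4) * 1 = 4 / 3 * (C₁ * η) := by rw [hC₁]; ring
    rw [h1]
    linarith
  have hθ : ∀ j, |t (j + 1) - t j - T| ≤ 2 * C₁ * η := by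
    intro j
    have := (H.norm_le_of_discrete (Z := 2 * C₁ * η) (e := Cs * η) (by linarith) le_rfl hq
        (by positivity) (by
          rw [← hA]; refine le_of_eq ?_; field_simp) s hs1
        (fun j => y (t j) - x (s j)) (fun j => t (j + 1) - t j - T) (fun _ => 1) (fun _ => Cs * η)
        (fun _ => zero_le_one) (fun _ => le_rfl) (fun _ => by norm_num) Q.ph_eq_zero hres
        (fun _ => by simp) (by positivity) (by positivity) (fun j => by simpa using hz j) j).2
    rw [← hA] at this
    refine this.trans ?_
    have h0 : 0 ≤ C₁ * η := by positivity
    have h1 : 4 * 1 * A * (Cs * η) = C₁ * η := by rw [hC₁]; ring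
    rw [h1]
    linarith
  -- Both bounds are kept: the one by `η` gives the closeness of `y` to the orbit, the one by `δ`
  -- the closeness of the new phases to the old ones.
  have hb : ∀ j, |t (j + 1) - t j - T| ≤ min (2 * C₁ * η) (3 * (Cp * δ)) := fun j =>
    le_min (hθ j) (Q.spacing j)
  obtain ⟨φ', hφ', hcell⟩ := hMc f x H h y η (S 0).forced hh t 0 (min (2 * C₁ * η) (3 * (Cp * δ)))
    (2 * C₁ * η) ((min_le_right _ _).trans (by linarith)) hb hz
  refine ⟨φ', hφ', fun r => ?_⟩
  obtain ⟨j, hj1, hj2, hj3, hj4⟩ := hcell r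
  constructor
  · refine hj4.trans ?_
    have h1 : min (2 * C₁ * η) (3 * (Cp * δ)) ≤ 2 * C₁ * η := min_le_left _ _
    have h2 : η ≤ C₁ * η := le_mul_of_one_le_left hη0 hC₁1
    have h3 : Cm * (2 * C₁ * η + min (2 * C₁ * η) (3 * (Cp * δ)) + η) ≤ Cm * (5 * (C₁ * η)) :=
      mul_le_mul_of_nonneg_left (by linarith) (by linarith)
    have h4 : 0 ≤ 18 * Cp * η := by positivity
    linarith
  · have h1 := (P (t j)).increment (t j) le_rfl (r - t j)
      ⟨by linarith, by linarith [(abs_le.1 (Q.spacing j)).2]⟩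
    rw [add_sub_cancel] at h1
    have h2 := Q.phase j
    have h3 : 4 * min (2 * C₁ * η) (3 * (Cp * δ)) ≤ 12 * (Cp * δ) := by
      have := min_le_right (2 * C₁ * η) (3 * (Cp * δ)); linarith
    have e : φ' r - φ r = (φ' r - (0 + j * T) - (r - t j)) - (φ r - φ (t j) - (r - t j))
      - (φ (t j) - s j) := by simp only [hs]; ring
    rw [e]
    refine (abs_sub _ _).trans ((add_le_add_left (abs_sub _ _) _).trans ?_)
    have h4 : 0 ≤ 5 * Cm * C₁ * δ := by positivity
    linarith

end Difference

/-! ### Asymptotic solutions depend on the forcing in a Lipschitz way. -/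

section Comparison

variable {E : Type*} [NormedAddCommGroup E] [NormedSpace ℝ E]

/-- Sequences with increments at most `1` in absolute value are dominated by weights that grow
geometrically to the left. -/
theorem exists_bound_of_geometric_weights {u w : ℤ → ℝ} (hw : ∀ j, 0 < w j)
    (hw4 : ∀ j, w (j + 1) ≤ 1 / 4 * w j) (hu : ∀ j, |u (j + 1) - u j| ≤ 1) {J : ℤ} {Z : ℝ}
    (hZ : ∀ j, J ≤ j → |u j| ≤ Z * w j) : ∃ Z₀, ∀ j, |u j| ≤ Z₀ * w j := by
  -- To the left the weight grows geometrically and `u` at most linearly, so already `(n + 1) * w J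
  -- ≤ w (J - n)` suffices.
  have hgrow : ∀ n : ℕ, (n + 1 : ℝ) * w J ≤ w (J - n) ∧ |u (J - n)| ≤ |u J| + n := by
    intro n
    induction n with
    | zero => simp
    | succ n ih =>
      have h1 := hw4 (J - (n + 1))
      have h2 := hu (J - (n + 1))
      rw [show J - ((n : ℤ) + 1) + 1 = J - n by ring] at h1 h2
      push_cast
      have h3 := abs_sub_abs_le_abs_sub (u (J - (n + 1))) (u (J - n))
      rw [abs_sub_comm] at h3
      have h4 := hw J
      have h5 : (0 : ℝ) ≤ n := n.cast_nonneg
      constructor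
      · nlinarith [ih.1, mul_nonneg h5 h4.le]
      · linarith [ih.2]
  refine ⟨max Z ((|u J| + 1) / w J), fun j => ?_⟩
  rcases le_total J j with h | h
  · exact (hZ j h).trans (mul_le_mul_of_nonneg_right (le_max_left _ _) (hw j).le)
  · obtain ⟨n, hn⟩ := Int.le.dest h
    have e : j = J - n := by omega
    subst e
    obtain ⟨h1, h2⟩ := hgrow n
    refine le_trans ?_ (mul_le_mul_of_nonneg_right (le_max_right _ _) (hw _).le)
    have h3 : (|u J| + 1) * (n + 1) ≤ (|u J| + 1) / w J * w (J - n) := by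
      rw [div_mul_eq_mul_div, le_div_iff₀ (hw J)]
      nlinarith [abs_nonneg (u J)]
    have h4 : (0 : ℝ) ≤ n := n.cast_nonneg
    nlinarith [abs_nonneg (u J), mul_nonneg (abs_nonneg (u J)) h4]

set_option maxHeartbeats 2000000 in
variable (E) in
/-- Two solutions that shadow the same hyperbolic orbit, and are asymptotic to each other, differ
by at most a constant times the difference of the forcings, in an exponentially weighted norm. -/
theorem norm_sub_le_of_shadows (D : HypData) : ∃ δ₁ > 0, δ₁ ≤ 1 ∧ ∃ ρ > 0, ∃ C ≥ 1,
    ∀ (f : E → E) (x : ℝ → E), HypOrbit D f x → ∀ (h h' y y' : ℝ → E) (φ φ' : ℝ → ℝ) (δ : ℝ),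
      (∀ τ, Shadows f x h y φ δ τ) → (∀ τ, Shadows f x h' y' φ' δ τ) → δ ≤ δ₁ →
      (∀ a b, ‖h a - h b‖ ≤ δ * |a - b|) →
      ∀ m : ℝ, 0 ≤ m → (∀ t, ‖h t - h' t‖ ≤ m * Real.exp (-(D.κ / 4) * t)) →
      ∀ C' : ℝ, (∀ᶠ t in atTop, |φ t - φ' t| ≤ 2 * ρ ∧
        ‖y t - y' t‖ ≤ C' * Real.exp (-(D.κ / 4) * t)) →
      ∀ t, ‖y t - y' t‖ ≤ C * m * Real.exp (-(D.κ / 4) * t) := by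
  obtain ⟨T, hT4, hTq, hTw⟩ := D.exists_period
  have hB := D.one_le_B
  have hK := D.one_le_K
  have hL := D.one_le_Lf
  have hα : 0 < D.κ / 4 := by have := D.κ_pos; positivity
  set α := D.κ / 4 with hαdef
  set A := D.B * D.K + 1 + D.K with hA
  have hA1 : 1 ≤ A := by
    have : 0 ≤ D.B * D.K := by positivity
    linarith
  set Λ := Real.exp (2 * α * T) with hΛ
  have hΛ1 : 1 ≤ Λ := Real.one_le_exp (by positivity)
  obtain ⟨δs, hδs, hδs1, Cs, hCs, hstep⟩ := HypOrbit.step (E := E) D (T := T)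
    (κ₀ := 1 / (32 * Λ * A)) (by linarith) (by positivity)
  obtain ⟨δp, hδp, hδp1, Cp, hCp, hCδp, hphase⟩ := HypOrbit.phaseControl (E := E) D (2 * T + 4)
    (by linarith)
  set C₁ := 4 * Λ * A * Cs with hC₁
  have hC₁pos : 0 < C₁ := by positivity
  set V := D.B + 2 * D.Lf with hV
  have hVpos : 0 < V := by positivity
  -- Crossing times whose phases differ by `2 * ρ` are so close that the velocity changes little
  -- between them: `ρ` contributes exactly 1/8 to the error in `h8` below, which has to stay below
  -- 1/2.
  set ρ := 1 / (16 * D.K * D.Lf * V) with hρ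
  have hρpos : 0 < ρ := by positivity
  have hρ1 : 2 * (D.K * D.Lf * V) * ρ = 1 / 8 := by rw [hρ]; field_simp; norm_num
  have hρ2 : ρ ≤ 1 / 16 := by
    have : 1 ≤ D.K * D.Lf * V := by
      have h1 : 1 ≤ D.K * D.Lf := one_le_mul_of_one_le_of_one_le hK hL
      have h2 : 1 ≤ V := by rw [hV]; linarith
      exact one_le_mul_of_one_le_of_one_le h1 h2
    linarith [mul_le_mul_of_nonneg_right this hρpos.le]
  set M := D.Lf * Cp + 3 * D.Lf * V * Cp + 1 with hM
  have hMpos : 0 < M := by positivity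
  set G := Real.exp (D.Lf * (T + 1)) with hG
  have hG1 : 1 ≤ G := Real.one_le_exp (by positivity)
  set δ₁ := min (min δp (δs / (3 * Cp))) (min (1 / (8 * C₁)) (1 / (4 * D.K * M))) with hδ₁
  have hδ₁p : δ₁ ≤ δp := (min_le_left _ _).trans (min_le_left _ _)
  have hδ₁s : 3 * (Cp * δ₁) ≤ δs := by
    have : δ₁ ≤ δs / (3 * Cp) := (min_le_left _ _).trans (min_le_right _ _)
    rw [le_div_iff₀ (by positivity)] at this
    linarith
  have hδ₁C : C₁ * δ₁ ≤ 1 / 8 := by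
    have : δ₁ ≤ 1 / (8 * C₁) := (min_le_right _ _).trans (min_le_left _ _)
    rw [le_div_iff₀ (by positivity)] at this
    linarith
  have hδ₁M : D.K * M * δ₁ ≤ 1 / 4 := by
    have : δ₁ ≤ 1 / (4 * D.K * M) := (min_le_right _ _).trans (min_le_right _ _)
    rw [le_div_iff₀ (by positivity)] at this
    linarith
  refine ⟨δ₁, lt_min (lt_min hδp (by positivity)) (lt_min (by positivity) (by positivity)),
    hδ₁p.trans hδp1, ρ, hρpos, G * Λ * (3 * C₁ * (V + 1) + 1), ?_, ?_⟩
  · have h1 : 1 ≤ G * Λ := one_le_mul_of_one_le_of_one_le hG1 hΛ1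
    have h2 : 1 ≤ 3 * C₁ * (V + 1) + 1 := by
      have : 0 ≤ 3 * C₁ * (V + 1) := by positivity
      linarith
    exact one_le_mul_of_one_le_of_one_le h1 h2
  intro f x H h h' y y' φ φ' δ S S' hδ hlip m hm hhh C' hev
  have hδ0 := (S 0).nonneg
  have hδ1 : δ ≤ 1 := hδ.trans (hδ₁p.trans hδp1)
  have P : ∀ τ, PhaseControl x y H.ph φ Cp (2 * T + 4) δ τ := fun τ =>
    hphase f x H h y φ δ τ (S τ) (hδ.trans hδ₁p)
  have P' : ∀ τ, PhaseControl x y' H.ph φ' Cp (2 * T + 4) δ τ := fun τ =>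
    hphase f x H h' y' φ' δ τ (S' τ) (hδ.trans hδ₁p)
  have hCδ1 : Cp * δ ≤ Cp * δ₁ := mul_le_mul_of_nonneg_left hδ (by linarith)
  have hCδ : Cp * δ ≤ 1 / 16 := hCδ1.trans
    ((mul_le_mul_of_nonneg_left hδ₁p (by linarith)).trans hCδp)
  have hCδs : 3 * (Cp * δ) ≤ δs := by linarith
  have hCpδ0 : 0 ≤ Cp * δ := by positivity
  have hδCp : δ ≤ Cp * δ := le_mul_of_one_le_left hδ0 hCp
  have hC₁δ : C₁ * δ ≤ 1 / 8 := (mul_le_mul_of_nonneg_left hδ hC₁pos.le).trans hδ₁C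
  have hδM : D.K * M * δ ≤ 1 / 4 := (mul_le_mul_of_nonneg_left hδ (by positivity)).trans hδ₁M
  have hspeed : ∀ a b, ‖y b - y a‖ ≤ V * |b - a| := fun a b =>
    (S (min a b)).norm_sub_le H hδ1 (min_le_left _ _) (min_le_right _ _)
  have hspeed' : ∀ a b, ‖y' b - y' a‖ ≤ V * |b - a| := fun a b =>
    (S' (min a b)).norm_sub_le H hδ1 (min_le_left _ _) (min_le_right _ _)
  set s : ℤ → ℝ := fun j => 0 + j * T with hs
  have hs1 : ∀ j, s (j + 1) = s j + T := fun j => by simp only [hs]; push_cast; ring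
  obtain ⟨t, Q⟩ := exists_sectionTimes (by linarith) hCδ P s hs1
  obtain ⟨t', Q'⟩ := exists_sectionTimes (by linarith) hCδ P' s hs1
  -- The weight is evaluated at the crossing times of the second solution; consecutive weights have
  -- a ratio between 1/4 and `Λ` in the appropriate directions.
  set w : ℤ → ℝ := fun j => Real.exp (-α * t' j) with hw
  have hw0 : ∀ j, 0 < w j := fun j => Real.exp_pos _
  have hw4 : ∀ j, w (j + 1) ≤ 1 / 4 * w j := by
    intro j
    have h1 := abs_le.1 (Q'.spacing j)
    have h2 : w (j + 1) = Real.exp (-α * (t' (j + 1) - t' j)) * w j := by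
      simp only [hw]; rw [← Real.exp_add]; congr 1; ring
    rw [h2]
    refine mul_le_mul_of_nonneg_right (le_trans (Real.exp_le_exp.2 ?_) hTw) (hw0 j).le
    linarith only [mul_le_mul_of_nonneg_left (show T / 2 ≤ t' (j + 1) - t' j by linarith) hα.le]
  have hwΛ : ∀ j, w j ≤ Λ * w (j + 1) := by
    intro j
    have h1 := abs_le.1 (Q'.spacing j)
    simp only [hw, hΛ]
    rw [← Real.exp_add]
    refine Real.exp_le_exp.2 ?_
    linarith only [mul_le_mul_of_nonneg_left (show t' (j + 1) ≤ t' j + 2 * T by linarith) hα.le]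
  have hw1 : ∀ j, w (j + 1) ≤ w j := fun j => (hw4 j).trans (by linarith [hw0 j])
  set z : ℤ → E := fun j => y (t j) - y' (t' j) with hz
  set d : ℤ → ℝ := fun j => t j - t' j with hd
  have hph : ∀ j, H.ph (s j) (z j) = 0 := by
    intro j
    have e : z j = (y (t j) - x (s j)) - (y' (t' j) - x (s j)) := by simp only [hz]; abel
    rw [e, map_sub, Q.ph_eq_zero, Q'.ph_eq_zero, sub_zero]
  -- The solutions cross a section at different times, so the forcings differ by `δ * |d j|`, from
  -- the Lipschitz bound on `h`, in addition to the true difference `m * w j`. The sequence `d`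
  -- therefore has to be estimated together with `z`.
  have hres : ∀ j, ‖z (j + 1) - H.U (s j) (s (j + 1)) (z j) - (d (j + 1) - d j) • f (x (s (j + 1)))‖
      ≤ 1 / (32 * Λ * A) * (‖z j‖ + |d (j + 1) - d j|) + Cs * (δ * |d j| + m * w j) := by
    intro j
    have := hstep f x H (s j) (fun r => h (t j + r)) (fun r => h' (t' j + r)) (fun r => y (t j + r))
      (fun r => y' (t' j + r)) ((S 0).forced.shift _) ((S' 0).forced.shift _)
      (fun r => ((S 0).bound _).trans (by linarith)) (fun r => ((S' 0).bound _).trans (by linarith))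
      (by simpa using (Q.near j).trans (by linarith))
      (by simpa using (Q'.near j).trans (by linarith))
      (t (j + 1) - t j - T) (t' (j + 1) - t' j - T) ((Q.spacing j).trans hCδs)
      ((Q'.spacing j).trans hCδs) (δ * |d j| + m * w j)
      (fun r hr => by
        have e : h (t j + r) - h' (t' j + r)
          = (h (t j + r) - h (t' j + r)) + (h (t' j + r) - h' (t' j + r)) := by abel
        rw [e]
        refine (norm_add_le _ _).trans (add_le_add ((hlip _ _).trans (le_of_eq ?_))
          ((hhh _).trans (mul_le_mul_of_nonneg_left (Real.exp_le_exp.2 ?_) hm)))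
        · congr 2; simp only [hd]; ring
        · linarith only [mul_nonneg hα.le hr.1])
    simp only [add_zero] at this
    rw [show t j + (T + (t (j + 1) - t j - T)) = t (j + 1) by ring,
      show t' j + (T + (t' (j + 1) - t' j - T)) = t' (j + 1) by ring,
      show t (j + 1) - t j - T - (t' (j + 1) - t' j - T) = d (j + 1) - d j by
        simp only [hd]; ring] at this
    rw [hs1]
    exact this
  -- the difference of the crossing times is controlled by the distance of the solutions
  have hclose : ∀ j, |φ (t j) - φ' (t j)| ≤ 2 * ρ → |d j| ≤ 1 ∧
      |d j| ≤ 2 * D.K * ‖y (t j) - y' (t j)‖ := by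
    intro j hj
    have h1 : |φ' (t j) - φ' (t' j)| ≤ 2 * ρ + 2 * (Cp * δ) := by
      have e : φ' (t j) - φ' (t' j) = (φ (t j) - s j) - (φ (t j) - φ' (t j)) - (φ' (t' j) - s j) := by
        ring
      rw [e]
      refine (abs_sub _ _).trans ((add_le_add_left (abs_sub _ _) _).trans ?_)
      linarith [Q.phase j, Q'.phase j]
    have h2 := (P' (min (t j) (t' j))).abs_sub_sub_le (t := t' j) (t' := t j)
      (S := 1) (min_le_right _ _) (min_le_left _ _) (h1.trans (by linarith)) (by linarith)
    have h3 : |d j| ≤ 2 * ρ + 3 * (Cp * δ) := by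
      have e : d j = ((t j - t' j) - (φ' (t j) - φ' (t' j))) + (φ' (t j) - φ' (t' j)) := by
        simp only [hd]; ring
      rw [e]
      exact (abs_add_le _ _).trans (by linarith)
    refine ⟨h3.trans (by linarith), ?_⟩
    have h4 := norm_sub_sub_smul_le_of_hasDerivAt (u := y') (v := f (x (s j)))
      (C := D.Lf * (Cp * δ + V * (2 * ρ + 3 * (Cp * δ))) + δ)
      (convex_uIcc (t' j) (t j)) (fun r _ => (S' 0).forced r) (fun r hr => by
        have e : f (y' r) + h' r - f (x (s j)) = (f (y' r) - f (x (s j))) + h' r := by abel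
        rw [e]
        refine (norm_add_le _ _).trans (add_le_add ((H.norm_vel_sub_le _ _).trans
          (mul_le_mul_of_nonneg_left ?_ (by linarith))) ((S' 0).bound r))
        have e' : y' r - x (s j) = (y' (t' j) - x (s j)) + (y' r - y' (t' j)) := by abel
        rw [e']
        refine (norm_add_le _ _).trans (add_le_add (Q'.near j) ((hspeed' _ _).trans
          (mul_le_mul_of_nonneg_left ?_ hVpos.le)))
        exact (abs_sub_left_of_mem_uIcc hr).trans h3)
      left_mem_uIcc right_mem_uIcc
    have h5 := H.norm_ph_le (s j) (y' (t j) - y' (t' j) - (t j - t' j) • f (x (s j)))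
    have h6 := H.norm_ph_le (s j) (y (t j) - y' (t j))
    have h7 : H.ph (s j) (y' (t j) - y' (t' j) - (t j - t' j) • f (x (s j)))
        = -H.ph (s j) (y (t j) - y' (t j)) - d j := by
      have h8 := hph j
      have e : z j = (y (t j) - y' (t j)) + (y' (t j) - y' (t' j)) := by simp only [hz]; abel
      rw [e, map_add] at h8
      rw [map_sub (H.ph (s j)) (y' (t j) - y' (t' j)), map_smul, H.ph_vel, smul_eq_mul, mul_one]
      linarith
    rw [h7] at h5
    have h8 : D.K * (D.Lf * (Cp * δ + V * (2 * ρ + 3 * (Cp * δ))) + δ) ≤ 1 / 2 := by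
      have e : D.K * (D.Lf * (Cp * δ + V * (2 * ρ + 3 * (Cp * δ))) + δ)
        = D.K * M * δ + 2 * (D.K * D.Lf * V) * ρ := by rw [hM]; ring
      rw [e, hρ1]; linarith
    have h9 : D.K * ‖y' (t j) - y' (t' j) - (t j - t' j) • f (x (s j))‖ ≤ 1 / 2 * |d j| := by
      refine (mul_le_mul_of_nonneg_left h4 (by linarith)).trans ?_
      rw [← mul_assoc]
      exact mul_le_mul_of_nonneg_right h8 (abs_nonneg _)
    have h10 := abs_sub_abs_le_abs_sub (-d j) (H.ph (s j) (y (t j) - y' (t j)))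
    rw [abs_neg, show -d j - H.ph (s j) (y (t j) - y' (t j))
      = -H.ph (s j) (y (t j) - y' (t j)) - d j by ring] at h10
    linarith
  -- finiteness of the weighted norms
  obtain ⟨R, hR⟩ := eventually_atTop.1 hev
  have hC'0 : 0 ≤ C' := by
    have h1 := (hR R le_rfl).2
    have h2 := (norm_nonneg _).trans h1
    exact nonneg_of_mul_nonneg_left h2 (Real.exp_pos _)
  obtain ⟨J, hJ⟩ : ∃ J : ℤ, ∀ j, J ≤ j → R ≤ t j := by
    obtain ⟨n, hn⟩ := exists_nat_gt (|R - t 0|)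
    refine ⟨n, fun j hj => ?_⟩
    obtain ⟨k, rfl⟩ := Int.eq_ofNat_of_zero_le (by omega : 0 ≤ j)
    have h1 := (grid_sub_bounds Q.spacing 0 k).1
    rw [zero_add] at h1
    have h2 : (n : ℝ) ≤ k := by exact_mod_cast hj
    have h3 : (1 : ℝ) * k ≤ (T - 3 * (Cp * δ)) * k :=
      mul_le_mul_of_nonneg_right (by linarith) (Nat.cast_nonneg k)
    have h4 := le_abs_self (R - t 0)
    linarith
  have hlate : ∀ j, J ≤ j → ‖y (t j) - y' (t j)‖ ≤ C' * Real.exp α * w j ∧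
      |d j| ≤ 2 * D.K * (C' * Real.exp α) * w j := by
    intro j hj
    obtain ⟨h1, h2⟩ := hR (t j) (hJ j hj)
    obtain ⟨h3, h4⟩ := hclose j h1
    have h5 : ‖y (t j) - y' (t j)‖ ≤ C' * Real.exp α * w j := by
      refine h2.trans ?_
      rw [mul_assoc]
      refine mul_le_mul_of_nonneg_left ?_ hC'0
      simp only [hw]
      rw [← Real.exp_add]
      refine Real.exp_le_exp.2 ?_
      have := (abs_le.1 h3).1
      simp only [hd] at this
      linarith only [mul_le_mul_of_nonneg_left this hα.le]
    refine ⟨h5, h4.trans ?_⟩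
    rw [mul_assoc (2 * D.K)]
    exact mul_le_mul_of_nonneg_left h5 (by positivity)
  -- On the right, finiteness comes from the asymptotic hypothesis; on the left, from increments of
  -- at most 1 against geometric weights.
  obtain ⟨Z₁, hZ₁⟩ := exists_bound_of_geometric_weights hw0 hw4 (u := d) (fun j => by
    have h1 := abs_le.1 (Q.spacing j)
    have h2 := abs_le.1 (Q'.spacing j)
    simp only [hd]
    rw [abs_le]
    constructor <;> linarith) (fun j hj => (hlate j hj).2)
  obtain ⟨Z₂, hZ₂⟩ := exists_bound_of_geometric_weights hw0 hw4 (u := fun j => ‖z j‖) (J := J)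
    (Z := C' * Real.exp α + V * (2 * D.K * (C' * Real.exp α))) (fun j => by
    have hzb : ∀ j, ‖z j‖ ≤ 1 / 8 := fun j => by
      have e : z j = (y (t j) - x (s j)) - (y' (t' j) - x (s j)) := by simp only [hz]; abel
      rw [e]
      exact (norm_sub_le _ _).trans (by linarith [Q.near j, Q'.near j])
    have h1 := hzb j
    have h2 := hzb (j + 1)
    have h3 := norm_nonneg (z j)
    have h4 := norm_nonneg (z (j + 1))
    rw [abs_le]
    constructor <;> linarith) (fun j hj => by
    obtain ⟨h1, h2⟩ := hlate j hj
    have e : z j = (y (t j) - y' (t j)) + (y' (t j) - y' (t' j)) := by simp only [hz]; abel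
    rw [abs_of_nonneg (norm_nonneg _), e]
    refine (norm_add_le _ _).trans ?_
    have h3 : V * |t j - t' j| ≤ V * (2 * D.K * (C' * Real.exp α) * w j) :=
      mul_le_mul_of_nonneg_left h2 hVpos.le
    have h4 := hspeed' (t' j) (t j)
    calc _ ≤ _ := add_le_add h1 (h4.trans h3)
      _ = _ := by ring)
  -- The recursion bounds `z j` and `d (j + 1) - d j` with the factor `1/4 + 1/8`. Writing `d j`
  -- through `d (j + 1)` adds 1/4, because the weight drops by 4; hence `β = 5/8`.
  have hbound := weighted_bound_of_self_improving (fun j => max ‖z j‖ |d j|) w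
    (fun j => (hw0 j).le) (β := 5 / 8) (c := C₁ * m) (by norm_num) (by norm_num) (by positivity)
    (Z₀ := max Z₁ Z₂) (fun j => max_le
      (by
        have := hZ₂ j
        simp only [abs_of_nonneg (norm_nonneg _)] at this
        exact this.trans (mul_le_mul_of_nonneg_right (le_max_right _ _) (hw0 j).le))
      ((hZ₁ j).trans (mul_le_mul_of_nonneg_right (le_max_left _ _) (hw0 j).le)))
    (fun Z hZ0 hZ j => by
      have hq : D.K * Real.exp (-D.κ * T) * Λ ≤ 1 / 16 := hTq
      have hzd := H.norm_le_of_discrete (Z := Z) (e := Cs * (δ * Z + m)) (by linarith) hΛ1 hq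
        (κ₀ := 1 / (32 * Λ * A)) (by positivity) (by rw [← hA]; refine le_of_eq ?_; field_simp) s hs1
        z (fun j => d (j + 1) - d j) w (fun j => Cs * (δ * |d j| + m * w j))
        (fun j => (hw0 j).le) hw1 hwΛ hph hres
        (fun j => by
          have h1 : δ * |d j| ≤ δ * (Z * w j) :=
            mul_le_mul_of_nonneg_left ((le_max_right _ _).trans (hZ j)) hδ0
          have h2 : Cs * (δ * |d j| + m * w j) ≤ Cs * (δ * (Z * w j) + m * w j) :=
            mul_le_mul_of_nonneg_left (by linarith) (by linarith)
          exact h2.trans (le_of_eq (by ring)))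
        hZ0 (by positivity) (fun j => (le_max_left _ _).trans (hZ j)) j
      rw [← hA] at hzd
      have e1 : Z / 4 + 4 * Λ * A * (Cs * (δ * Z + m)) = Z / 4 + (C₁ * δ) * Z + C₁ * m := by
        rw [hC₁]; ring
      rw [e1] at hzd
      have e2 : (C₁ * δ) * Z ≤ 1 / 8 * Z := mul_le_mul_of_nonneg_right hC₁δ hZ0
      have hb : (Z / 4 + C₁ * δ * Z + C₁ * m) * w j ≤ (3 / 8 * Z + C₁ * m) * w j :=
        mul_le_mul_of_nonneg_right (by linarith) (hw0 j).le
      have hZw : 0 ≤ Z * w j := mul_nonneg hZ0 (hw0 j).le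
      refine max_le (hzd.1.trans (hb.trans ?_)) ?_
      · exact mul_le_mul_of_nonneg_right (by linarith) (hw0 j).le
      · have h1 : |d (j + 1)| ≤ Z * (1 / 4 * w j) :=
          ((le_max_right _ _).trans (hZ (j + 1))).trans (mul_le_mul_of_nonneg_left (hw4 j) hZ0)
        have e : d j = d (j + 1) - (d (j + 1) - d j) := by ring
        rw [e]
        refine (abs_sub _ _).trans ((add_le_add h1 (hzd.2.trans hb)).trans (le_of_eq ?_))
        ring)
  have hfin : ∀ j, ‖z j‖ ≤ 3 * C₁ * m * w j ∧ |d j| ≤ 3 * C₁ * m * w j := by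
    intro j
    have h1 := hbound j
    have h2 : C₁ * m / (1 - 5 / 8) * w j ≤ 3 * C₁ * m * w j := by
      refine mul_le_mul_of_nonneg_right ?_ (hw0 j).le
      have : 0 ≤ C₁ * m := by positivity
      have e : C₁ * m / (1 - 5 / 8) = 8 / 3 * (C₁ * m) := by ring
      rw [e]; linarith
    exact ⟨(le_max_left _ _).trans (h1.trans h2), (le_max_right _ _).trans (h1.trans h2)⟩
  intro r
  obtain ⟨j, hj1, hj2⟩ := exists_grid_cell Q'.spacing (by linarith) r
  obtain ⟨h1, h2⟩ := hfin j
  have hlen := abs_le.1 (Q'.spacing j)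
  have h3 : ‖y (t' j) - y' (t' j)‖ ≤ (V + 1) * (3 * C₁ * m * w j) := by
    have e : y (t' j) - y' (t' j) = (y (t' j) - y (t j)) + z j := by simp only [hz]; abel
    rw [e]
    have h4 := hspeed (t j) (t' j)
    rw [abs_sub_comm] at h4
    have h5 : V * |t j - t' j| ≤ V * (3 * C₁ * m * w j) := mul_le_mul_of_nonneg_left h2 hVpos.le
    refine (norm_add_le _ _).trans ?_
    linarith
  have hmw : 0 ≤ m * w j := mul_nonneg hm (hw0 j).le
  have h4 := H.norm_sub_le_of_forced ((S 0).forced.shift (t' j)) ((S' 0).forced.shift (t' j))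
    (b := T + 1) (μ := m * w j) hmw (fun q hq => by
      refine (hhh _).trans (mul_le_mul_of_nonneg_left (Real.exp_le_exp.2 ?_) hm)
      linarith only [mul_nonneg hα.le hq.1]) (r - t' j) ⟨by linarith, by linarith⟩
  simp only [add_zero, add_sub_cancel] at h4
  have h5 : w j ≤ Λ * Real.exp (-α * r) := by
    simp only [hw, hΛ]
    rw [← Real.exp_add]
    refine Real.exp_le_exp.2 ?_
    linarith only [mul_le_mul_of_nonneg_left (show r ≤ t' j + 2 * T by linarith) hα.le]
  calc ‖y r - y' r‖ ≤ G * (‖y (t' j) - y' (t' j)‖ + m * w j) := h4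
    _ ≤ G * ((V + 1) * (3 * C₁ * m * w j) + m * w j) :=
        mul_le_mul_of_nonneg_left (by linarith) (by linarith)
    _ = G * (3 * C₁ * (V + 1) + 1) * m * w j := by ring
    _ ≤ G * (3 * C₁ * (V + 1) + 1) * m * (Λ * Real.exp (-α * r)) :=
        mul_le_mul_of_nonneg_left h5 (by positivity)
    _ = _ := by ring

end Comparison

/-! ### Two-sided orbits of perturbed hyperbolic recursions. -/

section Existence

variable {E : Type*} [NormedAddCommGroup E] [NormedSpace ℝ E]

namespace HypOrbit

variable {D : HypData} {f : E → E} {x : ℝ → E} (H : HypOrbit D f x)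

include H

theorem norm_sub_Pu_le (t : ℝ) (v : E) : ‖v - H.Pu t v‖ ≤ (1 + D.K) * ‖v‖ :=
  (norm_sub_le _ _).trans (by linarith [H.norm_Pu_le t v])

/-- Removing the component along the flow and the unstable component, what is left contracts. -/
theorem norm_sub_Pu_le_of_image {s s' : ℝ} (hs : s ≤ s') (v r : E) :
    ‖(H.U s s' v - H.ph s v • f (x s') + r) - H.Pu s' (H.U s s' v - H.ph s v • f (x s') + r)‖
      ≤ D.K * Real.exp (-D.κ * (s' - s)) * ‖v‖ + (1 + D.K) * ‖r‖ := by
  have h2 : H.Ps s v = v - H.Pu s v - H.ph s v • f (x s) := by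
    have := H.decomp s v
    rw [sub_sub, eq_sub_iff_add_eq, ← add_assoc]
    exact this
  have h1 : (H.U s s' v - H.ph s v • f (x s') + r)
      - H.Pu s' (H.U s s' v - H.ph s v • f (x s') + r)
      = H.U s s' (H.Ps s v) + (r - H.Pu s' r) := by
    rw [h2, map_add, map_sub, map_sub, map_sub, map_smul, map_smul, H.Pu_vel, smul_zero, H.Pu_U,
      H.U_vel]
    abel
  rw [h1]
  exact (norm_add_le _ _).trans
    (add_le_add (H.norm_U_Ps_le s s' v hs) (H.norm_sub_Pu_le _ _))

/-- The error of the flow map `A` with respect to its linearization, when the flight time is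
corrected by the phase. -/
noncomputable def discreteError (s : ℤ → ℝ) (θ : ℤ → ℝ) (A : ℤ → E × ℝ → E) (j : ℤ) (u : E × ℝ) : E :=
  A j u - (H.U (s j) (s (j + 1)) u.1 - H.ph (s j) u.1 • f (x (s (j + 1))))
    - θ j • f (x (s (j + 1)))

/-- The fixed points of this map are the two-sided orbits of `A`. -/
noncomputable def discreteMap (s : ℤ → ℝ) (θ : ℤ → ℝ) (A : ℤ → E × ℝ → E) (N : ℝ) (u : ℤ → E × ℝ)
    (j : ℤ) : E × ℝ :=
  ((A (j - 1) (u (j - 1)) - H.Pu (s j) (A (j - 1) (u (j - 1))))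
    + H.U (s (j + 1)) (s j) (H.Pu (s (j + 1)) ((u (j + 1)).1 - H.discreteError s θ A j (u j))),
    (u (j + 1)).2 + H.ph (s j) (u j).1 / N)

/-- Applying `Pu` to the fixed point equation leaves only the term pulled back from the next
section. Flowing it forward by the linearization, and using that `Pu` annihilates velocities, shows
that the unstable parts of `u (j + 1)` and `A j (u j)` agree; the complementary parts agree by
construction. -/
theorem eq_of_discreteMap_eq {s θ : ℤ → ℝ} {A : ℤ → E × ℝ → E} {N : ℝ} {u : ℤ → E × ℝ}
    (hu : H.discreteMap s θ A N u = u) (j : ℤ) :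
    (u (j + 1)).1 = A j (u j) ∧ (u j).2 = (u (j + 1)).2 + H.ph (s j) (u j).1 / N := by
  have h1 : ∀ j, (u j).1 = (A (j - 1) (u (j - 1)) - H.Pu (s j) (A (j - 1) (u (j - 1))))
      + H.U (s (j + 1)) (s j) (H.Pu (s (j + 1)) ((u (j + 1)).1 - H.discreteError s θ A j (u j))) :=
    fun j => (congrArg Prod.fst (congrFun hu j)).symm
  have h2 : ∀ j, H.Pu (s j) (u j).1
      = H.U (s (j + 1)) (s j) (H.Pu (s (j + 1)) ((u (j + 1)).1 - H.discreteError s θ A j (u j))) := by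
    intro j
    conv_lhs => rw [h1 j]
    rw [map_add, map_sub (H.Pu (s j)) (A (j - 1) (u (j - 1))), H.Pu_Pu, sub_self, zero_add, H.Pu_U,
      H.Pu_Pu]
  refine ⟨?_, (congrArg Prod.snd (congrFun hu j)).symm⟩
  have h3 : H.Pu (s (j + 1)) (u (j + 1)).1 = H.Pu (s (j + 1)) (A j (u j)) := by
    have h4 := congrArg (H.U (s j) (s (j + 1))) (h2 j)
    rw [H.U_comp, H.U_self, ← H.Pu_U, discreteError, map_sub, map_sub, map_sub,
      map_sub, map_smul, map_smul, H.Pu_vel, smul_zero, smul_zero, sub_zero, sub_zero] at h4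
    have : H.Pu (s (j + 1)) (u (j + 1)).1 - H.Pu (s (j + 1)) (A j (u j)) = 0 := by
      rw [sub_sub_eq_add_sub] at h4
      have h5 := sub_eq_zero.2 h4
      rw [← neg_eq_zero, ← h5]; abel
    exact sub_eq_zero.1 this
  have h5 := h1 (j + 1)
  rw [← h2 (j + 1), add_sub_cancel_right, h3] at h5
  rw [h5]; abel

/-- Existence of two-sided orbits of small Lipschitz perturbations of the linearized flow. -/
theorem exists_discrete_orbit [CompleteSpace E] {T Λ N ε e₁ b δ₂ M : ℝ} (hT : 0 ≤ T) (hΛ : 1 ≤ Λ)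
    (hq : D.K * Real.exp (-D.κ * T) * Λ ≤ 1 / 16) (hN : 4 * D.K ≤ N) (hε0 : 0 ≤ ε)
    (hε : Λ * (1 + D.K) * ε ≤ 1 / 32) (hM : 0 ≤ M) (s : ℤ → ℝ) (hs : ∀ j, s (j + 1) = s j + T)
    (θ : ℤ → ℝ) (A : ℤ → E × ℝ → E) (w : ℤ → ℝ) (hw : ∀ j, 0 < w j)
    (hw4 : ∀ j, w (j + 1) ≤ 1 / 4 * w j) (hwΛ : ∀ j, w j ≤ Λ * w (j + 1)) (hθ : ∀ j, |θ j| ≤ b)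
    (hlip : ∀ j u u', ‖Prod.fst u‖ ≤ δ₂ → ‖Prod.fst u'‖ ≤ δ₂ →
      ‖H.discreteError s θ A j u - H.discreteError s θ A j u'‖ ≤ ε * ‖u - u'‖)
    (hsize : ∀ j u, ‖Prod.fst u‖ ≤ δ₂ → ‖H.discreteError s θ A j u‖ ≤ e₁)
    (hδ₂ : 1 / 8 * δ₂ + D.B * b + (2 + D.K) * e₁ ≤ δ₂)
    (u₀ : ℤ → E × ℝ) (hu₀ : ∀ j, ‖(u₀ j).1‖ ≤ δ₂)
    (hu₀A : ∀ j, ‖A j (u₀ j) - (u₀ (j + 1)).1‖ ≤ M * w (j + 1))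
    (hu₀t : ∀ j, (u₀ j).2 = (u₀ (j + 1)).2 + H.ph (s j) (u₀ j).1 / N) :
    ∃ u : ℤ → E × ℝ, (∀ j, ‖(u j).1‖ ≤ δ₂) ∧ (∀ j, (u (j + 1)).1 = A j (u j)) ∧
      (∀ j, (u j).2 = (u (j + 1)).2 + H.ph (s j) (u j).1 / N) ∧
      ∀ j, ‖u j - u₀ j‖ ≤ 2 * ((2 + D.K) * M) * w j := by
  have hK := D.one_le_K
  have hB := D.one_le_B
  -- The second coordinate is the time shift divided by `N`. With `N ≥ 4 * D.K` the phase of the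
  -- first coordinate contributes at most 1/4 to it, so the product norm is contracted.
  have hN0 : 0 < N := by linarith
  set q := D.K * Real.exp (-D.κ * T) with hqdef
  have hq0 : 0 ≤ q := by positivity
  have hq16 : q ≤ 1 / 16 := by nlinarith
  have hsT : ∀ j, s (j + 1) - s j = T := fun j => by rw [hs]; ring
  have hsle : ∀ j, s j ≤ s (j + 1) := fun j => by rw [hs]; linarith
  have hUu : ∀ j v, ‖H.U (s (j + 1)) (s j) (H.Pu (s (j + 1)) v)‖ ≤ q * ‖v‖ := fun j v => by
    have := H.norm_U_Pu_le (s (j + 1)) (s j) v (hsle j)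
    rwa [hsT] at this
  have hUs : ∀ j v r, ‖(H.U (s j) (s (j + 1)) v - H.ph (s j) v • f (x (s (j + 1))) + r)
      - H.Pu (s (j + 1)) (H.U (s j) (s (j + 1)) v - H.ph (s j) v • f (x (s (j + 1))) + r)‖
      ≤ q * ‖v‖ + (1 + D.K) * ‖r‖ := fun j v r => by
    have := H.norm_sub_Pu_le_of_image (hsle j) v r
    rwa [hsT] at this
  have hA : ∀ j u, A j u = (H.U (s j) (s (j + 1)) u.1 - H.ph (s j) u.1 • f (x (s (j + 1))))
      + (H.discreteError s θ A j u + θ j • f (x (s (j + 1)))) := fun j u => by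
    rw [discreteError]; abel
  have hε16 : ε ≤ 1 / 32 := by
    have h1 : 1 ≤ Λ * (1 + D.K) := by nlinarith
    nlinarith
  obtain ⟨u, huS, hu, hd⟩ := exists_fixed_point_of_weighted_contraction w
    {u : ℤ → E × ℝ | ∀ j, ‖(u j).1‖ ≤ δ₂}
    (fun u v e hu he hb j => by
      have hlim : Tendsto (fun n => u n j) atTop (𝓝 (v j)) := by
        rw [tendsto_iff_norm_sub_tendsto_zero]
        refine squeeze_zero (fun _ => norm_nonneg _) (fun n => hb n j) ?_
        simpa using he.mul_const (w j)
      exact le_of_tendsto' ((continuous_fst.tendsto _).comp hlim).norm (fun n => hu n j))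
    (H.discreteMap s θ A N)
    (fun u hu j => by
      obtain ⟨i, rfl⟩ : ∃ i, j = i + 1 := ⟨j - 1, by ring⟩
      simp only [discreteMap, add_sub_cancel_right]
      have h1 := hUs i (u i).1 (H.discreteError s θ A i (u i) + θ i • f (x (s (i + 1))))
      have hPθ : (1 + D.K) * ‖H.discreteError s θ A i (u i)‖ ≤ (1 + D.K) * e₁ :=
        mul_le_mul_of_nonneg_left (hsize i _ (hu i)) (by linarith)
      -- The velocity term is split off before `Pu` is estimated: being annihilated by `Pu`, it
      -- costs `D.B * b` without a factor `1 + D.K`.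
      have h2 : ‖A i (u i) - H.Pu (s (i + 1)) (A i (u i))‖ ≤ q * δ₂ + (1 + D.K) * e₁ + D.B * b := by
        have e : A i (u i) - H.Pu (s (i + 1)) (A i (u i))
            = ((H.U (s i) (s (i + 1)) (u i).1 - H.ph (s i) (u i).1 • f (x (s (i + 1)))
                + H.discreteError s θ A i (u i))
              - H.Pu (s (i + 1)) (H.U (s i) (s (i + 1)) (u i).1
                - H.ph (s i) (u i).1 • f (x (s (i + 1))) + H.discreteError s θ A i (u i)))
              + θ i • f (x (s (i + 1))) := by
          rw [hA i (u i), ← add_assoc, map_add _ _ (θ i • f (x (s (i + 1)))), map_smul, H.Pu_vel,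
            smul_zero, add_zero]
          abel
        rw [e]
        refine (norm_add_le _ _).trans (add_le_add ((hUs i _ _).trans (add_le_add
          (mul_le_mul_of_nonneg_left (hu i) hq0) hPθ)) ?_)
        rw [norm_smul, Real.norm_eq_abs, mul_comm]
        exact mul_le_mul (H.norm_vel_le _) (hθ i) (abs_nonneg _) (by linarith)
      have h3 := hUu (i + 1) ((u (i + 1 + 1)).1 - H.discreteError s θ A (i + 1) (u (i + 1)))
      have h4 : ‖(u (i + 1 + 1)).1 - H.discreteError s θ A (i + 1) (u (i + 1))‖ ≤ δ₂ + e₁ :=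
        (norm_sub_le _ _).trans (add_le_add (hu _) (hsize _ _ (hu _)))
      have hδ0 : 0 ≤ δ₂ := (norm_nonneg _).trans (hu 0)
      have he0 : 0 ≤ e₁ := (norm_nonneg _).trans (hsize 0 _ (hu 0))
      have h5 : q * (δ₂ + e₁) ≤ 1 / 16 * (δ₂ + e₁) := mul_le_mul_of_nonneg_right hq16 (by linarith)
      have h6 : q * δ₂ ≤ 1 / 16 * δ₂ := mul_le_mul_of_nonneg_right hq16 hδ0
      have h7 := h3.trans (mul_le_mul_of_nonneg_left h4 hq0)
      refine (norm_add_le _ _).trans ((add_le_add h2 h7).trans ?_)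
      nlinarith)
    (β := 1 / 2) (by norm_num) (by norm_num)
    (fun u hu v hv Z hZ0 hZ j => by
      have hz : ∀ j, ‖(u j).1 - (v j).1‖ ≤ Z * w j := fun j => (norm_fst_le (u j - v j)).trans (hZ j)
      have ht : ∀ j, |(u j).2 - (v j).2| ≤ Z * w j := fun j => (norm_snd_le (u j - v j)).trans (hZ j)
      have hE : ∀ j, ‖H.discreteError s θ A j (u j) - H.discreteError s θ A j (v j)‖
          ≤ ε * (Z * w j) := fun j =>
        (hlip j _ _ (hu j) (hv j)).trans (mul_le_mul_of_nonneg_left (hZ j) hε0)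
      obtain ⟨i, rfl⟩ : ∃ i, j = i + 1 := ⟨j - 1, by ring⟩
      rw [Prod.norm_def]
      refine max_le ?_ ?_
      · simp only [discreteMap, add_sub_cancel_right, Prod.fst_sub]
        have e : A i (u i) - H.Pu (s (i + 1)) (A i (u i))
            + H.U (s (i + 1 + 1)) (s (i + 1)) (H.Pu (s (i + 1 + 1))
              ((u (i + 1 + 1)).1 - H.discreteError s θ A (i + 1) (u (i + 1))))
            - (A i (v i) - H.Pu (s (i + 1)) (A i (v i))
            + H.U (s (i + 1 + 1)) (s (i + 1)) (H.Pu (s (i + 1 + 1))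
              ((v (i + 1 + 1)).1 - H.discreteError s θ A (i + 1) (v (i + 1)))))
            = ((A i (u i) - A i (v i)) - H.Pu (s (i + 1)) (A i (u i) - A i (v i)))
            + H.U (s (i + 1 + 1)) (s (i + 1)) (H.Pu (s (i + 1 + 1))
              (((u (i + 1 + 1)).1 - (v (i + 1 + 1)).1)
              - (H.discreteError s θ A (i + 1) (u (i + 1))
                - H.discreteError s θ A (i + 1) (v (i + 1))))) := by
          simp only [map_sub]; abel
        have eA : A i (u i) - A i (v i) = H.U (s i) (s (i + 1)) ((u i).1 - (v i).1)
            - H.ph (s i) ((u i).1 - (v i).1) • f (x (s (i + 1)))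
            + (H.discreteError s θ A i (u i) - H.discreteError s θ A i (v i)) := by
          rw [hA i (u i), hA i (v i), map_sub, map_sub, sub_smul]
          abel
        rw [e, eA]
        have h1 := hUs i ((u i).1 - (v i).1)
          (H.discreteError s θ A i (u i) - H.discreteError s θ A i (v i))
        have h3 := hUu (i + 1) (((u (i + 1 + 1)).1 - (v (i + 1 + 1)).1)
              - (H.discreteError s θ A (i + 1) (u (i + 1))
                - H.discreteError s θ A (i + 1) (v (i + 1))))
        refine (norm_add_le _ _).trans ((add_le_add h1 (h3.trans (mul_le_mul_of_nonneg_left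
          (norm_sub_le _ _) hq0))).trans ?_)
        set W := w (i + 1) with hW
        have hW0 : 0 ≤ Z * W := mul_nonneg hZ0 (hw _).le
        have b1 : q * ‖(u i).1 - (v i).1‖ ≤ 1 / 16 * (Z * W) := by
          calc _ ≤ q * (Z * (Λ * W)) := mul_le_mul_of_nonneg_left
                ((hz i).trans (mul_le_mul_of_nonneg_left (hwΛ i) hZ0)) hq0
            _ = (q * Λ) * (Z * W) := by ring
            _ ≤ _ := mul_le_mul_of_nonneg_right hq hW0
        have b2 : (1 + D.K) * ‖H.discreteError s θ A i (u i) - H.discreteError s θ A i (v i)‖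
            ≤ 1 / 32 * (Z * W) := by
          calc _ ≤ (1 + D.K) * (ε * (Z * (Λ * W))) := mul_le_mul_of_nonneg_left
                ((hE i).trans (mul_le_mul_of_nonneg_left
                  (mul_le_mul_of_nonneg_left (hwΛ i) hZ0) hε0)) (by linarith)
            _ = (Λ * (1 + D.K) * ε) * (Z * W) := by ring
            _ ≤ _ := mul_le_mul_of_nonneg_right hε hW0
        have b3 : ‖(u (i + 1 + 1)).1 - (v (i + 1 + 1)).1‖ ≤ 1 / 4 * (Z * W) := by
          calc _ ≤ Z * (1 / 4 * W) := (hz _).trans (mul_le_mul_of_nonneg_left (hw4 _) hZ0)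
            _ = _ := by ring
        have b4 := (hE (i + 1)).trans (mul_le_mul_of_nonneg_right hε16 hW0)
        have b5 := mul_le_mul hq16 (add_le_add b3 b4) (by positivity) (by norm_num)
        linarith
      -- The time shift is propagated from the future, where the weight is smaller by a factor 4.
      · simp only [discreteMap, Prod.snd_sub, Real.norm_eq_abs]
        have e : (u (i + 1 + 1)).2 + H.ph (s (i + 1)) (u (i + 1)).1 / N
            - ((v (i + 1 + 1)).2 + H.ph (s (i + 1)) (v (i + 1)).1 / N)
            = ((u (i + 1 + 1)).2 - (v (i + 1 + 1)).2)
              + H.ph (s (i + 1)) ((u (i + 1)).1 - (v (i + 1)).1) / N := by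
          rw [map_sub]; ring
        rw [e]
        have hW0 : 0 ≤ Z * w (i + 1) := mul_nonneg hZ0 (hw _).le
        have h1 : |H.ph (s (i + 1)) ((u (i + 1)).1 - (v (i + 1)).1) / N| ≤ 1 / 4 * (Z * w (i + 1)) := by
          rw [abs_div, abs_of_pos hN0, div_le_iff₀ hN0]
          refine (H.norm_ph_le _ _).trans ((mul_le_mul_of_nonneg_left (hz _) (by linarith)).trans ?_)
          nlinarith
        have h2 : |(u (i + 1 + 1)).2 - (v (i + 1 + 1)).2| ≤ 1 / 4 * (Z * w (i + 1)) := by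
          calc _ ≤ Z * (1 / 4 * w (i + 1)) := (ht _).trans (mul_le_mul_of_nonneg_left (hw4 _) hZ0)
            _ = _ := by ring
        refine (abs_add_le _ _).trans ?_
        linarith)
    u₀ hu₀ (M₀ := (2 + D.K) * M) (by positivity)
    (fun j => by
      obtain ⟨i, rfl⟩ : ∃ i, j = i + 1 := ⟨j - 1, by ring⟩
      have hW0 : 0 ≤ M * w (i + 1) := mul_nonneg hM (hw _).le
      rw [Prod.norm_def]
      refine max_le ?_ ?_
      · simp only [discreteMap, add_sub_cancel_right, Prod.fst_sub]
        -- The pulled-back term equals the unstable part of `u₀` minus the pulled-back defect of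
        -- `u₀`, so the displacement of `u₀` by the map involves only its defects as an orbit.
        have h1 : H.U (s (i + 1 + 1)) (s (i + 1)) (H.Pu (s (i + 1 + 1))
            ((u₀ (i + 1 + 1)).1 - H.discreteError s θ A (i + 1) (u₀ (i + 1))))
            = H.Pu (s (i + 1)) (u₀ (i + 1)).1 - H.U (s (i + 1 + 1)) (s (i + 1)) (H.Pu (s (i + 1 + 1))
              (A (i + 1) (u₀ (i + 1)) - (u₀ (i + 1 + 1)).1)) := by
          have h2 : H.Pu (s (i + 1)) (u₀ (i + 1)).1 = H.U (s (i + 1 + 1)) (s (i + 1))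
              (H.Pu (s (i + 1 + 1)) (H.U (s (i + 1)) (s (i + 1 + 1)) (u₀ (i + 1)).1)) := by
            rw [H.Pu_U, H.U_comp, H.U_self]
          rw [h2, ← map_sub (H.U _ _), ← map_sub (H.Pu _), discreteError]
          congr 1
          simp only [map_sub, map_smul, H.Pu_vel, smul_zero, sub_zero]
          abel
        rw [h1]
        have e : A i (u₀ i) - H.Pu (s (i + 1)) (A i (u₀ i)) + (H.Pu (s (i + 1)) (u₀ (i + 1)).1
            - H.U (s (i + 1 + 1)) (s (i + 1)) (H.Pu (s (i + 1 + 1))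
              (A (i + 1) (u₀ (i + 1)) - (u₀ (i + 1 + 1)).1))) - (u₀ (i + 1)).1
            = ((A i (u₀ i) - (u₀ (i + 1)).1) - H.Pu (s (i + 1)) (A i (u₀ i) - (u₀ (i + 1)).1))
              - H.U (s (i + 1 + 1)) (s (i + 1)) (H.Pu (s (i + 1 + 1))
              (A (i + 1) (u₀ (i + 1)) - (u₀ (i + 1 + 1)).1)) := by
          rw [map_sub (H.Pu (s (i + 1))) (A i (u₀ i))]; abel
        rw [e]
        have h3 := (H.norm_sub_Pu_le (s (i + 1)) (A i (u₀ i) - (u₀ (i + 1)).1)).trans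
          (mul_le_mul_of_nonneg_left (hu₀A i) (by linarith))
        have h4 := hUu (i + 1) (A (i + 1) (u₀ (i + 1)) - (u₀ (i + 1 + 1)).1)
        have h5 : ‖A (i + 1) (u₀ (i + 1)) - (u₀ (i + 1 + 1)).1‖ ≤ M * w (i + 1) :=
          (hu₀A _).trans (mul_le_mul_of_nonneg_left ((hw4 _).trans (by linarith [hw (i + 1)])) hM)
        have h6 := mul_le_mul hq16 h5 (norm_nonneg _) (by norm_num)
        refine (norm_sub_le _ _).trans ((add_le_add h3 (h4.trans h6)).trans ?_)
        nlinarith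
      · simp only [discreteMap, Prod.snd_sub, ← hu₀t (i + 1), sub_self, norm_zero]
        have := hw (i + 1)
        positivity)
  refine ⟨u, huS, fun j => (H.eq_of_discreteMap_eq hu j).1, fun j => (H.eq_of_discreteMap_eq hu j).2,
    fun j => (hd j).trans (le_of_eq ?_)⟩
  norm_num
  left; ring

end HypOrbit

end Existence

/-! ### Sections on a half-line and the section map. -/

section HalfLine

variable {E : Type*} [NormedAddCommGroup E] [NormedSpace ℝ E]

theorem PhaseControl.abs_increment_le {x y : ℝ → E} {ph : ℝ → E →L[ℝ] ℝ} {φ : ℝ → ℝ}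
    {C N δ τ : ℝ} (P : PhaseControl x y ph φ C N δ τ) {t t' : ℝ} (ht : τ ≤ t) (ht' : τ ≤ t')
    (hN : |t' - t| ≤ N) : |φ t' - φ t - (t' - t)| ≤ C * δ := by
  have hN' := abs_le.1 hN
  rcases le_total t t' with h | h
  · have h2 := P.increment t ht (t' - t) ⟨by linarith, by linarith⟩
    rwa [add_sub_cancel] at h2
  · have h2 := P.increment t' ht' (t - t') ⟨by linarith, by linarith⟩
    rw [add_sub_cancel] at h2
    rw [← abs_neg]
    refine le_trans (le_of_eq ?_) h2
    congr 1; ring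

/-- Section times for a solution that shadows `x` on a half-line, continued to all integers. -/
theorem exists_halfLine_sectionTimes {x y : ℝ → E} {ph : ℝ → E →L[ℝ] ℝ} {φ : ℝ → ℝ} {C T δ τ : ℝ}
    (hT : 4 ≤ T) (hC : C * δ ≤ 1 / 16) (P : PhaseControl x y ph φ C (2 * T + 4) δ τ) :
    ∃ (s₀ : ℝ) (t : ℤ → ℝ), τ ≤ t 0 ∧ t 0 ≤ τ + 2 ∧
      (∀ j : ℤ, 0 ≤ j → τ ≤ t j ∧ ph (s₀ + j * T) (y (t j) - x (s₀ + j * T)) = 0 ∧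
        ‖y (t j) - x (s₀ + j * T)‖ ≤ C * δ ∧ |φ (t j) - (s₀ + j * T)| ≤ C * δ) ∧
      (∀ j, |t (j + 1) - t j - T| ≤ 3 * (C * δ)) ∧ ∀ j < 0, t (j + 1) - t j = T := by
  have hC0 : 0 ≤ C * δ := by
    have := P.increment τ le_rfl 0 ⟨le_rfl, by linarith⟩
    simpa using this
  set s₀ := φ (τ + 1) with hs₀
  have hsec : ∀ n : ℕ, ∃ t, τ ≤ t ∧ ph (s₀ + n * T) (y t - x (s₀ + n * T)) = 0 ∧
      ‖y t - x (s₀ + n * T)‖ ≤ C * δ ∧ |φ t - (s₀ + n * T)| ≤ C * δ := fun n =>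
    P.exists_section _ (by
      have : (0 : ℝ) ≤ n * T := by positivity
      linarith)
  choose t' h1 h2 h3 h4 using hsec
  -- For negative indices there is no solution to follow; the times continue with spacing exactly
  -- `T`, as for the unperturbed orbit.
  set t : ℤ → ℝ := fun j => if 0 ≤ j then t' j.toNat else t' 0 + j * T with ht
  have htn : ∀ n : ℕ, t n = t' n := fun n => by simp [ht]
  have htneg : ∀ j < 0, t j = t' 0 + j * T := fun j hj => by simp [ht, not_le.2 hj]
  have ht0 : t 0 = t' 0 := htn 0
  refine ⟨s₀, t, ?_, ?_, fun j hj => ?_, fun j => ?_, fun j hj => ?_⟩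
  · rw [ht0]; exact h1 0
  · have h5 := h4 0
    rw [Nat.cast_zero, zero_mul, add_zero, hs₀] at h5
    have h6 := P.abs_sub_sub_le (t := τ + 1) (t' := t' 0) (S := 1) (by linarith) (h1 0)
      (h5.trans (by linarith)) (by linarith)
    have h7 := abs_le.1 h5
    have h8 := abs_le.1 h6
    rw [ht0]
    linarith
  · obtain ⟨n, rfl⟩ := Int.eq_ofNat_of_zero_le hj
    rw [htn]
    exact ⟨h1 n, h2 n, h3 n, h4 n⟩
  · rcases lt_or_ge j 0 with hj | hj
    · rcases lt_or_ge (j + 1) 0 with hj1 | hj1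
      · rw [htneg j hj, htneg (j + 1) hj1]
        push_cast
        rw [show t' 0 + ((j : ℝ) + 1) * T - (t' 0 + j * T) - T = 0 by ring, abs_zero]
        linarith
      · have : j = -1 := by omega
        subst this
        rw [htneg _ hj, show (-1 : ℤ) + 1 = 0 by ring, ht0]
        push_cast
        rw [show t' 0 - (t' 0 + -1 * T) - T = 0 by ring, abs_zero]
        linarith
    · obtain ⟨n, rfl⟩ := Int.eq_ofNat_of_zero_le hj
      have e : ((n : ℤ) + 1) = ((n + 1 : ℕ) : ℤ) := by push_cast; ring
      rw [e, htn, htn]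
      have a1 := abs_le.1 (h4 n)
      have a2 := abs_le.1 (h4 (n + 1))
      push_cast at a2
      have key := P.abs_sub_sub_le (t := t' n) (t' := t' (n + 1)) (S := T + 1)
        (h1 _) (h1 _) (abs_le.2 ⟨by linarith, by linarith⟩) (by linarith)
      have a3 := abs_le.1 key
      rw [abs_le]
      constructor <;> linarith
  · rcases lt_or_ge (j + 1) 0 with hj1 | hj1
    · rw [htneg j hj, htneg (j + 1) hj1]
      push_cast; ring
    · have : j = -1 := by omega
      subst this
      rw [htneg _ hj, show (-1 : ℤ) + 1 = 0 by ring, ht0]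
      push_cast; ring

/-- The map that takes the deviation `u.1` from the point `x (s j)` at the time `t j + N * u.2` to
the deviation from `x (s (j + 1))` after the flight time, corrected by the phase. -/
def sectionMap (x : ℝ → E) (ph : ℝ → E →L[ℝ] ℝ) (Y : ℝ → E → ℝ → E) (s t θ : ℤ → ℝ) (T N : ℝ)
    (j : ℤ) (u : E × ℝ) : E :=
  Y (t j + N * u.2) (x (s j) + u.1) (t j + N * u.2 + (T + θ j - ph (s j) u.1)) - x (s (j + 1))

namespace HypOrbit

variable {D : HypData} {f : E → E} {x : ℝ → E} (H : HypOrbit D f x)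

include H

theorem exists_forced_solution [CompleteSpace E] {h : ℝ → E} {C δ : ℝ} (hb : ∀ t, ‖h t‖ ≤ C)
    (hlip : ∀ a b, ‖h a - h b‖ ≤ δ * |a - b|) (t₀ : ℝ) (x₀ : E) :
    ∃ y, y t₀ = x₀ ∧ IsForced f h y := by
  have hc : Continuous h := by
    refine (LipschitzWith.of_dist_le_mul (K := δ.toNNReal) fun a b => ?_).continuous
    rw [dist_eq_norm, Real.dist_eq]
    exact (hlip a b).trans (mul_le_mul_of_nonneg_right (Real.le_coe_toNNReal δ) (abs_nonneg _))
  have hf : Continuous f := H.differentiable.continuous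
  exact exists_global_solution (v := fun t y => f y + h t) (L := D.Lf) (C := ‖f x₀‖ + C)
    (by linarith [D.one_le_Lf])
    (fun t y z => by rw [add_sub_add_right_eq_sub]; exact H.norm_vel_sub_le y z)
    (fun u hu => (hf.comp hu).add hc) t₀ x₀
    (fun t => (norm_add_le _ _).trans (add_le_add_right (hb t) _))

theorem forced_unique {h y z : ℝ → E} (hy : IsForced f h y) (hz : IsForced f h z) {t₀ : ℝ}
    (e : y t₀ = z t₀) : y = z :=
  global_solution_unique (v := fun t y => f y + h t) (L := D.Lf) (by linarith [D.one_le_Lf])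
    (fun t y z => by rw [add_sub_add_right_eq_sub]; exact H.norm_vel_sub_le y z) hy hz e

/-- The orbits of the section map come from solutions. -/
theorem exists_forced_of_discrete_orbit {h : ℝ → E} {Y : ℝ → E → ℝ → E}
    (hY : ∀ t z, Y t z t = z ∧ IsForced f h (Y t z)) {s t θ : ℤ → ℝ} {T N : ℝ} (hN : N ≠ 0)
    (ht : ∀ j, t (j + 1) = t j + T + θ j)
    {u : ℤ → E × ℝ} (hu1 : ∀ j, (u (j + 1)).1 = sectionMap x H.ph Y s t θ T N j (u j))
    (hu2 : ∀ j, (u j).2 = (u (j + 1)).2 + H.ph (s j) (u j).1 / N) :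
    ∃ y, IsForced f h y ∧ (∀ j, y (t j + N * (u j).2) = x (s j) + (u j).1) ∧
      ∀ j, (t (j + 1) + N * (u (j + 1)).2) - (t j + N * (u j).2) - T
        = θ j - H.ph (s j) (u j).1 := by
  have hstep : ∀ j, t (j + 1) + N * (u (j + 1)).2
      = t j + N * (u j).2 + (T + θ j - H.ph (s j) (u j).1) := by
    intro j
    have : (u (j + 1)).2 = (u j).2 - H.ph (s j) (u j).1 / N := by linarith [hu2 j]
    rw [this, ht, mul_sub, mul_div_cancel₀ _ hN]; ring
  set y : ℤ → ℝ → E := fun j => Y (t j + N * (u j).2) (x (s j) + (u j).1) with hy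
  -- The time coordinate of the discrete orbit makes each arrival time the next departure time, so
  -- consecutive pieces agree at one instant and are the same solution.
  have hconst : ∀ j, y j = y (j + 1) := by
    intro j
    refine H.forced_unique (hY _ _).2 (hY _ _).2 (t₀ := t (j + 1) + N * (u (j + 1)).2) ?_
    simp only [hy]
    rw [(hY _ _).1, hu1 j, sectionMap, hstep j, add_sub_cancel]
  have hall : ∀ j, y j = y 0 := by
    intro j
    induction j using Int.induction_on with
    | zero => rfl
    | succ i ih => rw [← hconst, ih]
    | pred i ih => rw [hconst (-i - 1), sub_add_cancel, ih]
  refine ⟨y 0, (hY _ _).2, fun j => ?_, fun j => ?_⟩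
  · rw [← hall j]; exact (hY _ _).1
  · rw [hstep]; ring

omit H in
/-- Lipschitz bounds for the section map. -/
theorem discreteError_sectionMap_bounds (D : HypData) {T κ₀ : ℝ} (hT : 1 ≤ T) (hκ : 0 < κ₀) :
    ∃ δs > 0, δs ≤ 1 ∧ ∃ Cs ≥ 1, ∀ (f : E → E) (x : ℝ → E) (H : HypOrbit D f x) (h : ℝ → E)
      (Y : ℝ → E → ℝ → E) (s t θ : ℤ → ℝ) (N δ δ₂ b : ℝ), (∀ t z, Y t z t = z ∧ IsForced f h (Y t z)) →
      (∀ j, s (j + 1) = s j + T) → (∀ j, |θ j| ≤ b) → δ ≤ δs → δ₂ ≤ δs → b + D.K * δ₂ ≤ δs →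
      0 ≤ N → (∀ t, ‖h t‖ ≤ δ) → (∀ a b, ‖h a - h b‖ ≤ δ * |a - b|) →
      ∀ j u u', ‖Prod.fst u‖ ≤ δ₂ → ‖Prod.fst u'‖ ≤ δ₂ →
        ‖H.discreteError s θ (sectionMap x H.ph Y s t θ T N) j u
          - H.discreteError s θ (sectionMap x H.ph Y s t θ T N) j u'‖
          ≤ (κ₀ * (1 + D.K) + Cs * δ * N) * ‖u - u'‖ ∧
        ‖H.discreteError s θ (sectionMap x H.ph Y s t θ T N) j u‖
          ≤ κ₀ * (δ₂ + (b + D.K * δ₂)) + Cs * δ := by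
  obtain ⟨δs, hδs, hδs1, Cs, hCs, hstep⟩ := HypOrbit.step (E := E) D hT hκ
  refine ⟨δs, hδs, hδs1, Cs, hCs, ?_⟩
  intro f x H h Y s t θ N δ δ₂ b hY hs hθ hδ hδ₂ hb hN hh hlip j u u' hu hu'
  have hδ0 : 0 ≤ δ := (norm_nonneg _).trans (hh 0)
  have hK := D.one_le_K
  have hθu : ∀ v : E × ℝ, ‖v.1‖ ≤ δ₂ → |θ j - H.ph (s j) v.1| ≤ b + D.K * δ₂ := fun v hv =>
    (abs_sub _ _).trans (add_le_add (hθ j) ((H.norm_ph_le _ _).trans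
      (mul_le_mul_of_nonneg_left hv (by linarith))))
  set y : E × ℝ → ℝ → E := fun v r => Y (t j + N * v.2) (x (s j) + v.1) (t j + N * v.2 + r) with hy
  have hyf : ∀ v, IsForced f (fun r => h (t j + N * v.2 + r)) (y v) := fun v =>
    (hY _ _).2.shift _
  have hy0 : ∀ v, y v 0 = x (s j) + v.1 := fun v => by simp only [hy, add_zero]; exact (hY _ _).1
  have herr : ∀ v : E × ℝ, H.discreteError s θ (sectionMap x H.ph Y s t θ T N) j v
      = y v (T + (θ j - H.ph (s j) v.1)) - x (s j + T) - H.U (s j) (s j + T) v.1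
        - (θ j - H.ph (s j) v.1) • f (x (s j + T)) := fun v => by
    simp only [discreteError, sectionMap, hy, hs, sub_smul, add_sub_assoc]
    abel
  constructor
  -- Departures shifted by `N * u.2` and `N * u'.2` see the same forcing at shifted times; its
  -- Lipschitz bound gives the error `δ * N * |u.2 - u'.2|`.
  · have h1 := hstep f x H (s j) _ _ (y u) (y u') (hyf u) (hyf u') (fun r => (hh _).trans hδ)
      (fun r => (hh _).trans hδ) (by rw [hy0, add_sub_cancel_left]; exact hu.trans hδ₂)
      (by rw [hy0, add_sub_cancel_left]; exact hu'.trans hδ₂) _ _ ((hθu u hu).trans hb)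
      ((hθu u' hu').trans hb) (δ * (N * |u.2 - u'.2|))
      (fun r _ => (hlip _ _).trans (le_of_eq (by
        rw [show t j + N * u.2 + r - (t j + N * u'.2 + r) = N * (u.2 - u'.2) by ring, abs_mul,
          abs_of_nonneg hN])))
    rw [hy0, hy0, add_sub_add_left_eq_sub] at h1
    have h2 : |θ j - H.ph (s j) u.1 - (θ j - H.ph (s j) u'.1)| ≤ D.K * ‖u.1 - u'.1‖ := by
      rw [show θ j - H.ph (s j) u.1 - (θ j - H.ph (s j) u'.1) = -H.ph (s j) (u.1 - u'.1) by
        rw [map_sub]; ring, abs_neg]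
      exact H.norm_ph_le _ _
    have h3 : ‖u.1 - u'.1‖ ≤ ‖u - u'‖ := norm_fst_le (u - u')
    have h4 : |u.2 - u'.2| ≤ ‖u - u'‖ := norm_snd_le (u - u')
    have e : H.discreteError s θ (sectionMap x H.ph Y s t θ T N) j u
        - H.discreteError s θ (sectionMap x H.ph Y s t θ T N) j u'
        = (y u (T + (θ j - H.ph (s j) u.1)) - y u' (T + (θ j - H.ph (s j) u'.1)))
          - H.U (s j) (s j + T) (u.1 - u'.1)
          - (θ j - H.ph (s j) u.1 - (θ j - H.ph (s j) u'.1)) • f (x (s j + T)) := by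
      rw [herr, herr, map_sub, sub_smul (θ j - H.ph (s j) u.1)]; abel
    rw [e]
    have h5 : κ₀ * (‖u.1 - u'.1‖ + |θ j - H.ph (s j) u.1 - (θ j - H.ph (s j) u'.1)|)
        ≤ κ₀ * (‖u - u'‖ + D.K * ‖u - u'‖) :=
      mul_le_mul_of_nonneg_left (add_le_add h3 (h2.trans
        (mul_le_mul_of_nonneg_left h3 (by linarith)))) hκ.le
    have h6 : Cs * (δ * (N * |u.2 - u'.2|)) ≤ Cs * (δ * (N * ‖u - u'‖)) := by gcongr
    refine h1.trans ((add_le_add h5 h6).trans (le_of_eq ?_))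
    ring
  · have h1 := hstep f x H (s j) _ _ (y u) (fun r => x (s j + r)) (hyf u) (H.isForced_orbit _)
      (fun r => (hh _).trans hδ) (fun r => by simpa using hδs.le)
      (by rw [hy0, add_sub_cancel_left]; exact hu.trans hδ₂)
      (by simpa using hδs.le) _ 0 ((hθu u hu).trans hb) (by simpa using hδs.le) δ
      (fun r _ => by simpa using hh _)
    simp only [hy0, add_zero, add_sub_cancel_left, sub_zero] at h1
    rw [herr]
    refine h1.trans (add_le_add_left (mul_le_mul_of_nonneg_left (add_le_add hu (hθu u hu)) hκ.le) _)

/-- The reference sequence is an approximate orbit of the section map, with an error that decays. -/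
theorem norm_sectionMap_sub_le {h h₁ y₁ : ℝ → E} {Y : ℝ → E → ℝ → E}
    (hY : ∀ t z, Y t z t = z ∧ IsForced f h (Y t z)) (hy₁ : IsForced f h₁ y₁) {s₀ T α δ a τ : ℝ}
    {t : ℤ → ℝ} (hα : 0 ≤ α) (hα2 : α * 2 ≤ 2 * α * T) (hδ : 0 ≤ δ) (ha : 0 ≤ a) (hδ1 : δ ≤ 1)
    (ha1 : a ≤ 1) (hT : 0 ≤ T)
    (hb : ∀ t, ‖h t‖ ≤ δ) (hh : ∀ t, τ ≤ t → ‖h t - h₁ t‖ ≤ Real.exp (-α * (t - τ)))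
    (ht0 : t 0 ≤ τ + 2) (htτ : ∀ j, 0 ≤ j → τ ≤ t j) (hspace : ∀ j, |t (j + 1) - t j - T| ≤ 1)
    (hmono : ∀ j, t j ≤ t (j + 1)) (hT1 : 1 ≤ T) (htneg : ∀ j < 0, t (j + 1) - t j = T)
    (hnear : ‖y₁ (t 0) - x s₀‖ ≤ a) {z : ℤ → E}
    (hz : ∀ j : ℤ, 0 ≤ j → z j = y₁ (t j) - x (s₀ + j * T))
    (hz' : ∀ j < 0, z j = 0) {N : ℝ} (hph : ∀ j : ℤ, H.ph (s₀ + j * T) (z j) = 0) (j : ℤ) :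
    ‖sectionMap x H.ph Y (fun j => s₀ + j * T) t (fun j => t (j + 1) - t j - T) T N j (z j, 0)
      - z (j + 1)‖ ≤ 2 * Real.exp (D.Lf * (T + 1)) * Real.exp (2 * α * T)
        * Real.exp (-α * (t (j + 1) - τ)) := by
  have hL := D.one_le_Lf
  set G := Real.exp (D.Lf * (T + 1)) with hG
  have hG1 : 1 ≤ G := Real.one_le_exp (by positivity)
  have e1 : sectionMap x H.ph Y (fun j => s₀ + j * T) t (fun j => t (j + 1) - t j - T) T N j (z j, 0)
      = Y (t j) (x (s₀ + j * T) + z j) (t (j + 1)) - x (s₀ + ((j + 1 : ℤ) : ℝ) * T) := by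
    simp only [sectionMap, hph, mul_zero, add_zero, sub_zero]
    congr 2; ring
  rw [e1]
  have hsp := abs_le.1 (hspace j)
  -- For `j < 0` the reference sequence lies on the orbit and its defect is merely bounded, but the
  -- weight is bounded below there because `t (j + 1) ≤ τ + 2`. For `j ≥ 0` the defect is the effect
  -- of `h - h₁` over one flight.
  rcases lt_or_ge j 0 with hj | hj
  · have h1 := H.norm_sub_orbit_le ((hY (t j) (x (s₀ + j * T) + z j)).2.shift (t j))
      (s := s₀ + j * T) (b := T + 1) (μ := δ) hδ (fun r _ => hb _) T ⟨hT, by linarith⟩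
    have e2 : t j + T = t (j + 1) := by linarith [htneg j hj]
    simp only [add_zero, (hY _ _).1, e2, hz' j hj, sub_self, norm_zero, zero_add] at h1
    have e3 : s₀ + ((j + 1 : ℤ) : ℝ) * T = s₀ + j * T + T := by push_cast; ring
    have hz1 : ‖z (j + 1)‖ ≤ a := by
      rcases lt_or_ge (j + 1) 0 with h2 | h2
      · rw [hz' _ h2, norm_zero]; exact ha
      · have : j + 1 = 0 := by omega
        rw [this, hz 0 le_rfl]; simpa using hnear
    have hle : t (j + 1) ≤ t 0 := by
      have : ∀ n : ℕ, t (-n) ≤ t 0 := by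
        intro n
        induction n with
        | zero => simp
        | succ n ih =>
          refine le_trans ?_ ih
          have := hmono (-(n + 1 : ℕ))
          rwa [show -((n + 1 : ℕ) : ℤ) + 1 = -n by push_cast; ring] at this
      have h3 := this (-(j + 1)).toNat
      rwa [show -((-(j + 1)).toNat : ℤ) = j + 1 by omega] at h3
    have h4 : 1 ≤ Real.exp (2 * α * T) * Real.exp (-α * (t (j + 1) - τ)) := by
      rw [← Real.exp_add]
      refine Real.one_le_exp ?_
      nlinarith
    rw [e3, hz' j hj, add_zero]
    refine (norm_sub_le _ _).trans ((add_le_add h1 hz1).trans ?_)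
    calc G * δ + a ≤ G * 1 + 1 := add_le_add (mul_le_mul_of_nonneg_left hδ1 (by linarith)) ha1
      _ ≤ 2 * G := by linarith
      _ ≤ 2 * G * (Real.exp (2 * α * T) * Real.exp (-α * (t (j + 1) - τ))) :=
          le_mul_of_one_le_right (by positivity) h4
      _ = _ := by ring
  · have h1 := H.norm_sub_le_of_forced ((hY (t j) (x (s₀ + j * T) + z j)).2.shift (t j))
      (hy₁.shift (t j)) (b := T + 1) (μ := Real.exp (-α * (t j - τ))) (Real.exp_pos _).le
      (fun r hr => (hh _ (by linarith [hr.1, htτ j hj])).trans (Real.exp_le_exp.2 (by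
        nlinarith [hr.1]))) (t (j + 1) - t j) ⟨by linarith, by linarith⟩
    simp only [add_zero, (hY _ _).1, add_sub_cancel] at h1
    rw [hz (j + 1) (by omega), sub_sub_sub_cancel_right]
    rw [hz j hj, add_sub_cancel] at h1 ⊢
    rw [sub_self, norm_zero, zero_add] at h1
    refine h1.trans ?_
    have h2 : Real.exp (-α * (t j - τ)) ≤ Real.exp (2 * α * T) * Real.exp (-α * (t (j + 1) - τ)) := by
      rw [← Real.exp_add]
      refine Real.exp_le_exp.2 ?_
      nlinarith
    have h3 := mul_le_mul_of_nonneg_left h2 (by linarith : 0 ≤ G)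
    have h4 : 0 ≤ G * (Real.exp (2 * α * T) * Real.exp (-α * (t (j + 1) - τ))) := by positivity
    calc _ ≤ _ := h3
      _ ≤ 2 * (G * (Real.exp (2 * α * T) * Real.exp (-α * (t (j + 1) - τ)))) := by linarith
      _ = _ := by ring

end HypOrbit

end HalfLine

/-! ### Shadowing solutions with exponential asymptotics. -/

section Shadowing

variable {E : Type*} [NormedAddCommGroup E] [NormedSpace ℝ E]

theorem PhaseControl.abs_phase_sub_le {x y : ℝ → E} {ph : ℝ → E →L[ℝ] ℝ} {φ φ' : ℝ → ℝ}
    {C N δ τ : ℝ} (P : PhaseControl x y ph φ C N δ τ) {t r u s a b c : ℝ} (ht : τ ≤ t) (hr : τ ≤ r)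
    (hs : |φ t - s| ≤ a) (hu : |u - t| ≤ b) (hφ' : |φ' r - s - (r - u)| ≤ c) (hN : |r - t| ≤ N) :
    |φ' r - φ r| ≤ a + b + c + C * δ := by
  have h1 := abs_le.1 (P.abs_increment_le ht hr hN)
  have h2 := abs_le.1 hs
  have h3 := abs_le.1 hu
  have h4 := abs_le.1 hφ'
  rw [abs_le]
  constructor <;> linarith

/-- Comparison of two solutions in terms of their deviations at grid times. -/
theorem HypOrbit.norm_sub_le_of_grid {D : HypData} {f : E → E} {x : ℝ → E} (H : HypOrbit D f x)
    {h h₁ y y₁ : ℝ → E} (hy : IsForced f h y) (hy₁ : IsForced f h₁ y₁) {T α τ V M : ℝ} (hα : 0 ≤ α)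
    (hT : 4 ≤ T) (hV : 0 ≤ V) (hM : 0 ≤ M) {t : ℤ → ℝ} (ht0 : t 0 ≤ τ + 2)
    (hspace : ∀ j, |t (j + 1) - t j - T| ≤ 1) (htτ : ∀ j, 0 ≤ j → τ ≤ t j)
    (hh : ∀ t, τ ≤ t → ‖h t - h₁ t‖ ≤ Real.exp (-α * (t - τ)))
    (hv : ∀ a b, τ ≤ a → τ ≤ b → ‖y b - y a‖ ≤ V * |b - a|)
    (hv₁ : ∀ a b, τ ≤ a → τ ≤ b → ‖y₁ b - y₁ a‖ ≤ V * |b - a|)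
    (hd : ∀ j, 0 ≤ j → ‖y (t j) - y₁ (t j)‖ ≤ M * Real.exp (-α * (t j - τ))) (r : ℝ) (hr : τ ≤ r) :
    ‖y r - y₁ r‖ ≤ (Real.exp (D.Lf * (T + 1)) * (M + 1) + 4 * V) * Real.exp (2 * α * T)
      * Real.exp (-α * (r - τ)) := by
  have hL := D.one_le_Lf
  set G := Real.exp (D.Lf * (T + 1)) with hG
  have hG1 : 1 ≤ G := Real.one_le_exp (by positivity)
  -- The initial piece before the first section has length at most 2 and is covered by the speed
  -- bound.
  rcases lt_or_ge r (t 0) with h0 | h0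
  · have h1 : |r - t 0| ≤ 2 := by
      rw [abs_le]; constructor <;> linarith
    have h2 := hd 0 le_rfl
    have hτ0 := htτ 0 le_rfl
    have h3 := (hv (t 0) r hτ0 hr).trans (mul_le_mul_of_nonneg_left h1 hV)
    have h4 := (hv₁ (t 0) r hτ0 hr).trans (mul_le_mul_of_nonneg_left h1 hV)
    have e : y r - y₁ r = (y r - y (t 0)) + (y (t 0) - y₁ (t 0)) - (y₁ r - y₁ (t 0)) := by abel
    have h5 : Real.exp (-α * (t 0 - τ)) ≤ 1 := Real.exp_le_one_iff.2 (by linarith only [mul_nonneg hα (sub_nonneg.2 hτ0)])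
    have h6 : M * Real.exp (-α * (t 0 - τ)) ≤ M * 1 := mul_le_mul_of_nonneg_left h5 hM
    have h7 : 1 ≤ Real.exp (2 * α * T) * Real.exp (-α * (r - τ)) := by
      rw [← Real.exp_add]
      refine Real.one_le_exp ?_
      linarith only [mul_le_mul_of_nonneg_left (show r - τ ≤ 2 * T by linarith) hα]
    rw [e]
    refine (norm_sub_le _ _).trans ((add_le_add_left (norm_add_le _ _) _).trans ?_)
    calc _ ≤ M + 4 * V := by linarith
      _ ≤ G * (M + 1) + 4 * V := by linarith only [le_mul_of_one_le_left (by linarith : 0 ≤ M + 1) hG1]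
      _ ≤ (G * (M + 1) + 4 * V) * (Real.exp (2 * α * T) * Real.exp (-α * (r - τ))) :=
          le_mul_of_one_le_right (by positivity) h7
      _ = _ := by ring
  · obtain ⟨j, hj1, hj2⟩ := exists_grid_cell hspace (by linarith) r
    have hj : 0 ≤ j := by
      by_contra hcon
      push Not at hcon
      obtain ⟨n, hn⟩ := Int.le.dest (show j + 1 ≤ 0 by omega)
      have h1 := (grid_sub_bounds hspace (j + 1) n).1
      rw [hn] at h1
      have : 0 ≤ (T - 1) * (n : ℝ) := mul_nonneg (by linarith) (Nat.cast_nonneg n)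
      linarith
    have hsp := abs_le.1 (hspace j)
    have h1 := H.norm_sub_le_of_forced (hy.shift (t j)) (hy₁.shift (t j)) (b := T + 1)
      (μ := Real.exp (-α * (t j - τ))) (Real.exp_pos _).le
      (fun q hq => (hh _ (by linarith [hq.1, htτ j hj])).trans (Real.exp_le_exp.2 (by
        linarith only [mul_nonneg hα hq.1]))) (r - t j) ⟨by linarith, by linarith⟩
    simp only [add_zero, add_sub_cancel] at h1
    have h2 : Real.exp (-α * (t j - τ)) ≤ Real.exp (2 * α * T) * Real.exp (-α * (r - τ)) := by
      rw [← Real.exp_add]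
      refine Real.exp_le_exp.2 ?_
      linarith only [mul_le_mul_of_nonneg_left (show r ≤ t j + 2 * T by linarith) hα]
    calc _ ≤ G * (‖y (t j) - y₁ (t j)‖ + Real.exp (-α * (t j - τ))) := h1
      _ ≤ G * (M * Real.exp (-α * (t j - τ)) + Real.exp (-α * (t j - τ))) :=
          mul_le_mul_of_nonneg_left (add_le_add_left (hd j hj) _) (by linarith)
      _ = (G * (M + 1)) * Real.exp (-α * (t j - τ)) := by ring
      _ ≤ (G * (M + 1) + 4 * V) * (Real.exp (2 * α * T) * Real.exp (-α * (r - τ))) :=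
          mul_le_mul (by linarith) h2 (Real.exp_pos _).le (by positivity)
      _ = _ := by ring

variable (E) in
set_option maxHeartbeats 1000000 in
/-- The two-sided orbit of a forced system that is asymptotic to a given solution. -/
theorem exists_discrete_shadowing [CompleteSpace E] (D : HypData) {T : ℝ} (hT4 : 4 ≤ T)
    (hTq : D.K * Real.exp (-D.κ * T) * Real.exp (2 * (D.κ / 4) * T) ≤ 1 / 16)
    (hTw : Real.exp (-(D.κ / 4) * (T / 2)) ≤ 1 / 4) {Cp : ℝ} (hCp : 1 ≤ Cp) :
    ∃ δ₁ > 0, δ₁ ≤ 1 ∧ ∃ C ≥ 1, ∀ (f : E → E) (x : ℝ → E) (H : HypOrbit D f x)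
      (h h₁ y₁ : ℝ → E) (s₀ δ τ : ℝ) (t : ℤ → ℝ), δ ≤ δ₁ → Cp * δ ≤ 1 / 16 → IsForced f h₁ y₁ →
      (∀ t, ‖h t‖ ≤ δ) → (∀ a b, ‖h a - h b‖ ≤ δ * |a - b|) →
      (∀ t, τ ≤ t → ‖h t - h₁ t‖ ≤ Real.exp (-(D.κ / 4) * (t - τ))) →
      τ ≤ t 0 → t 0 ≤ τ + 2 →
      (∀ j : ℤ, 0 ≤ j → τ ≤ t j ∧ H.ph (s₀ + j * T) (y₁ (t j) - x (s₀ + j * T)) = 0 ∧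
        ‖y₁ (t j) - x (s₀ + j * T)‖ ≤ Cp * δ) →
      (∀ j, |t (j + 1) - t j - T| ≤ 3 * (Cp * δ)) → (∀ j < 0, t (j + 1) - t j = T) →
      ∃ (y : ℝ → E) (t' : ℤ → ℝ), IsForced f h y ∧ (∀ j : ℤ, ‖y (t' j) - x (s₀ + j * T)‖ ≤ C * δ) ∧
        (∀ j, |t' (j + 1) - t' j - T| ≤ C * δ) ∧
        (∀ j, |t' j - t j| ≤ C * Real.exp (-(D.κ / 4) * (t j - τ))) ∧
        ∀ j, 0 ≤ j → ‖y (t' j) - y₁ (t j)‖ ≤ C * Real.exp (-(D.κ / 4) * (t j - τ)) := by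
  have hB := D.one_le_B
  have hK := D.one_le_K
  have hL := D.one_le_Lf
  have hα : 0 < D.κ / 4 := by have := D.κ_pos; positivity
  set α := D.κ / 4 with hαdef
  set A := 2 + D.K with hA
  set Λ := Real.exp (2 * α * T) with hΛ
  have hΛ1 : 1 ≤ Λ := Real.one_le_exp (by positivity)
  -- The Lipschitz constant of the section map error may use 1/32 after multiplication by `Λ * (1 +
  -- D.K)`: half goes to `κ₀`, half to the time shift of the forcing, through the last bound in
  -- `δ₁`.
  set κ₀ := 1 / (64 * Λ * A ^ 2) with hκ₀
  have hκ₀pos : 0 < κ₀ := by positivity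
  have hκ₀e : 64 * Λ * A ^ 2 * κ₀ = 1 := mul_one_div_cancel (by positivity)
  obtain ⟨δs, hδs, hδs1, Cs, hCs, hbounds⟩ := HypOrbit.discreteError_sectionMap_bounds (E := E) D
    (T := T) (by linarith) hκ₀pos
  set N := 4 * D.K with hN
  -- `C₂ * δ` is the radius of a ball that the fixed point map preserves: the terms proportional to
  -- the radius take less than half of it, and the factor 2 provides for the others.
  set C₂ := 2 * ((D.B + 1) * (3 * Cp) + A * Cs) with hC₂
  have hC₂Cp : Cp ≤ C₂ := by
    have : 0 ≤ D.B * Cp := by positivity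
    have h2 : 0 ≤ A * Cs := by positivity
    rw [hC₂]; linarith
  set C₃ := 3 * Cp + D.K * C₂ with hC₃
  have hC₃C₂ : C₂ ≤ C₃ := by
    have : 0 ≤ (D.K - 1) * C₂ := mul_nonneg (by linarith) (by linarith)
    rw [hC₃]; linarith
  have hC₃pos : 0 < C₃ := by linarith
  set G := Real.exp (D.Lf * (T + 1)) with hG
  set M₀ := 2 * (A * (2 * G * Λ)) with hM₀
  have hM₀pos : 0 < M₀ := by positivity
  set δ₁ := min (min 1 (δs / C₃)) (1 / (64 * Λ * A * Cs * N)) with hδ₁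
  have hδ₁s : C₃ * δ₁ ≤ δs := by
    have : δ₁ ≤ δs / C₃ := (min_le_left _ _).trans (min_le_right _ _)
    rw [le_div_iff₀ hC₃pos] at this
    linarith
  have hδ₁N : Λ * A * (Cs * δ₁ * N) ≤ 1 / 64 := by
    have : δ₁ ≤ 1 / (64 * Λ * A * Cs * N) := min_le_right _ _
    rw [le_div_iff₀ (by positivity)] at this
    linarith
  refine ⟨δ₁, lt_min (lt_min one_pos (by positivity)) (by positivity),
    (min_le_left _ _).trans (min_le_left _ _), C₃ + (N + 1) * M₀, ?_, ?_⟩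
  · have : 0 ≤ (N + 1) * M₀ := by positivity
    linarith
  intro f x H h h₁ y₁ s₀ δ τ t hδ hCδ hy₁ hb hlip hh ht0 ht0' hsec hspace htneg
  have hδ0 : 0 ≤ δ := (norm_nonneg _).trans (hb 0)
  have hδ1 : δ ≤ 1 := hδ.trans ((min_le_left _ _).trans (min_le_left _ _))
  have hCpδ0 : 0 ≤ Cp * δ := by positivity
  have hspace1 : ∀ j, |t (j + 1) - t j - T| ≤ 1 := fun j => (hspace j).trans (by linarith)
  have hδC₃ : C₃ * δ ≤ δs := (mul_le_mul_of_nonneg_left hδ hC₃pos.le).trans hδ₁s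
  have hδC₂ : C₂ * δ ≤ δs := (mul_le_mul_of_nonneg_right hC₃C₂ hδ0).trans hδC₃
  have hδs' : δ ≤ δs := by
    have : 1 * δ ≤ C₂ * δ := mul_le_mul_of_nonneg_right (hCp.trans hC₂Cp) hδ0
    linarith
  set s : ℤ → ℝ := fun j => s₀ + j * T with hs
  have hs1 : ∀ j, s (j + 1) = s j + T := fun j => by simp only [hs]; push_cast; ring
  set θ : ℤ → ℝ := fun j => t (j + 1) - t j - T with hθ
  set w : ℤ → ℝ := fun j => Real.exp (-α * (t j - τ)) with hw
  have hw0 : ∀ j, 0 < w j := fun j => Real.exp_pos _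
  have hw4 : ∀ j, w (j + 1) ≤ 1 / 4 * w j := by
    intro j
    have h1 := abs_le.1 (hspace1 j)
    have h2 : w (j + 1) = Real.exp (-α * (t (j + 1) - t j)) * w j := by
      simp only [hw]; rw [← Real.exp_add]; congr 1; ring
    rw [h2]
    refine mul_le_mul_of_nonneg_right (le_trans (Real.exp_le_exp.2 ?_) hTw) (hw0 j).le
    linarith only [mul_le_mul_of_nonneg_left (show T / 2 ≤ t (j + 1) - t j by linarith) hα.le]
  have hwΛ : ∀ j, w j ≤ Λ * w (j + 1) := by
    intro j
    have h1 := abs_le.1 (hspace1 j)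
    simp only [hw, hΛ]
    rw [← Real.exp_add]
    refine Real.exp_le_exp.2 ?_
    linarith only [mul_le_mul_of_nonneg_left (show t (j + 1) ≤ t j + 2 * T by linarith) hα.le]
  choose Y hY1 hY2 using fun a z => H.exists_forced_solution hb hlip a z
  have hY : ∀ a z, Y a z a = z ∧ IsForced f h (Y a z) := fun a z => ⟨hY1 a z, hY2 a z⟩
  -- The approximate orbit follows `y₁` for `j ≥ 0` and the unperturbed orbit for `j < 0`.
  set z : ℤ → E := fun j => if 0 ≤ j then y₁ (t j) - x (s j) else 0 with hz
  have hzpos : ∀ j : ℤ, 0 ≤ j → z j = y₁ (t j) - x (s₀ + j * T) := fun j hj => by simp [hz, hj, hs]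
  have hzneg : ∀ j < 0, z j = 0 := fun j hj => by simp [hz, not_le.2 hj]
  have hzph : ∀ j : ℤ, H.ph (s₀ + j * T) (z j) = 0 := fun j => by
    rcases lt_or_ge j 0 with hj | hj
    · rw [hzneg j hj, map_zero]
    · rw [hzpos j hj]; exact (hsec j hj).2.1
  have hznorm : ∀ j, ‖z j‖ ≤ C₂ * δ := fun j => by
    rcases lt_or_ge j 0 with hj | hj
    · rw [hzneg j hj, norm_zero]; exact mul_nonneg (by linarith) hδ0
    · rw [hzpos j hj]
      exact (hsec j hj).2.2.trans (mul_le_mul_of_nonneg_right hC₂Cp hδ0)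
  have hbd := hbounds f x H h Y s t θ N δ (C₂ * δ) (3 * (Cp * δ)) hY hs1 hspace hδs' hδC₂
    (by rw [← mul_assoc, ← mul_assoc, ← add_mul]; exact hδC₃) (by positivity) hb hlip
  have hres := fun j => H.norm_sectionMap_sub_le hY hy₁ (α := α) (δ := δ) (a := Cp * δ) (τ := τ) (t := t)
    (s₀ := s₀) (T := T) (N := N) hα.le (by linarith only [mul_nonneg hα.le (sub_nonneg.2 hT4), hα]) hδ0 hCpδ0 hδ1 (by linarith) (by linarith) hb hh
    ht0' (fun j hj => (hsec j hj).1) hspace1 (fun j => by linarith [(abs_le.1 (hspace1 j)).1])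
    (by linarith) htneg (by simpa using (hsec 0 le_rfl).2.2) hzpos hzneg hzph j
  obtain ⟨u, hu1, hu2, hu3, hu4⟩ := H.exists_discrete_orbit (T := T) (Λ := Λ) (N := N)
    (ε := κ₀ * (1 + D.K) + Cs * δ * N)
    (e₁ := κ₀ * (C₂ * δ + (3 * (Cp * δ) + D.K * (C₂ * δ))) + Cs * δ) (b := 3 * (Cp * δ))
    (δ₂ := C₂ * δ) (M := 2 * G * Λ) (by linarith) hΛ1 hTq le_rfl (by positivity)
    (by
      have h1 : Λ * (1 + D.K) * (κ₀ * (1 + D.K)) ≤ 1 / 64 := by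
        calc Λ * (1 + D.K) * (κ₀ * (1 + D.K)) ≤ Λ * A * (κ₀ * A) := by
              have : 1 + D.K ≤ A := by linarith
              gcongr
          _ = 1 / 64 * (64 * Λ * A ^ 2 * κ₀) := by ring
          _ = 1 / 64 := by rw [hκ₀e, mul_one]
      have h2 : Λ * (1 + D.K) * (Cs * δ * N) ≤ 1 / 64 := by
        refine le_trans ?_ hδ₁N
        have : 1 + D.K ≤ A := by linarith
        gcongr
      rw [mul_add]; linarith)
    (by positivity) s hs1 θ (sectionMap x H.ph Y s t θ T N) w hw0 hw4 hwΛ hspace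
    (fun j u u' hu hu' => (hbd j u u' hu hu').1)
    (fun j u hu => (hbd j u u hu hu).2)
    (by
      have hC₂0 : 0 ≤ C₂ := by linarith
      have h1 : A * κ₀ * (1 + D.K) ≤ 1 / 64 := by
        calc A * κ₀ * (1 + D.K) ≤ A * κ₀ * A := by
              have : 1 + D.K ≤ A := by linarith
              gcongr
          _ = 1 * (A ^ 2 * κ₀) := by ring
          _ ≤ Λ * (A ^ 2 * κ₀) := mul_le_mul_of_nonneg_right hΛ1 (by positivity)
          _ = 1 / 64 * (64 * Λ * A ^ 2 * κ₀) := by ring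
          _ = 1 / 64 := by rw [hκ₀e, mul_one]
      have h2 : A * κ₀ ≤ 1 := by
        refine le_trans ?_ (h1.trans (by norm_num))
        exact le_mul_of_one_le_right (by positivity) (by linarith)
      have h3 : A * κ₀ * (1 + D.K) * (C₂ * δ) ≤ 1 / 64 * (C₂ * δ) :=
        mul_le_mul_of_nonneg_right h1 (by positivity)
      have h4 : A * κ₀ * (3 * (Cp * δ)) ≤ 1 * (3 * (Cp * δ)) :=
        mul_le_mul_of_nonneg_right h2 (by positivity)
      have h5 : C₂ * δ = 2 * (D.B * (3 * (Cp * δ)) + 3 * (Cp * δ) + A * (Cs * δ)) := by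
        rw [hC₂]; ring
      calc _ = 1 / 8 * (C₂ * δ) + D.B * (3 * (Cp * δ)) + A * κ₀ * (1 + D.K) * (C₂ * δ)
            + A * κ₀ * (3 * (Cp * δ)) + A * (Cs * δ) := by ring
        _ ≤ C₂ * δ := by
            have : 0 ≤ C₂ * δ := by positivity
            linarith)
    (fun j => (z j, 0)) hznorm hres
    (fun j => by
      have := hzph j
      simp only [hs, this]
      simp)
  obtain ⟨y, hy, hyt, hflight⟩ := H.exists_forced_of_discrete_orbit hY (N := N)
    (by positivity) (t := t) (θ := θ) (fun j => by simp only [hθ]; ring) hu2 hu3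
  have hud : ∀ j, ‖(u j).1 - z j‖ ≤ M₀ * w j ∧ |(u j).2| ≤ M₀ * w j := fun j => by
    have h1 := hu4 j
    refine ⟨(norm_fst_le (u j - (z j, 0))).trans h1, ?_⟩
    have h2 := (norm_snd_le (u j - (z j, (0 : ℝ)))).trans h1
    simpa using h2
  have hCtot : ∀ j, (N + 1) * M₀ * w j ≤ (C₃ + (N + 1) * M₀) * w j := fun j =>
    mul_le_mul_of_nonneg_right (by linarith) (hw0 j).le
  have hCδ' : C₃ * δ ≤ (C₃ + (N + 1) * M₀) * δ :=
    mul_le_mul_of_nonneg_right (by linarith [show 0 ≤ (N + 1) * M₀ by positivity]) hδ0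
  refine ⟨y, fun j => t j + N * (u j).2, hy, fun j => ?_, fun j => ?_, fun j => ?_, fun j hj => ?_⟩
  · rw [hyt j, add_sub_cancel_left]
    exact (hu1 j).trans ((mul_le_mul_of_nonneg_right hC₃C₂ hδ0).trans hCδ')
  · rw [hflight j]
    refine (abs_sub _ _).trans (le_trans ?_ hCδ')
    have := (H.norm_ph_le (s j) (u j).1).trans
      (mul_le_mul_of_nonneg_left (hu1 j) (by linarith : 0 ≤ D.K))
    refine (add_le_add (hspace j) this).trans (le_of_eq ?_)
    rw [hC₃]; ring
  · rw [add_sub_cancel_left, abs_mul, abs_of_nonneg (by positivity : 0 ≤ N)]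
    refine le_trans ?_ (hCtot j)
    have := mul_le_mul_of_nonneg_left (hud j).2 (by positivity : 0 ≤ N)
    have h2 : 0 ≤ M₀ * w j := mul_nonneg hM₀pos.le (hw0 j).le
    linarith
  · have e : y (t j + N * (u j).2) - y₁ (t j) = (u j).1 - z j := by
      rw [hyt j, hzpos j hj]; abel
    rw [e]
    refine ((hud j).1).trans (le_trans ?_ (hCtot j))
    have h2 : 0 ≤ N * (M₀ * w j) := mul_nonneg (by positivity) (mul_nonneg hM₀pos.le (hw0 j).le)
    linarith

end Shadowing

section Existence

variable {E : Type*} [NormedAddCommGroup E] [NormedSpace ℝ E]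

variable (E) in
set_option maxHeartbeats 1000000 in
/-- Given a solution of one forced system that shadows `x` from the time `τ` on, a second forcing
term that approaches the first one exponentially has a solution that shadows `x` for all times and
approaches the given solution exponentially. -/
theorem exists_shadowing [CompleteSpace E] (D : HypData) : ∃ δ₁ > 0, δ₁ ≤ 1 ∧ ∃ C ≥ 1, ∀ δ > 0,
    δ ≤ δ₁ → ∃ S : ℝ, ∀ (f : E → E) (x : ℝ → E), HypOrbit D f x →
      ∀ (h h₁ y₁ : ℝ → E) (φ₁ : ℝ → ℝ) (η τ : ℝ), Shadows f x h₁ y₁ φ₁ δ τ → η ≤ δ →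
      (∀ t, ‖h t‖ ≤ η) → (∀ a b, ‖h a - h b‖ ≤ δ * |a - b|) →
      (∀ t, τ ≤ t → ‖h t - h₁ t‖ ≤ Real.exp (-(D.κ / 4) * (t - τ))) →
      ∃ (y : ℝ → E) (φ : ℝ → ℝ), LipschitzWith 2 φ ∧ IsForced f h y ∧
        (∀ t, ‖y t - x (φ t)‖ ≤ C * η) ∧
        (∀ t, τ ≤ t → ‖y t - y₁ t‖ ≤ C * Real.exp (-(D.κ / 4) * (t - τ))) ∧
        ∀ t, τ + S ≤ t → |φ t - φ₁ t| ≤ C * δ := by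
  obtain ⟨T, hT4, hTq, hTw⟩ := D.exists_period
  have hB := D.one_le_B
  have hL := D.one_le_Lf
  have hα : 0 < D.κ / 4 := by have := D.κ_pos; positivity
  obtain ⟨δp, hδp, hδp1, Cp, hCp, hCpδ, hphase⟩ := HypOrbit.phaseControl (E := E) D (2 * T + 4)
    (by linarith)
  obtain ⟨δd, hδd, hδd1, Cd, hCd, hdisc⟩ := exists_discrete_shadowing E D hT4 hTq hTw hCp
  obtain ⟨Ct, hCt, htimes⟩ := exists_phases_of_times (E := E) D hT4
  obtain ⟨δa, hδa, hδa1, Ca, hCa, hap⟩ := exists_phases_of_shadows (E := E) D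
  set α := D.κ / 4 with hαdef
  set V := D.B + 2 * D.Lf with hV
  set M := (V + 1) * Cd with hM
  set C₁ := (Real.exp (D.Lf * (T + 1)) * (M + 1) + 4 * V) * Real.exp (2 * α * T) with hC₁
  set Cn := Ct * (2 * Cd + 1) with hCn
  have hCn1 : 1 ≤ Cn := by
    have := mul_le_mul hCt (show 1 ≤ 2 * Cd + 1 by linarith) zero_le_one (by linarith)
    rw [hCn]; linarith
  set C₂ := Ca * Cn + 5 * Cd + 2 * Cp + 1 with hC₂
  have hV0 : 0 ≤ V := by positivity
  have hM0 : 0 ≤ M := by positivity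
  have hC₁0 : 0 ≤ C₁ := by positivity
  have hC₂0 : 0 ≤ C₂ := by positivity
  refine ⟨min (min δp δd) (min (δa / Cn) (1 / Cd)), by positivity,
    (min_le_left _ _).trans ((min_le_left _ _).trans hδp1), C₁ + C₂ + Ca, by linarith, ?_⟩
  intro δ hδ hδle
  have hδp' : δ ≤ δp := hδle.trans ((min_le_left _ _).trans (min_le_left _ _))
  have hδd' : δ ≤ δd := hδle.trans ((min_le_left _ _).trans (min_le_right _ _))
  have hδa' : Cn * δ ≤ δa := by
    have : δ ≤ δa / Cn := hδle.trans ((min_le_right _ _).trans (min_le_left _ _))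
    rw [le_div_iff₀ (by linarith)] at this
    linarith
  have hδC : Cd * δ ≤ 1 := by
    have : δ ≤ 1 / Cd := hδle.trans ((min_le_right _ _).trans (min_le_right _ _))
    rw [le_div_iff₀ (by linarith)] at this
    linarith
  have hδ1 : δ ≤ 1 := hδp'.trans hδp1
  have hCpδ' : Cp * δ ≤ 1 / 16 := (mul_le_mul_of_nonneg_left hδp' (by linarith)).trans hCpδ
  set S' := Real.log (Cd / δ) / α with hS'
  have hS'0 : 0 ≤ S' := div_nonneg (Real.log_nonneg (by rw [le_div_iff₀ hδ]; linarith)) hα.le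
  -- After the time `S'` the crossing times of the two solutions differ by at most `δ`, so that
  -- their phases can be compared to order `δ`.
  have hS'e : Cd * Real.exp (-α * S') = δ := by
    have : -α * S' = -Real.log (Cd / δ) := by rw [hS']; field_simp
    rw [this, Real.exp_neg, Real.exp_log (by positivity)]
    field_simp
  -- Besides `S'`, this covers one cell of the grid, the displacement of crossing times by at most
  -- `Cd`, and the delay of at most 2 before the first section.
  refine ⟨T + 3 + Cd + S', ?_⟩
  intro f x H h h₁ y₁ φ₁ η τ Sh hη hb hlip hh
  have hη0 : 0 ≤ η := (norm_nonneg _).trans (hb 0)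
  have P := hphase f x H h₁ y₁ φ₁ δ τ Sh hδp'
  obtain ⟨s₀, t, ht0, ht0', hsec, hspace, htneg⟩ := exists_halfLine_sectionTimes hT4 hCpδ' P
  obtain ⟨y, t', hy, hyx, hspace', htt', hyy⟩ := hdisc f x H h h₁ y₁ s₀ δ τ t hδd' hCpδ' Sh.forced
    (fun r => (hb r).trans hη) hlip hh ht0 ht0' (fun j hj => ⟨(hsec j hj).1, (hsec j hj).2.1,
      (hsec j hj).2.2.1⟩) hspace htneg
  obtain ⟨φ, hφlip, hφ⟩ := htimes f x H h y δ hy (fun r => (hb r).trans hη) t' s₀ (Cd * δ) (Cd * δ)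
    hδC hspace' hyx
  have hnear : ∀ r, ‖y r - x (φ r)‖ ≤ Cn * δ := fun r => by
    obtain ⟨j, -, -, -, h4⟩ := hφ r
    refine h4.trans (le_of_eq ?_)
    rw [hCn]; ring
  have hδn : δ ≤ Cn * δ := le_mul_of_one_le_left hδ.le hCn1
  have Shy : ∀ τ, Shadows f x h y φ (Cn * δ) τ := fun τ =>
    ⟨hy, fun r => ((hb r).trans hη).trans hδn, hφlip.continuous, fun r _ => hnear r⟩
  -- So far `y` is close to the orbit only to order `δ`; new phases improve this to the order `η` of
  -- the forcing `h`.
  obtain ⟨φ', hφ'lip, hφ'⟩ := hap f x H h y φ (Cn * δ) η Shy hδa' (hη.trans hδn) hb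
  refine ⟨y, φ', hφ'lip, hy, fun r => (hφ' r).1.trans ?_, fun r hr => ?_, fun r hr => ?_⟩
  · exact mul_le_mul_of_nonneg_right (by linarith) hη0
  · refine (H.norm_sub_le_of_grid hy Sh.forced hα.le hT4 hV0 hM0 ht0'
      (fun j => (hspace j).trans (by linarith)) (fun j hj => (hsec j hj).1) hh
      (fun a b ha hb => (Shy τ).norm_sub_le H (hδa'.trans hδa1) ha hb)
      (fun a b ha hb => Sh.norm_sub_le H hδ1 ha hb) (fun j hj => ?_) r hr).trans ?_
    · have h1 := (Shy (min (t j) (t' j))).norm_sub_le H (hδa'.trans hδa1) (min_le_right _ _)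
        (min_le_left _ _)
      have h2 := (htt' j)
      rw [abs_sub_comm] at h2
      have h3 := mul_le_mul_of_nonneg_left h2 hV0
      have h4 := norm_add_le (y (t j) - y (t' j)) (y (t' j) - y₁ (t j))
      rw [sub_add_sub_cancel] at h4
      refine h4.trans ((add_le_add (h1.trans h3) (hyy j hj)).trans (le_of_eq ?_))
      rw [hM]; ring
    · exact mul_le_mul_of_nonneg_right (by linarith) (Real.exp_pos _).le
  · obtain ⟨j, hj1, hj2, hj3, -⟩ := hφ r
    have hspj := abs_le.1 (hspace' j)
    have hj : 0 ≤ j := by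
      by_contra hcon
      push Not at hcon
      obtain ⟨n, hn⟩ := Int.le.dest (show j + 1 ≤ 0 by omega)
      have h1 := (grid_sub_bounds hspace' (j + 1) n).1
      rw [hn] at h1
      have h2 : 0 ≤ (T - Cd * δ) * (n : ℝ) := mul_nonneg (by linarith) (Nat.cast_nonneg n)
      have h3 := abs_le.1 ((htt' 0).trans (mul_le_mul_of_nonneg_left
        (Real.exp_le_one_iff.2 (by linarith only [mul_nonneg hα.le (sub_nonneg.2 ht0)] : -α * (t 0 - τ) ≤ 0)) (by linarith)))
      linarith [h3.2]
    have hτj := (hsec j hj).1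
    have h3 := abs_le.1 ((htt' j).trans (mul_le_mul_of_nonneg_left
      (Real.exp_le_one_iff.2 (by linarith only [mul_nonneg hα.le (sub_nonneg.2 hτj)] : -α * (t j - τ) ≤ 0)) (by linarith)))
    have h4 : |t' j - t j| ≤ δ := by
      refine (htt' j).trans ?_
      rw [← hS'e]
      refine mul_le_mul_of_nonneg_left (Real.exp_le_exp.2 ?_) (by linarith)
      have : S' ≤ t j - τ := by linarith [h3.2]
      linarith only [mul_le_mul_of_nonneg_left this hα.le]
    have h5 := abs_le.1 h4
    have h6 := P.abs_phase_sub_le hτj (by linarith : τ ≤ r) (hsec j hj).2.2.2 h4 hj3 (by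
      rw [abs_le]; constructor <;> linarith)
    have h7 := (hφ' r).2
    have h8 := abs_sub_le (φ' r) (φ r) (φ₁ r)
    have h9 : |φ' r - φ₁ r| ≤ C₂ * δ := by
      refine h8.trans ((add_le_add h7 h6).trans ?_)
      rw [hC₂]
      have : 0 ≤ Cd * δ := by positivity
      linarith
    exact h9.trans (mul_le_mul_of_nonneg_right (by linarith) hδ.le)

end Existence

/-! ### Curves of bounded sequences and decaying primitives. -/

section BoundedSequences

variable {F : Type*} [NormedAddCommGroup F]

theorem exists_lp_of_bound {ι : Type*} {u : ι → ℤ → F} (hu : ∀ t, ∃ C, ∀ k, ‖u t k‖ ≤ C) :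
    ∃ U : ι → lp (fun _ : ℤ => F) ∞, ∀ t k, U t k = u t k :=
  ⟨fun t => ⟨u t, memℓp_infty (by
    obtain ⟨C, hC⟩ := hu t
    exact ⟨C, by rintro _ ⟨k, rfl⟩; exact hC k⟩)⟩, fun _ _ => rfl⟩

theorem lp_norm_sub_apply_le (u v : lp (fun _ : ℤ => F) ∞) (k : ℤ) : ‖u k - v k‖ ≤ ‖u - v‖ :=
  lp.norm_apply_le_norm (by simp) (u - v) k

theorem lp_norm_sub_le {u v : lp (fun _ : ℤ => F) ∞} {C : ℝ} (h : ∀ k, ‖u k - v k‖ ≤ C) :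
    ‖u - v‖ ≤ C :=
  lp.norm_le_of_forall_le ((norm_nonneg _).trans (h 0)) h

theorem continuous_of_norm_sub_le {X : Type*} [NormedAddCommGroup X] {u : ℝ → X} {C : ℝ}
    (h : ∀ a b, ‖u a - u b‖ ≤ C * |a - b|) : Continuous u := by
  have hC : 0 ≤ C := by simpa using (norm_nonneg _).trans (h 1 0)
  refine (LipschitzWith.of_dist_le_mul (K := ⟨C, hC⟩) fun a b => ?_).continuous
  rw [dist_eq_norm, Real.dist_eq]
  exact h a b

variable [NormedSpace ℝ F]

/-- A curve of bounded sequences is differentiable if its components are differentiable and their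
derivatives form a continuous curve of bounded sequences. -/
theorem hasDerivAt_lp {u v : ℝ → lp (fun _ : ℤ => F) ∞} (hv : Continuous v)
    (h : ∀ t k, HasDerivAt (fun s => u s k) (v t k) t) (t : ℝ) : HasDerivAt u (v t) t := by
  rw [hasDerivAt_iff_isLittleO, Asymptotics.isLittleO_iff]
  intro c hc
  -- One radius serves all components because `v` is continuous in the supremum norm.
  obtain ⟨r, hr, hball⟩ := Metric.continuousAt_iff.1 hv.continuousAt c hc
  filter_upwards [Metric.ball_mem_nhds t hr] with s hs
  refine lp.norm_le_of_forall_le (by positivity) fun k => ?_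
  exact norm_sub_sub_smul_le_of_hasDerivAt (u := fun s => u s k) (u' := fun s => v s k)
    (convex_ball t r) (fun q _ => h q k) (fun q hq => (lp_norm_sub_apply_le _ _ k).trans
      (by rw [← dist_eq_norm]; exact (hball hq).le)) (Metric.mem_ball_self hr) hs

theorem hasDerivAt_lp_apply {u : ℝ → lp (fun _ : ℤ => F) ∞} {v : lp (fun _ : ℤ => F) ∞} {t : ℝ}
    (h : HasDerivAt u v t) (k : ℤ) : HasDerivAt (fun s => u s k) (v k) t :=
  (lp.evalCLM ℝ (fun _ : ℤ => F) ∞ k).hasFDerivAt.comp_hasDerivAt t h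

end BoundedSequences

section Decay

variable {X : Type*} [NormedAddCommGroup X] [NormedSpace ℝ X]

/-- A curve that tends to zero and has an exponentially decaying velocity decays exponentially. -/
theorem norm_le_of_tendsto_zero {q J : ℝ → X} {α M τ a : ℝ} (hα : 0 < α)
    (hq : ∀ t, a ≤ t → HasDerivAt q (J t) t)
    (hJ : ∀ t, a ≤ t → ‖J t‖ ≤ M * Real.exp (-α * (t - τ))) (h0 : Tendsto q atTop (𝓝 0)) (t : ℝ)
    (ht : a ≤ t) : ‖q t‖ ≤ M / α * Real.exp (-α * (t - τ)) := by
  have hM : 0 ≤ M := nonneg_of_mul_nonneg_left ((norm_nonneg _).trans (hJ a le_rfl))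
    (Real.exp_pos _)
  set W : ℝ → ℝ := fun s => Real.exp (-α * (s - τ)) with hW
  have hWd : ∀ s, HasDerivAt (fun s => M / α * (W t - W s)) (M * W s) s := fun s => by
    have h1 : HasDerivAt W (Real.exp (-α * (s - τ)) * (-α * 1)) s :=
      (((hasDerivAt_id s).sub_const τ).const_mul (-α)).exp
    refine ((h1.const_sub (W t)).const_mul (M / α)).congr_deriv ?_
    have h2 : M / α * α = M := div_mul_cancel₀ _ hα.ne'
    linear_combination W s * h2
  have key : ∀ s, t ≤ s → ‖q s - q t‖ ≤ M / α * W t := fun s hs => by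
    have h1 := image_norm_le_of_norm_deriv_right_le_deriv_boundary (f := fun s => q s - q t)
      (f' := J) (a := t) (b := s) (B := fun s => M / α * (W t - W s)) (B' := fun s => M * W s)
      (fun r hr => ((hq r (ht.trans hr.1)).sub_const _).continuousAt.continuousWithinAt)
      (fun r hr => ((hq r (ht.trans hr.1)).sub_const _).hasDerivWithinAt) (by simp) hWd
      (fun r hr => hJ r (ht.trans hr.1)) (right_mem_Icc.2 hs)
    refine h1.trans (mul_le_mul_of_nonneg_left ?_ (by positivity))
    have : 0 < W s := Real.exp_pos _
    linarith
  have h1 : Tendsto (fun s => ‖q s - q t‖) atTop (𝓝 ‖0 - q t‖) := (h0.sub_const _).norm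
  rw [zero_sub, norm_neg] at h1
  exact le_of_tendsto h1 ((eventually_ge_atTop t).mono key)

/-- A continuous curve that decays exponentially has a primitive that decays exponentially. -/
theorem exists_decaying_primitive [CompleteSpace X] {J : ℝ → X} {α M τ : ℝ} (hα : 0 < α)
    (hJc : Continuous J) (hJ : ∀ t, τ ≤ t → ‖J t‖ ≤ M * Real.exp (-α * (t - τ))) :
    ∃ q : ℝ → X, (∀ t, HasDerivAt q (J t) t) ∧
      ∀ t, τ ≤ t → ‖q t‖ ≤ M / α * Real.exp (-α * (t - τ)) := by
  have hint : MeasureTheory.IntegrableOn J (Ioi τ) := by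
    have h1 : MeasureTheory.IntegrableOn (fun t => M * Real.exp (-α * (t - τ))) (Ioi τ) := by
      have h2 := (integrableOn_exp_mul_Ioi (a := -α) (by linarith) τ).const_mul
        (M * Real.exp (α * τ))
      refine MeasureTheory.IntegrableOn.congr_fun h2 (fun t _ => ?_) measurableSet_Ioi
      rw [mul_assoc, ← Real.exp_add]
      congr 2
      ring
    exact MeasureTheory.Integrable.mono' h1 hJc.aestronglyMeasurable.restrict
      ((MeasureTheory.ae_restrict_iff' measurableSet_Ioi).2
        (Eventually.of_forall fun t ht => hJ t (le_of_lt ht)))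
  have hd : ∀ t, HasDerivAt (fun t => (∫ s in τ..t, J s) - ∫ s in Ioi τ, J s) (J t) t := fun t =>
    (intervalIntegral.integral_hasDerivAt_right (hJc.intervalIntegrable _ _)
      hJc.aestronglyMeasurable.stronglyMeasurableAtFilter hJc.continuousAt).sub_const _
  refine ⟨_, hd, norm_le_of_tendsto_zero hα (fun t _ => hd t) hJ ?_⟩
  have := (MeasureTheory.intervalIntegral_tendsto_integral_Ioi τ hint tendsto_id).sub_const
    (∫ s in Ioi τ, J s)
  simpa using this

end Decay

/-! ### Driven lattice systems: comparison and existence. -/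

namespace LatticeSystem

variable {n m : ℕ}

/-- The coupling terms `ε F_ε` and `ε G_ε`. -/
noncomputable def forcing (L : LatticeSystem n m) (ε : ℝ) (q : SeqVec n × SeqVec m) : SeqVec n × SeqVec m :=
  (ε • L.F ε q, ε • L.G ε q)

/-- `(y, p)` is a solution of the uncoupled system with the additional forcing term `H(t)`. -/
def IsDriven (L : LatticeSystem n m) (H : ℝ → SeqVec n × SeqVec m) (y : ℝ → SeqVec n)
    (p : ℝ → SeqVec m) : Prop :=
  ∀ t, ∃ (v : SeqVec n) (w : SeqVec m), HasDerivAt y v t ∧ HasDerivAt p w t ∧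
    (∀ k, v k = L.f k (y t k) + (H t).1 k) ∧ (∀ k, w k = L.g k (y t k) + (H t).2 k)

/-- Quantitative form of the standing assumptions: all orbits in the sets `Λ k` are hyperbolic with
the constants `D`. -/
structure UniformData (D : HypData) (A R ε₁ : ℝ) (L : LatticeSystem n m)
    (Λ : ℤ → Set (Vec n)) : Prop where
  hyp : ∀ k x, IsOrbitIn (L.f k) (Λ k) x → Nonempty (HypOrbit D (L.f k) x)
  bounded : ∀ k, ∀ y ∈ Λ k, ‖y‖ ≤ R
  norm_g_zero_le : ∀ k, ‖L.g k 0‖ ≤ A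
  norm_g_sub_le : ∀ k y z, ‖L.g k y - L.g k z‖ ≤ A * ‖y - z‖
  norm_forcing_le : ∀ ε, |ε| < ε₁ → ∀ q, ‖L.forcing ε q‖ ≤ |ε| * A
  norm_forcing_sub_le : ∀ ε, |ε| < ε₁ → ∀ q q',
    ‖L.forcing ε q - L.forcing ε q'‖ ≤ |ε| * A * ‖q - q'‖

/-- A bound for the velocities of driven solutions near the orbits of the unperturbed system. -/
noncomputable def speedBound (D : HypData) (A R : ℝ) : ℝ := D.B + 2 * D.Lf + A * (R + 3)

variable {L : LatticeSystem n m} {Λ : ℤ → Set (Vec n)} {D : HypData} {A R ε₁ : ℝ}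

theorem IsDriven.hasDerivAt_fst {H : ℝ → SeqVec n × SeqVec m} {y : ℝ → SeqVec n}
    {p : ℝ → SeqVec m} (h : L.IsDriven H y p) (k : ℤ) :
    IsForced (L.f k) (fun t => (H t).1 k) (fun t => y t k) := fun t => by
  obtain ⟨v, w, hv, -, hv', -⟩ := h t
  have := hasDerivAt_lp_apply hv k
  rwa [hv' k] at this

theorem IsDriven.hasDerivAt_snd {H : ℝ → SeqVec n × SeqVec m} {y : ℝ → SeqVec n}
    {p : ℝ → SeqVec m} (h : L.IsDriven H y p) (k : ℤ) (t : ℝ) :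
    HasDerivAt (fun t => p t k) (L.g k (y t k) + (H t).2 k) t := by
  obtain ⟨v, w, -, hw, -, hw'⟩ := h t
  have := hasDerivAt_lp_apply hw k
  rwa [hw' k] at this

theorem norm_fst_apply_le (q : SeqVec n × SeqVec m) (k : ℤ) : ‖q.1 k‖ ≤ ‖q‖ :=
  (lp.norm_apply_le_norm (by simp) q.1 k).trans (norm_fst_le q)

theorem norm_snd_apply_le (q : SeqVec n × SeqVec m) (k : ℤ) : ‖q.2 k‖ ≤ ‖q‖ :=
  (lp.norm_apply_le_norm (by simp) q.2 k).trans (norm_snd_le q)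

theorem IsDriven.shadows {H : ℝ → SeqVec n × SeqVec m} {y : ℝ → SeqVec n}
    {p : ℝ → SeqVec m} (h : L.IsDriven H y p) {y0 : ℤ → ℝ → Vec n} {φ : ℤ → ℝ → ℝ} {δ τ : ℝ}
    (hb : ∀ t, ‖H t‖ ≤ δ) (hφ : ∀ k, Continuous (φ k))
    (hnear : ∀ t, τ ≤ t → ∀ k, ‖y t k - y0 k (φ k t)‖ ≤ δ) (k : ℤ) :
    Shadows (L.f k) (y0 k) (fun t => (H t).1 k) (fun t => y t k) (φ k) δ τ :=
  ⟨h.hasDerivAt_fst k, fun t => (norm_fst_apply_le _ k).trans (hb t), hφ k, fun t ht => hnear t ht k⟩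

theorem UniformData.norm_g_le (U : L.UniformData D A R ε₁ Λ) (k : ℤ) (y : Vec n) :
    ‖L.g k y‖ ≤ A + A * ‖y‖ := by
  have h1 := U.norm_g_sub_le k y 0
  have h2 := norm_add_le (L.g k y - L.g k 0) (L.g k 0)
  rw [sub_add_cancel] at h2
  rw [sub_zero] at h1
  linarith [U.norm_g_zero_le k]

/-- Driven solutions near the unperturbed orbits have bounded speed. -/
theorem IsDriven.norm_sub_le (U : L.UniformData D A R ε₁ Λ) (hA : 1 ≤ A) (hR : 0 ≤ R)
    {y0 : ℤ → ℝ → Vec n} (h0 : L.IsOrbitOfProduct Λ y0) {H : ℝ → SeqVec n × SeqVec m}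
    {y : ℝ → SeqVec n} {p : ℝ → SeqVec m} (h : L.IsDriven H y p) {φ : ℤ → ℝ → ℝ}
    (hb : ∀ t, ‖H t‖ ≤ 1) (hφ : ∀ k, Continuous (φ k))
    (hnear : ∀ t k, ‖y t k - y0 k (φ k t)‖ ≤ 1) (a b : ℝ) :
    ‖y a - y b‖ ≤ speedBound D A R * |a - b| ∧ ‖p a - p b‖ ≤ speedBound D A R * |a - b| := by
  have hB := D.one_le_B
  have hL := D.one_le_Lf
  constructor
  · refine lp_norm_sub_le fun k => ?_
    obtain ⟨Hk⟩ := U.hyp k (y0 k) (h0 k)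
    refine ((h.shadows (τ := min a b) hb hφ (fun t _ => hnear t) k).norm_sub_le Hk le_rfl
      (min_le_right _ _) (min_le_left _ _)).trans (mul_le_mul_of_nonneg_right ?_ (abs_nonneg _))
    have : 0 ≤ A * (R + 3) := by positivity
    rw [speedBound]; linarith
  · refine lp_norm_sub_le fun k => ?_
    refine norm_sub_le_of_hasDerivAt_bound convex_univ (fun t _ => h.hasDerivAt_snd k t)
      (fun t _ => ?_) trivial trivial
    have h1 : ‖y t k‖ ≤ R + 1 := by
      have h2 := norm_add_le (y t k - y0 k (φ k t)) (y0 k (φ k t))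
      rw [sub_add_cancel] at h2
      linarith [hnear t k, U.bounded k _ ((h0 k).2 (φ k t))]
    have h3 := U.norm_g_le k (y t k)
    have h4 := (norm_snd_apply_le (H t) k).trans (hb t)
    have h5 : A * ‖y t k‖ ≤ A * (R + 1) := mul_le_mul_of_nonneg_left h1 (by linarith)
    refine (norm_add_le _ _).trans ?_
    rw [speedBound]; linarith

variable (n m) in
/-- Comparison of two driven solutions near the same unperturbed orbits. -/
theorem exists_comparison_constants (D : HypData) {A : ℝ} (hA : 1 ≤ A) (R ε₁ : ℝ) :
    ∃ δ₁ > 0, δ₁ ≤ 1 ∧ ∃ ρ > 0, ∃ Q ≥ 1,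
    ∀ (L : LatticeSystem n m) (Λ : ℤ → Set (Vec n)), L.UniformData D A R ε₁ Λ →
    ∀ y0 : ℤ → ℝ → Vec n, L.IsOrbitOfProduct Λ y0 →
    ∀ (H H' : ℝ → SeqVec n × SeqVec m) (y y' : ℝ → SeqVec n) (p p' : ℝ → SeqVec m)
      (φ φ' : ℤ → ℝ → ℝ) (δ τ : ℝ), δ ≤ δ₁ → L.IsDriven H y p → L.IsDriven H' y' p' →
      (∀ t, ‖H t‖ ≤ δ) → (∀ t, ‖H' t‖ ≤ δ) → (∀ k, Continuous (φ k)) → (∀ k, Continuous (φ' k)) →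
      (∀ t k, ‖y t k - y0 k (φ k t)‖ ≤ δ) → (∀ t k, ‖y' t k - y0 k (φ' k t)‖ ≤ δ) →
      (∀ a b, ‖H a - H b‖ ≤ δ * |a - b|) → ∀ M, 0 ≤ M →
      (∀ t, ‖H t - H' t‖ ≤ M * Real.exp (-(D.κ / 4) * (t - τ))) →
      (∀ k, ∀ᶠ t in atTop, |φ k t - φ' k t| ≤ 2 * ρ) →
      (∃ C', ∀ᶠ t in atTop, ‖y t - y' t‖ + ‖p t - p' t‖ ≤ C' * Real.exp (-(D.κ / 4) * (t - τ))) →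
      ∀ t, ‖(y t, p t) - (y' t, p' t)‖ ≤ Q * M * Real.exp (-(D.κ / 4) * (t - τ)) := by
  obtain ⟨δ₁, hδ₁, hδ₁1, ρ, hρ, C, hC, hcd⟩ := norm_sub_le_of_shadows (E := Vec n) D
  have hα : 0 < D.κ / 4 := by have := D.κ_pos; positivity
  set α := D.κ / 4 with hαdef
  have hQ0 : 0 ≤ (A * C + 1) / α := by positivity
  refine ⟨δ₁, hδ₁, hδ₁1, ρ, hρ, C + (A * C + 1) / α, by linarith, ?_⟩
  intro L Λ U y0 h0 H H' y y' p p' φ φ' δ τ hδ hd hd' hb hb' hφ hφ' hn hn' hlip M hM hHH hph hdec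
  obtain ⟨C', hC'⟩ := hdec
  have hexp : ∀ c t : ℝ, c * Real.exp (-α * (t - τ)) = c * Real.exp (α * τ) * Real.exp (-α * t) :=
    fun c t => by
      rw [mul_assoc, ← Real.exp_add]
      congr 2
      ring
  have hy : ∀ t, ‖y t - y' t‖ ≤ C * M * Real.exp (-α * (t - τ)) := fun t => by
    refine lp_norm_sub_le fun k => ?_
    obtain ⟨Hk⟩ := U.hyp k (y0 k) (h0 k)
    have h1 := hcd (L.f k) (y0 k) Hk _ _ _ _ (φ k) (φ' k) δ
      (fun τ => hd.shadows hb hφ (fun t _ => hn t) k)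
      (fun τ => hd'.shadows hb' hφ' (fun t _ => hn' t) k) hδ
      (fun a b => (norm_fst_apply_le (H a - H b) k).trans (hlip a b)) (M * Real.exp (α * τ))
      (by positivity)
      (fun t => (norm_fst_apply_le (H t - H' t) k).trans ((hHH t).trans (hexp _ _).le))
      (C' * Real.exp (α * τ)) (by
        filter_upwards [hph k, hC'] with t h2 h3
        refine ⟨h2, (lp_norm_sub_apply_le _ _ k).trans ?_⟩
        rw [← hexp]
        linarith [norm_nonneg (p t - p' t)]) t
    rw [hexp, mul_assoc C]
    exact h1
  -- There is no hyperbolicity in `p`: the difference is controlled only through its velocity,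
  -- integrated from `+∞`, where the asymptotic hypothesis makes it vanish.
  have hJ : ∀ t, ∃ w, HasDerivAt (fun t => p t - p' t) w t ∧
      ‖w‖ ≤ (A * C + 1) * M * Real.exp (-α * (t - τ)) := fun t => by
    obtain ⟨-, w, -, hw, -, hwk⟩ := hd t
    obtain ⟨-, w', -, hw', -, hwk'⟩ := hd' t
    refine ⟨w - w', hw.sub hw', lp_norm_sub_le fun k => ?_⟩
    rw [hwk, hwk', add_sub_add_comm]
    have h1 := (U.norm_g_sub_le k (y t k) (y' t k)).trans
      (mul_le_mul_of_nonneg_left ((lp_norm_sub_apply_le _ _ k).trans (hy t)) (by linarith))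
    have h2 := (norm_snd_apply_le (H t - H' t) k).trans (hHH t)
    refine (norm_add_le _ _).trans ((add_le_add h1 h2).trans (le_of_eq ?_))
    ring
  choose w hw1 hw2 using hJ
  have hexp0 : Tendsto (fun t => C' * Real.exp (-α * (t - τ))) atTop (𝓝 0) := by
    have h1 : Tendsto (fun t => α * (t - τ)) atTop atTop :=
      (tendsto_atTop_add_const_right _ (-τ) tendsto_id).const_mul_atTop hα
    have := (Real.tendsto_exp_neg_atTop_nhds_zero.comp h1).const_mul C'
    simpa [Function.comp_def] using this
  have h0 : Tendsto (fun t => p t - p' t) atTop (𝓝 0) := by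
    refine squeeze_zero_norm' (hC'.mono fun t ht => ?_) hexp0
    linarith [norm_nonneg (y t - y' t)]
  intro t
  have hp := norm_le_of_tendsto_zero hα (a := t) (fun s _ => hw1 s) (fun s _ => hw2 s) h0 t le_rfl
  have he := Real.exp_pos (-α * (t - τ))
  have e : (A * C + 1) * M / α = (A * C + 1) / α * M := by ring
  rw [e] at hp
  have hM' : 0 ≤ M * Real.exp (-α * (t - τ)) := by positivity
  refine (Prod.norm_def _).trans_le (max_le ?_ ?_)
  · refine (hy t).trans ?_
    rw [mul_assoc, mul_assoc]
    exact mul_le_mul_of_nonneg_right (by linarith) hM'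
  · refine hp.trans ?_
    rw [mul_assoc, mul_assoc]
    exact mul_le_mul_of_nonneg_right (by linarith) hM'

end LatticeSystem

namespace LatticeSystem

variable {n m : ℕ}

variable (n m) in
set_option maxHeartbeats 1000000 in
/-- A forcing term that approaches the forcing term of a given driven solution exponentially has a
driven solution that approaches the given one exponentially. -/
theorem exists_driven_constants (D : HypData) {A : ℝ} (hA : 1 ≤ A) (R ε₁ : ℝ) :
    ∃ δ₁ > 0, δ₁ ≤ 1 ∧ ∃ C ≥ 1, ∀ δ > 0, δ ≤ δ₁ → ∃ S : ℝ,
    ∀ (L : LatticeSystem n m) (Λ : ℤ → Set (Vec n)), L.UniformData D A R ε₁ Λ →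
    ∀ y0 : ℤ → ℝ → Vec n, L.IsOrbitOfProduct Λ y0 →
    ∀ (H H₁ : ℝ → SeqVec n × SeqVec m) (y₁ : ℝ → SeqVec n) (p₁ : ℝ → SeqVec m)
      (φ₁ : ℤ → ℝ → ℝ) (η τ V : ℝ), L.IsDriven H₁ y₁ p₁ → (∀ k, Continuous (φ₁ k)) →
      (∀ t, τ ≤ t → ∀ k, ‖y₁ t k - y0 k (φ₁ k t)‖ ≤ δ) → (∀ t, ‖H₁ t‖ ≤ δ) →
      (∀ a b, ‖H₁ a - H₁ b‖ ≤ δ * |a - b|) → (∀ a b, ‖y₁ a - y₁ b‖ ≤ V * |a - b|) →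
      η ≤ δ → C * η ≤ 1 → (∀ t, ‖H t‖ ≤ η) → (∀ a b, ‖H a - H b‖ ≤ δ * |a - b|) →
      (∀ t, τ ≤ t → ‖H t - H₁ t‖ ≤ Real.exp (-(D.κ / 4) * (t - τ))) →
      ∃ (y : ℝ → SeqVec n) (p : ℝ → SeqVec m) (φ : ℤ → ℝ → ℝ), (∀ k, LipschitzWith 2 (φ k)) ∧
        L.IsDriven H y p ∧ (∀ t k, ‖y t k - y0 k (φ k t)‖ ≤ C * η) ∧
        (∀ t, τ ≤ t → ‖y t - y₁ t‖ + ‖p t - p₁ t‖ ≤ C * Real.exp (-(D.κ / 4) * (t - τ))) ∧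
        ∀ t, τ + S ≤ t → ∀ k, |φ k t - φ₁ k t| ≤ C * δ := by
  obtain ⟨δ₁, hδ₁, hδ₁1, C, hC, hex⟩ := exists_shadowing (Vec n) D
  have hα : 0 < D.κ / 4 := by have := D.κ_pos; positivity
  set α := D.κ / 4 with hαdef
  have hQ0 : 0 ≤ (A * C + 1) / α := by positivity
  refine ⟨δ₁, hδ₁, hδ₁1, C + (A * C + 1) / α, by linarith, ?_⟩
  intro δ hδ hδle
  obtain ⟨S, hS⟩ := hex δ hδ hδle
  refine ⟨S, ?_⟩
  intro L Λ U y0 h0 H H₁ y₁ p₁ φ₁ η τ V hd₁ hφ₁ hn₁ hb₁ hlip₁ hV hη hCη hb hlip hHH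
  have hη0 : 0 ≤ η := (norm_nonneg _).trans (hb 0)
  have hCη' : C * η ≤ (C + (A * C + 1) / α) * η := mul_le_mul_of_nonneg_right (by linarith) hη0
  have hCδ' : C * δ ≤ (C + (A * C + 1) / α) * δ := mul_le_mul_of_nonneg_right (by linarith) hδ.le
  have hcomp : ∀ k, ∃ (y : ℝ → Vec n) (φ : ℝ → ℝ), LipschitzWith 2 φ ∧
      IsForced (L.f k) (fun t => (H t).1 k) y ∧ (∀ t, ‖y t - y0 k (φ t)‖ ≤ C * η) ∧
      (∀ t, τ ≤ t → ‖y t - y₁ t k‖ ≤ C * Real.exp (-α * (t - τ))) ∧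
      ∀ t, τ + S ≤ t → |φ t - φ₁ k t| ≤ C * δ := fun k => by
    obtain ⟨Hk⟩ := U.hyp k (y0 k) (h0 k)
    exact hS (L.f k) (y0 k) Hk _ _ _ (φ₁ k) η τ (hd₁.shadows hb₁ hφ₁ hn₁ k) hη
      (fun t => (norm_fst_apply_le _ k).trans (hb t))
      (fun a b => (norm_fst_apply_le (H a - H b) k).trans (hlip a b))
      (fun t ht => (norm_fst_apply_le (H t - H₁ t) k).trans (hHH t ht))
  choose yk φ hφ hyk hn hyy hph using hcomp
  have hbound : ∀ t k, ‖yk k t‖ ≤ R + 1 := fun t k => by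
    have h2 := norm_add_le (yk k t - y0 k (φ k t)) (y0 k (φ k t))
    rw [sub_add_cancel] at h2
    linarith [hn k t, U.bounded k _ ((h0 k).2 (φ k t))]
  obtain ⟨y, hy⟩ := exists_lp_of_bound (u := fun t k => yk k t) fun t => ⟨R + 1, hbound t⟩
  have hB := D.one_le_B
  have hL := D.one_le_Lf
  set W := D.B + 2 * D.Lf with hW
  have hyW : ∀ a b, ‖y a - y b‖ ≤ W * |a - b| := fun a b => by
    refine lp_norm_sub_le fun k => ?_
    obtain ⟨Hk⟩ := U.hyp k (y0 k) (h0 k)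
    have Sh : Shadows (L.f k) (y0 k) (fun t => (H t).1 k) (yk k) (φ k) 1 (min a b) :=
      ⟨hyk k, fun t => (norm_fst_apply_le _ k).trans ((hb t).trans (by linarith)),
        (hφ k).continuous, fun t _ => (hn k t).trans (by linarith)⟩
    rw [hy, hy]
    exact Sh.norm_sub_le Hk le_rfl (min_le_right _ _) (min_le_left _ _)
  have hvel : ∀ t k, ‖L.f k (y t k) + (H t).1 k‖ ≤ W := fun t k => by
    obtain ⟨Hk⟩ := U.hyp k (y0 k) (h0 k)
    have Sh : Shadows (L.f k) (y0 k) (fun t => (H t).1 k) (yk k) (φ k) 1 t :=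
      ⟨hyk k, fun t => (norm_fst_apply_le _ k).trans ((hb t).trans (by linarith)),
        (hφ k).continuous, fun t _ => (hn k t).trans (by linarith)⟩
    rw [hy]
    exact Sh.norm_velocity_le Hk le_rfl t le_rfl
  -- The velocities are bounded and Lipschitz in time uniformly in `k`, which upgrades componentwise
  -- differentiability to the supremum norm.
  obtain ⟨v, hv⟩ := exists_lp_of_bound (u := fun t k => L.f k (y t k) + (H t).1 k)
    fun t => ⟨W, hvel t⟩
  have hvc : Continuous v := continuous_of_norm_sub_le (C := D.Lf * W + δ) fun a b => by
    refine lp_norm_sub_le fun k => ?_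
    obtain ⟨Hk⟩ := U.hyp k (y0 k) (h0 k)
    rw [hv, hv, add_sub_add_comm]
    have h1 := (Hk.norm_vel_sub_le (y a k) (y b k)).trans (mul_le_mul_of_nonneg_left
      ((lp_norm_sub_apply_le _ _ k).trans (hyW a b)) (by linarith))
    have h2 := (norm_fst_apply_le (H a - H b) k).trans (hlip a b)
    refine (norm_add_le _ _).trans ((add_le_add h1 h2).trans (le_of_eq ?_))
    ring
  have hyd : ∀ t, HasDerivAt y (v t) t := hasDerivAt_lp hvc fun t k => by
    simp only [hv, hy]
    exact hyk k t
  have hyy' : ∀ t, τ ≤ t → ‖y t - y₁ t‖ ≤ C * Real.exp (-α * (t - τ)) := fun t ht =>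
    lp_norm_sub_le fun k => by
      rw [hy]
      exact hyy k t ht
  have hJest : ∀ t k, ‖L.g k (y t k) - L.g k (y₁ t k) + ((H t).2 k - (H₁ t).2 k)‖ ≤
      A * ‖y t - y₁ t‖ + ‖H t - H₁ t‖ := fun t k => by
    refine (norm_add_le _ _).trans (add_le_add ?_ (norm_snd_apply_le (H t - H₁ t) k))
    exact (U.norm_g_sub_le k _ _).trans
      (mul_le_mul_of_nonneg_left (lp_norm_sub_apply_le _ _ k) (by linarith))
  -- `J` is the required velocity of `p - p₁`. It decays exponentially, so `p` is obtained from `p₁`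
  -- by adding the primitive of `J` that vanishes at `+∞`.
  obtain ⟨J, hJ⟩ := exists_lp_of_bound
    (u := fun t k => L.g k (y t k) - L.g k (y₁ t k) + ((H t).2 k - (H₁ t).2 k))
    fun t => ⟨_, hJest t⟩
  have hJc : Continuous J := continuous_of_norm_sub_le (C := A * W + A * V + (δ + δ)) fun a b => by
    refine lp_norm_sub_le fun k => ?_
    rw [hJ, hJ]
    have h1 := (U.norm_g_sub_le k (y a k) (y b k)).trans (mul_le_mul_of_nonneg_left
      ((lp_norm_sub_apply_le _ _ k).trans (hyW a b)) (by linarith))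
    have h2 := (U.norm_g_sub_le k (y₁ a k) (y₁ b k)).trans (mul_le_mul_of_nonneg_left
      ((lp_norm_sub_apply_le _ _ k).trans (hV a b)) (by linarith))
    have h3 := (norm_snd_apply_le (H a - H b) k).trans (hlip a b)
    have h4 := (norm_snd_apply_le (H₁ a - H₁ b) k).trans (hlip₁ a b)
    have e : L.g k (y a k) - L.g k (y₁ a k) + ((H a).2 k - (H₁ a).2 k) -
        (L.g k (y b k) - L.g k (y₁ b k) + ((H b).2 k - (H₁ b).2 k)) =
        (L.g k (y a k) - L.g k (y b k)) - (L.g k (y₁ a k) - L.g k (y₁ b k)) +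
          ((H a - H b).2 k - (H₁ a - H₁ b).2 k) := by
      simp only [Prod.snd_sub, lp.coeFn_sub, Pi.sub_apply]
      abel
    rw [e]
    refine (norm_add_le _ _).trans ((add_le_add ((norm_sub_le _ _).trans (add_le_add h1 h2))
      ((norm_sub_le _ _).trans (add_le_add h3 h4))).trans (le_of_eq ?_))
    ring
  obtain ⟨q, hq, hqb⟩ := exists_decaying_primitive (M := A * C + 1) (τ := τ) hα hJc (fun t ht => by
    refine lp.norm_le_of_forall_le (by positivity) fun k => ?_
    rw [hJ]
    refine (hJest t k).trans ?_
    have h1 := mul_le_mul_of_nonneg_left (hyy' t ht) (by linarith : 0 ≤ A)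
    have h2 := hHH t ht
    linarith)
  refine ⟨y, fun t => p₁ t + q t, φ, hφ, fun t => ?_, fun t k => ?_, fun t ht => ?_,
    fun t ht k => (hph k t ht).trans hCδ'⟩
  · obtain ⟨-, w, -, hw, -, hwk⟩ := hd₁ t
    refine ⟨v t, w + J t, hyd t, hw.add (hq t), hv t, fun k => ?_⟩
    rw [lp.coeFn_add, Pi.add_apply, hwk, hJ]
    abel
  · rw [hy]
    exact (hn k t).trans hCη'
  · rw [add_sub_cancel_left, add_mul]
    exact add_le_add (hyy' t ht) (hqb t ht)

end LatticeSystem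

/-! ### Forcing terms that reproduce themselves. -/

section SelfConsistent

variable {X X' : Type*} [NormedAddCommGroup X] [NormedAddCommGroup X']

/-- Fixed points of `H ↦ F ∘ Z H`, where `Z` is a solution operator that is Lipschitz with respect to
an exponential weight and `F` has a small Lipschitz constant. -/
theorem exists_self_consistent [CompleteSpace X] {F : X' → X} {z₁ : ℝ → X'}
    {Z : (ℝ → X) → ℝ → X'} {α η δ C Q τ : ℝ} (hα : 0 ≤ α) (hη : 0 ≤ η) (hFb : ∀ q, ‖F q‖ ≤ η)
    (hFl : ∀ q q', ‖F q - F q'‖ ≤ η * ‖q - q'‖) (hηC : η * C ≤ 1) (hηQ : η * Q ≤ 1 / 2)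
    (𝒮 : Set (ℝ → X)) (h𝒮 : ∀ H, H ∈ 𝒮 ↔ (∀ t, ‖H t‖ ≤ η) ∧ (∀ a b, ‖H a - H b‖ ≤ δ * |a - b|) ∧
      ∀ t, τ ≤ t → ‖H t - F (z₁ t)‖ ≤ Real.exp (-α * (t - τ)))
    (h₁ : ∀ a b, ‖F (z₁ a) - F (z₁ b)‖ ≤ δ * |a - b|)
    (hlip : ∀ H ∈ 𝒮, ∀ a b, ‖F (Z H a) - F (Z H b)‖ ≤ δ * |a - b|)
    (hclose : ∀ H ∈ 𝒮, ∀ t, τ ≤ t → ‖Z H t - z₁ t‖ ≤ C * Real.exp (-α * (t - τ)))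
    (hcontr : ∀ u ∈ 𝒮, ∀ v ∈ 𝒮, ∀ M, 0 ≤ M →
      (∀ t, ‖u t - v t‖ ≤ M * Real.exp (-α * (t - τ))) →
      ∀ t, ‖Z u t - Z v t‖ ≤ Q * M * Real.exp (-α * (t - τ))) :
    ∃ H ∈ 𝒮, H = fun t => F (Z H t) := by
  set w : ℝ → ℝ := fun t => Real.exp (-α * (t - τ)) with hw
  have hw0 : ∀ t, 0 < w t := fun t => Real.exp_pos _
  have hTS : ∀ H ∈ 𝒮, (fun t => F (Z H t)) ∈ 𝒮 := fun H hH => by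
    rw [h𝒮]
    refine ⟨fun t => hFb _, hlip H hH, fun t ht => (hFl _ _).trans ?_⟩
    refine (mul_le_mul_of_nonneg_left (hclose H hH t ht) hη).trans ?_
    rw [← mul_assoc]
    exact mul_le_of_le_one_left (hw0 t).le hηC
  have hH₁S : (fun t => F (z₁ t)) ∈ 𝒮 := (h𝒮 _).2 ⟨fun t => hFb _, h₁, fun t _ => by
    rw [sub_self, norm_zero]; exact (hw0 t).le⟩
  obtain ⟨H, hH, hfix, -⟩ := exists_fixed_point_of_weighted_contraction w 𝒮
    (fun u v e hu he huv => by
      have hlim : ∀ t, Tendsto (fun j => u j t) atTop (𝓝 (v t)) := fun t => by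
        rw [tendsto_iff_norm_sub_tendsto_zero]
        refine squeeze_zero (fun _ => norm_nonneg _) (fun j => huv j t) ?_
        simpa using he.mul_const (w t)
      have hu' := fun j => (h𝒮 _).1 (hu j)
      exact (h𝒮 _).2 ⟨fun t => le_of_tendsto (hlim t).norm
          (Eventually.of_forall fun j => (hu' j).1 t),
        fun a b => le_of_tendsto ((hlim a).sub (hlim b)).norm
          (Eventually.of_forall fun j => (hu' j).2.1 a b),
        fun t ht => le_of_tendsto ((hlim t).sub_const _).norm
          (Eventually.of_forall fun j => (hu' j).2.2 t ht)⟩)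
    (fun H t => F (Z H t)) hTS (β := 1 / 2) (by norm_num) (by norm_num)
    (fun u hu v hv M hM huv t => by
      refine (hFl _ _).trans
        ((mul_le_mul_of_nonneg_left (hcontr u hu v hv M hM huv t) hη).trans ?_)
      have h3 := mul_le_mul_of_nonneg_right hηQ (mul_nonneg hM (hw0 t).le)
      calc _ = η * Q * (M * w t) := by ring
        _ ≤ 1 / 2 * (M * w t) := h3
        _ = _ := by ring)
    (fun t => F (z₁ t)) hH₁S (M₀ := 1 + 2 * η) (by positivity) (fun t => by
      rw [add_mul, one_mul]
      -- Before `τ` nothing is known about decay, but the forcings are bounded by `η` and the weight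
      -- is at least 1; the starting point thus moves a finite distance.
      rcases le_total τ t with ht | ht
      · refine (((h𝒮 _).1 (hTS _ hH₁S)).2.2 t ht).trans (le_add_of_nonneg_right ?_)
        exact mul_nonneg (by linarith) (hw0 t).le
      · have h1 : 1 ≤ w t := Real.one_le_exp (by nlinarith)
        refine (norm_sub_le _ _).trans ?_
        have h3 := hFb (Z (fun t => F (z₁ t)) t)
        have h4 := hFb (z₁ t)
        have h5 := mul_le_mul_of_nonneg_left h1 (by linarith : 0 ≤ 2 * η)
        linarith)
  exact ⟨H, hH, hfix.symm⟩

/-- Two curves that depend in a Lipschitz manner, with respect to an exponential weight, on their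
images under a map with a small Lipschitz constant coincide if they are asymptotic. -/
theorem eq_of_asymptotic {F : X' → X} {z z' : ℝ → X'} {α η Q τ : ℝ} (hα : 0 ≤ α) (hη : 0 ≤ η)
    (hFb : ∀ q, ‖F q‖ ≤ η) (hFl : ∀ q q', ‖F q - F q'‖ ≤ η * ‖q - q'‖) (hηQ : η * Q ≤ 1 / 2)
    (hcomp : ∀ M, 0 ≤ M → (∀ t, ‖F (z t) - F (z' t)‖ ≤ M * Real.exp (-α * (t - τ))) →
      ∀ t, ‖z t - z' t‖ ≤ Q * M * Real.exp (-α * (t - τ)))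
    {C' a : ℝ} (has : ∀ t, a ≤ t → ‖z t - z' t‖ ≤ C' * Real.exp (-α * (t - τ))) : z = z' := by
  set w : ℝ → ℝ := fun t => Real.exp (-α * (t - τ)) with hw
  have hw0 : ∀ t, 0 < w t := fun t => Real.exp_pos _
  have hC' : 0 ≤ C' := nonneg_of_mul_nonneg_left ((norm_nonneg _).trans (has a le_rfl)) (hw0 a)
  -- A first bound, needed only for its finiteness: asymptotics to the right of `a`, boundedness of
  -- `F` to the left.
  have h1 := hcomp (2 * η * Real.exp (α * (a - τ)) + η * C') (by positivity) (fun t => by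
    have h6 := hw0 t
    rw [add_mul]
    rcases le_total a t with ht | ht
    · have h2 := (hFl (z t) (z' t)).trans (mul_le_mul_of_nonneg_left (has t ht) hη)
      have h3 : 0 ≤ 2 * η * Real.exp (α * (a - τ)) * w t := by positivity
      rw [← mul_assoc] at h2
      linarith
    · have h2 := norm_sub_le (F (z t)) (F (z' t))
      have h3 := hFb (z t)
      have h4 := hFb (z' t)
      have h5 : 1 ≤ Real.exp (α * (a - τ)) * w t := by
        simp only [hw]
        rw [← Real.exp_add]
        exact Real.one_le_exp (by nlinarith)
      have h7 := mul_le_mul_of_nonneg_left h5 (by linarith : 0 ≤ 2 * η)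
      have h8 : 0 ≤ η * C' * w t := by positivity
      rw [mul_assoc (2 * η)]
      linarith)
  have h2 := weighted_bound_of_self_improving (fun t => ‖z t - z' t‖) w (fun t => (hw0 t).le)
    (β := 1 / 2) (c := 0) (by norm_num) (by norm_num) le_rfl h1 (fun M hM hb t => by
      have h3 := hcomp (η * M) (by positivity) (fun t => by
        rw [mul_assoc]
        exact (hFl _ _).trans (mul_le_mul_of_nonneg_left (hb t) hη)) t
      refine h3.trans ?_
      have h4 := mul_le_mul_of_nonneg_right hηQ (mul_nonneg hM (hw0 t).le)
      calc _ = η * Q * (M * w t) := by ring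
        _ ≤ 1 / 2 * (M * w t) := h4
        _ = _ := by ring)
  funext t
  have h3 := h2 t
  rw [zero_div, zero_mul] at h3
  exact sub_eq_zero.1 (norm_le_zero_iff.1 h3)

end SelfConsistent

/-! ### Asymptotic solutions of the coupled system. -/

namespace LatticeSystem

variable {n m : ℕ}

theorem IsSolutionOnManifold.continuous_phase_apply {L : LatticeSystem n m} {ε δ : ℝ}
    {y0 : ℤ → ℝ → Vec n} {y : ℝ → SeqVec n} {p : ℝ → SeqVec m} {Φ : ℝ → PhaseSpace}
    (h : L.IsSolutionOnManifold ε δ y0 y p Φ) (k : ℤ) : Continuous fun t => Φ t k :=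
  (lp.evalCLM ℝ (fun _ : ℤ => ℝ) ∞ k).continuous.comp h.continuous_phase

theorem norm_prod_sub_le {q q' : SeqVec n × SeqVec m} :
    ‖q - q'‖ ≤ ‖q.1 - q'.1‖ + ‖q.2 - q'.2‖ :=
  (Prod.norm_def _).trans_le
    (max_le_add_of_nonneg (norm_nonneg _) (norm_nonneg _))

variable (n m) in
set_option maxHeartbeats 1000000 in
/-- Existence and uniqueness of a solution near the orbits `y02` that is asymptotic to a given
solution, if the latter is close to `y02`, up to its own phases, from the time `τ` on. -/
theorem exists_asymptotic_solution (D : HypData) {A : ℝ} (hA : 1 ≤ A) {R : ℝ} (hR : 0 ≤ R)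
    {ε₁ : ℝ} (hε₁ : 0 < ε₁) :
    ∃ δ₁ > 0, δ₁ ≤ 1 ∧ ∃ ρ > 0, ∃ C ≥ 1, ∀ δ > 0, δ ≤ δ₁ → ∃ ε₀ > 0, ∀ ε : ℝ, |ε| < ε₀ →
    ∀ (L : LatticeSystem n m) (Λ : ℤ → Set (Vec n)), L.UniformData D A R ε₁ Λ →
    ∀ y01 y02 : ℤ → ℝ → Vec n, L.IsOrbitOfProduct Λ y01 → L.IsOrbitOfProduct Λ y02 →
    ∀ (y1 : ℝ → SeqVec n) (p1 : ℝ → SeqVec m) (Φ1 : ℝ → PhaseSpace),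
      L.IsSolutionOnManifold ε δ y01 y1 p1 Φ1 → ∀ τ : ℝ,
      (∀ t, τ ≤ t → ∀ k, ‖y1 t k - y02 k (Φ1 t k)‖ ≤ δ₁) →
      ∃ (y2 : ℝ → SeqVec n) (p2 : ℝ → SeqVec m) (Φ2 : ℝ → PhaseSpace),
        L.IsSolutionOnManifold ε δ y02 y2 p2 Φ2 ∧ (∀ᶠ t in atTop, ‖Φ1 t - Φ2 t‖ ≤ ρ) ∧
        (∀ t, τ ≤ t → ‖y1 t - y2 t‖ + ‖p1 t - p2 t‖ ≤ C * Real.exp (-(D.κ / 4) * (t - τ))) ∧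
        ∀ (y : ℝ → SeqVec n) (p : ℝ → SeqVec m) (Φ : ℝ → PhaseSpace),
          L.IsSolutionOnManifold ε δ y02 y p Φ → (∀ᶠ t in atTop, ‖Φ1 t - Φ t‖ ≤ ρ) →
          (∃ C' a : ℝ, ∀ t, a ≤ t →
            ‖y1 t - y t‖ + ‖p1 t - p t‖ ≤ C' * Real.exp (-(D.κ / 4) * (t - τ))) →
          y = y2 ∧ p = p2 := by
  obtain ⟨δc, hδc, hδc1, ρ, hρ, Q, hQ, hcompare⟩ := exists_comparison_constants n m D hA R ε₁
  obtain ⟨δd, hδd, hδd1, C, hC, hdriven⟩ := exists_driven_constants n m D hA R ε₁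
  have hα : 0 < D.κ / 4 := by have := D.κ_pos; positivity
  set α := D.κ / 4 with hαdef
  -- The bound `ρ / C` puts the phases of every constructed solution within `ρ` of `Φ1`; two such
  -- solutions are then `2 * ρ`-close in phase, as the comparison requires.
  set δ₁ := min (min δc δd) (ρ / C) with hδ₁def
  have hδ₁ : 0 < δ₁ := by positivity
  have hδ₁c : δ₁ ≤ δc := (min_le_left _ _).trans (min_le_left _ _)
  have hδ₁d : δ₁ ≤ δd := (min_le_left _ _).trans (min_le_right _ _)
  have hδ₁1 : δ₁ ≤ 1 := hδ₁c.trans hδc1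
  have hδ₁ρ : C * δ₁ ≤ ρ := by
    have : δ₁ ≤ ρ / C := min_le_right _ _
    rw [le_div_iff₀ (by linarith)] at this
    linarith
  -- The fixed size `δ₁` is used, not `δ`: the given solution is only known to be `δ₁`-close to the
  -- orbits `y02`.
  obtain ⟨S, hS⟩ := hdriven δ₁ hδ₁ hδ₁d
  set V := speedBound D A R with hV
  have hV0 : 0 ≤ V := by
    have := D.one_le_B
    have := D.one_le_Lf
    rw [hV, speedBound]; positivity
  -- With `η = |ε| * A` this yields `η * C ≤ δ` for closeness to the orbits, `η * V ≤ δ₁` for the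
  -- Lipschitz bound of the forcing in time, and `η * Q ≤ 1 / 2` for the contraction.
  refine ⟨δ₁, hδ₁, hδ₁1, ρ, hρ, C, hC, fun δ hδ hδle => ⟨min ε₁ (δ / (2 * A * (C + V + Q))),
    by positivity, ?_⟩⟩
  intro ε hε L Λ U y01 y02 h01 h02 y1 p1 Φ1 h1 τ hn1
  have hεε : |ε| < ε₁ := hε.trans_le (min_le_left _ _)
  set η := |ε| * A with hη
  have hη0 : 0 ≤ η := by positivity
  have hηsum : 2 * (η * C + η * V + η * Q) ≤ δ := by
    have := (hε.trans_le (min_le_right _ _)).le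
    rw [le_div_iff₀ (by positivity)] at this
    refine le_trans (le_of_eq ?_) this
    rw [hη]; ring
  have hηC0 : 0 ≤ η * C := by positivity
  have hηV0 : 0 ≤ η * V := by positivity
  have hηQ0 : 0 ≤ η * Q := by positivity
  have hηC : C * η ≤ δ := by linarith
  have hηQ : η * Q ≤ 1 / 2 := by linarith
  have hηδ : η ≤ δ := (le_mul_of_one_le_left hη0 hC).trans hηC
  have hηδ₁ : η ≤ δ₁ := hηδ.trans hδle
  have hδ1 : δ ≤ 1 := hδle.trans hδ₁1
  set H₁ : ℝ → SeqVec n × SeqVec m := fun t => L.forcing ε (y1 t, p1 t) with hH₁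
  have hd1 : L.IsDriven H₁ y1 p1 := h1.solution
  have hFb : ∀ q, ‖L.forcing ε q‖ ≤ η := U.norm_forcing_le ε hεε
  have hFl : ∀ q q', ‖L.forcing ε q - L.forcing ε q'‖ ≤ η * ‖q - q'‖ :=
    U.norm_forcing_sub_le ε hεε
  have hlip : ∀ {y0 : ℤ → ℝ → Vec n}, L.IsOrbitOfProduct Λ y0 →
      ∀ (H : ℝ → SeqVec n × SeqVec m) (y : ℝ → SeqVec n) (p : ℝ → SeqVec m) (φ : ℤ → ℝ → ℝ),
      L.IsDriven H y p → (∀ t, ‖H t‖ ≤ η) → (∀ k, Continuous (φ k)) →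
      (∀ t k, ‖y t k - y0 k (φ k t)‖ ≤ δ) → (∀ a b, ‖y a - y b‖ ≤ V * |a - b|) ∧
      ∀ a b, ‖L.forcing ε (y a, p a) - L.forcing ε (y b, p b)‖ ≤ δ₁ * |a - b| := by
    intro y0 h0 H y p φ hd hb hφ hn
    have key := hd.norm_sub_le U hA hR h0 (fun t => (hb t).trans (hηδ.trans hδ1)) hφ
      (fun t k => (hn t k).trans hδ1)
    refine ⟨fun a b => (key a b).1, fun a b => (hFl _ _).trans ?_⟩
    have h2 : ‖(y a, p a) - (y b, p b)‖ ≤ V * |a - b| :=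
      (Prod.norm_def _).trans_le (max_le (key a b).1 (key a b).2)
    refine (mul_le_mul_of_nonneg_left h2 hη0).trans ?_
    rw [← mul_assoc]
    exact mul_le_mul_of_nonneg_right (by linarith) (abs_nonneg _)
  have hlip1 := hlip h01 H₁ y1 p1 (fun k t => Φ1 t k) hd1 (fun t => hFb _)
    h1.continuous_phase_apply h1.close
  obtain ⟨𝒮, h𝒮⟩ : ∃ 𝒮 : Set (ℝ → SeqVec n × SeqVec m), ∀ H, H ∈ 𝒮 ↔ (∀ t, ‖H t‖ ≤ η) ∧
    (∀ a b, ‖H a - H b‖ ≤ δ₁ * |a - b|) ∧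
    ∀ t, τ ≤ t → ‖H t - L.forcing ε (y1 t, p1 t)‖ ≤ Real.exp (-α * (t - τ)) := ⟨{H | _}, fun _ => Iff.rfl⟩
  have hex : ∀ H ∈ 𝒮, ∃ (y : ℝ → SeqVec n) (p : ℝ → SeqVec m) (φ : ℤ → ℝ → ℝ),
      (∀ k, LipschitzWith 2 (φ k)) ∧ L.IsDriven H y p ∧ (∀ t k, ‖y t k - y02 k (φ k t)‖ ≤ C * η) ∧
      (∀ t, τ ≤ t → ‖y t - y1 t‖ + ‖p t - p1 t‖ ≤ C * Real.exp (-α * (t - τ))) ∧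
      ∀ t, τ + S ≤ t → ∀ k, |φ k t - Φ1 t k| ≤ C * δ₁ := fun H hH =>
    hS L Λ U y02 h02 H H₁ y1 p1 (fun k t => Φ1 t k) η τ V hd1 h1.continuous_phase_apply hn1
      (fun t => (hFb _).trans hηδ₁) hlip1.2 hlip1.1 hηδ₁ (hηC.trans hδ1) ((h𝒮 H).1 hH).1
      ((h𝒮 H).1 hH).2.1 ((h𝒮 H).1 hH).2.2
  choose! Y P φ hφ hd hn hclose hph using hex
  have hlipT := fun H (hH : H ∈ 𝒮) => (hlip h02 H (Y H) (P H) (φ H) (hd H hH) ((h𝒮 H).1 hH).1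
    (fun k => (hφ H hH k).continuous) (fun t k => (hn H hH t k).trans hηC)).2
  obtain ⟨H, hH, hfix⟩ := exists_self_consistent (F := L.forcing ε) (z₁ := fun t => (y1 t, p1 t))
    (Z := fun H t => (Y H t, P H t)) (C := C) hα.le hη0 hFb hFl (by linarith) hηQ 𝒮 h𝒮 hlip1.2 hlipT
    (fun H hH t ht => norm_prod_sub_le.trans (hclose H hH t ht))
    (fun u hu v hv M hM huv => by
      refine hcompare L Λ U y02 h02 u v (Y u) (Y v) (P u) (P v) (φ u) (φ v) δ₁ τ hδ₁c
        (hd u hu) (hd v hv) (fun t => (((h𝒮 u).1 hu).1 t).trans hηδ₁)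
        (fun t => (((h𝒮 v).1 hv).1 t).trans hηδ₁)
        (fun k => (hφ u hu k).continuous) (fun k => (hφ v hv k).continuous)
        (fun t k => (hn u hu t k).trans (hηC.trans hδle))
        (fun t k => (hn v hv t k).trans (hηC.trans hδle)) ((h𝒮 u).1 hu).2.1 M hM huv
        (fun k => (eventually_ge_atTop (τ + S)).mono fun t ht => ?_)
        ⟨C + C, (eventually_ge_atTop τ).mono fun t ht => ?_⟩
      · have h3 := abs_sub_le (φ u k t) (Φ1 t k) (φ v k t)
        have h4 := hph u hu t ht k
        have h5 := hph v hv t ht k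
        rw [abs_sub_comm] at h5
        linarith
      · have h3 := norm_sub_le_norm_sub_add_norm_sub (Y u t) (y1 t) (Y v t)
        have h4 := norm_sub_le_norm_sub_add_norm_sub (P u t) (p1 t) (P v t)
        rw [norm_sub_rev (y1 t)] at h3
        rw [norm_sub_rev (p1 t)] at h4
        have h5 := hclose u hu t ht
        have h6 := hclose v hv t ht
        rw [add_mul]
        linarith)
  have hHb := ((h𝒮 H).1 hH).1
  have hHl := ((h𝒮 H).1 hH).2.1
  have hdH := hd H hH
  have hφH := hφ H hH
  have hnH := hn H hH
  have hphH := hph H hH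
  have hcH := hclose H hH
  set y2 := Y H
  set p2 := P H
  set φ2 := φ H
  have hsol : L.IsDriven (fun t => L.forcing ε (y2 t, p2 t)) y2 p2 := hfix ▸ hdH
  -- At time `τ + S` the phases are uniformly close to those of `Φ1`, and they are 2-Lipschitz; so
  -- they form a bounded sequence at every time.
  obtain ⟨Φ2, hΦ2⟩ := exists_lp_of_bound (u := fun t k => φ2 k t) fun t =>
    ⟨2 * |t - (τ + S)| + (C * δ₁ + ‖Φ1 (τ + S)‖), fun k => by
      have h2 := (hφH k).dist_le_mul t (τ + S)
      rw [Real.dist_eq, Real.dist_eq] at h2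
      have h3 := hphH (τ + S) le_rfl k
      have h4 : |Φ1 (τ + S) k| ≤ ‖Φ1 (τ + S)‖ := lp.norm_apply_le_norm (by simp) (Φ1 (τ + S)) k
      have h5 := abs_sub_abs_le_abs_sub (φ2 k t) (φ2 k (τ + S))
      have h6 := abs_sub_abs_le_abs_sub (φ2 k (τ + S)) (Φ1 (τ + S) k)
      rw [Real.norm_eq_abs]
      push_cast at h2
      linarith⟩
  have hon : L.IsSolutionOnManifold ε δ y02 y2 p2 Φ2 := by
    refine ⟨hsol, continuous_of_norm_sub_le (C := 2) fun a b => lp_norm_sub_le fun k => ?_,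
      fun t k => ?_⟩
    · have h2 := (hφH k).dist_le_mul a b
      rw [Real.dist_eq, Real.dist_eq] at h2
      rw [hΦ2, hΦ2]
      exact h2
    · rw [hΦ2]
      exact (hnH t k).trans hηC
  refine ⟨y2, p2, Φ2, hon, (eventually_ge_atTop (τ + S)).mono fun t ht => lp_norm_sub_le fun k => ?_,
    fun t ht => ?_, fun y p Φ hm hphase hasym => ?_⟩
  · rw [norm_sub_rev, hΦ2]
    exact (hphH t ht k).trans hδ₁ρ
  · rw [norm_sub_rev (y1 t), norm_sub_rev (p1 t)]
    exact hcH t ht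
  · obtain ⟨C', a, hC'⟩ := hasym
    have hclose2 : ∀ t, max a τ ≤ t →
        ‖y t - y2 t‖ + ‖p t - p2 t‖ ≤ (C' + C) * Real.exp (-α * (t - τ)) := fun t ht => by
      have h3 := norm_sub_le_norm_sub_add_norm_sub (y t) (y1 t) (y2 t)
      have h4 := norm_sub_le_norm_sub_add_norm_sub (p t) (p1 t) (p2 t)
      rw [norm_sub_rev (y t) (y1 t), norm_sub_rev (y1 t) (y2 t)] at h3
      rw [norm_sub_rev (p t) (p1 t), norm_sub_rev (p1 t) (p2 t)] at h4
      have h5 := hC' t ((le_max_left _ _).trans ht)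
      have h6 := hcH t ((le_max_right _ _).trans ht)
      rw [add_mul]
      linarith
    have hd3 : L.IsDriven (fun t => L.forcing ε (y t, p t)) y p := hm.solution
    have hlip3 := (hlip h02 _ y p (fun k t => Φ t k) hd3 (fun t => hFb _)
      hm.continuous_phase_apply hm.close).2
    have key := eq_of_asymptotic (F := L.forcing ε) (z := fun t => (y t, p t))
      (z' := fun t => (y2 t, p2 t)) (Q := Q) hα.le hη0 hFb hFl hηQ
      (fun M hM hMb => hcompare L Λ U y02 h02 _ _ y y2 p p2 (fun k t => Φ t k) φ2 δ₁ τ hδ₁c hd3 hsol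
        (fun t => (hFb _).trans hηδ₁) (fun t => (hFb _).trans hηδ₁) hm.continuous_phase_apply
        (fun k => (hφH k).continuous) (fun t k => (hm.close t k).trans hδle)
        (fun t k => (hnH t k).trans (hηC.trans hδle)) hlip3 M hM hMb
        (fun k => by
          filter_upwards [hphase, eventually_ge_atTop (τ + S)] with t h2 h3
          have h4 := (lp_norm_sub_apply_le (Φ1 t) (Φ t) k).trans h2
          have h5 := abs_sub_le (Φ t k) (Φ1 t k) (φ2 k t)
          have h6 := hphH t h3 k
          rw [Real.norm_eq_abs, abs_sub_comm] at h4
          rw [abs_sub_comm] at h6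
          linarith)
        ⟨C' + C, (eventually_ge_atTop (max a τ)).mono hclose2⟩)
      (a := max a τ) (C' := C' + C) (fun t ht => norm_prod_sub_le.trans (hclose2 t ht))
    exact ⟨funext fun t => congrArg Prod.fst (congrFun key t),
      funext fun t => congrArg Prod.snd (congrFun key t)⟩

end LatticeSystem

/-- Backward comparison of two orbits of a vector field. -/
theorem HypOrbit.norm_sub_le_backward {E : Type*} [NormedAddCommGroup E] [NormedSpace ℝ E]
    {D : HypData} {f : E → E} {x y : ℝ → E} (H : HypOrbit D f x)
    (hy : ∀ t, HasDerivAt y (f (y t)) t) {t₀ r b : ℝ} (hr : 0 ≤ r) (hrb : r ≤ b) :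
    ‖x (t₀ - r) - y (t₀ - r)‖ ≤ Real.exp (D.Lf * b) * ‖x t₀ - y t₀‖ := by
  have key := norm_le_exp_mul_of_norm_deriv_le (u := fun r => x (t₀ - r) - y (t₀ - r))
    (u' := fun r => -f (x (t₀ - r)) - -f (y (t₀ - r))) (L := D.Lf) (ε := 0) (b := b) D.one_le_Lf
    le_rfl (fun t _ => ?_) (fun t _ => ?_) r ⟨hr, hrb⟩
  · simpa using key
  · exact ((H.orbit (t₀ - t)).comp_const_sub t₀ t).sub ((hy (t₀ - t)).comp_const_sub t₀ t)
  · rw [neg_sub_neg, norm_sub_rev, add_zero]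
    exact H.norm_vel_sub_le _ _

/-! ### From `γ`-close orbits to the asymptotic phase. -/

namespace LatticeSystem

variable {n m : ℕ}

/-- The asymptotic phase property for solutions that start near two products of orbits which are
`γ`-close in forward time. -/
def ForwardAsymptotics (L : LatticeSystem n m) (Λ : ℤ → Set (Vec n)) (α ρ : ℝ) (C : ℝ → ℝ → ℝ)
    (δ ε γ : ℝ) : Prop :=
  ∀ y01 y02 : ℤ → ℝ → Vec n, L.IsOrbitOfProduct Λ y01 → L.IsOrbitOfProduct Λ y02 →
  ∀ t₀ : ℝ, (∀ t, t₀ ≤ t → ∀ k, ‖y01 k t - y02 k t‖ ≤ γ) →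
    ∀ (y1 : ℝ → SeqVec n) (p1 : ℝ → SeqVec m) (Φ1 : ℝ → PhaseSpace),
    L.IsSolutionOnManifold ε δ y01 y1 p1 Φ1 →
    ∀ σ : ℝ, 0 ≤ σ → (∀ k, t₀ - σ ≤ Φ1 t₀ k) →
    ∃ (y2 : ℝ → SeqVec n) (p2 : ℝ → SeqVec m) (Φ2 : ℝ → PhaseSpace),
      L.IsSolutionOnManifold ε δ y02 y2 p2 Φ2 ∧
      (∀ᶠ t in atTop, ‖Φ1 t - Φ2 t‖ ≤ ρ) ∧
      (∀ t, t₀ ≤ t →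
        ‖y1 t - y2 t‖ + ‖p1 t - p2 t‖ ≤ C σ γ * Real.exp (-α * (t - t₀))) ∧
      ∀ (y : ℝ → SeqVec n) (p : ℝ → SeqVec m) (Φ : ℝ → PhaseSpace),
        L.IsSolutionOnManifold ε δ y02 y p Φ →
        (∀ᶠ t in atTop, ‖Φ1 t - Φ t‖ ≤ ρ) →
        (∃ C' : ℝ, ∀ t, t₀ ≤ t →
          ‖y1 t - y t‖ + ‖p1 t - p t‖ ≤ C' * Real.exp (-α * (t - t₀))) →
        y = y2 ∧ p = p2

/-- For `γ > 0` the expression is a constant times `γ ^ (c / b)`; it is the small factor in `C(σ,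
γ)`. -/
theorem tendsto_exp_sub_log_div {a b c g : ℝ} (hb : 0 < b) (hc : 0 < c) (hg : 0 < g) :
    Tendsto (fun γ => Real.exp (c * (a - Real.log (g / γ) / b))) (𝓝[>] 0) (𝓝 0) := by
  refine Real.tendsto_exp_atBot.comp (Tendsto.const_mul_atBot hc ?_)
  have h1 : Tendsto (fun γ : ℝ => g / γ) (𝓝[>] 0) atTop := by
    simpa only [div_eq_mul_inv] using tendsto_inv_nhdsGT_zero.const_mul_atTop hg
  have h2 := (Real.tendsto_log_atTop.comp h1).atTop_div_const hb
  simpa only [sub_eq_add_neg, Function.comp_def] using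
    tendsto_atBot_add_const_left _ a (tendsto_neg_atTop_atBot.comp h2)

-- Closeness of the orbits extends into the past of `t₀` for a time logarithmic in `1 / γ`. The
-- asymptotic solution can therefore be started at a time `τ` that lies far before `t₀` when `γ` is
-- small, and its decay has made the difference small by the time `t₀`.
variable (n m) in
theorem exists_forward_constants (D : HypData) {A : ℝ} (hA : 1 ≤ A) {R : ℝ} (hR : 0 ≤ R)
    {ε₁ : ℝ} (hε₁ : 0 < ε₁) :
    ∃ α > (0 : ℝ), ∃ γbar > (0 : ℝ), ∃ ρ > (0 : ℝ), ∃ δ₀ > (0 : ℝ), ∃ C : ℝ → ℝ → ℝ,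
      (∀ σ : ℝ, 0 ≤ σ → Tendsto (C σ) (𝓝[>] 0) (𝓝 0)) ∧
      ∀ δ : ℝ, 0 < δ → δ ≤ δ₀ → ∃ ε₀ > (0 : ℝ), ∀ ε : ℝ, |ε| < ε₀ →
      ∀ γ : ℝ, 0 < γ → γ < γbar →
      ∀ (L : LatticeSystem n m) (Λ : ℤ → Set (Vec n)), L.UniformData D A R ε₁ Λ →
      L.ForwardAsymptotics Λ α ρ C δ ε γ := by
  have hB := D.one_le_B
  have hL := D.one_le_Lf
  have hα : 0 < D.κ / 4 := by have := D.κ_pos; positivity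
  obtain ⟨δa, hδa, hδa1, ρ, hρ, C, hC, hsol⟩ := exists_asymptotic_solution n m D hA hR hε₁
  obtain ⟨δp, hδp, hδp1, Cp, -, -, hphase⟩ := HypOrbit.phaseControl (E := Vec n) D 4 (by norm_num)
  set α := D.κ / 4 with hαdef
  set V := speedBound D A R with hV
  have hV0 : 0 ≤ V := by rw [hV, speedBound]; positivity
  refine ⟨α, hα, δa / 2, by positivity, ρ, hρ, min (δa / 2) δp, by positivity,
    fun σ γ => (C + 8 * V * (σ + 1)) *
      Real.exp (α * (2 * (σ + 1) - Real.log (δa / 2 / γ) / (2 * D.Lf))), fun σ hσ => ?_, ?_⟩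
  · simpa using (tendsto_exp_sub_log_div (a := 2 * (σ + 1)) (b := 2 * D.Lf) (c := α) (g := δa / 2)
      (by positivity) hα (by positivity)).const_mul (C + 8 * V * (σ + 1))
  intro δ hδ hδle
  have hδa' : δ ≤ δa / 2 := hδle.trans (min_le_left _ _)
  obtain ⟨ε₀, hε₀, hε⟩ := hsol δ hδ (by linarith)
  refine ⟨min (min ε₀ ε₁) (δ / A), by positivity, ?_⟩
  intro ε hεlt γ hγ hγlt L Λ U y01 y02 h01 h02 t₀ hclose y1 p1 Φ1 h1 σ hσ hσΦ
  have hεε₀ : |ε| < ε₀ := hεlt.trans_le ((min_le_left _ _).trans (min_le_left _ _))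
  have hεε₁ : |ε| < ε₁ := hεlt.trans_le ((min_le_left _ _).trans (min_le_right _ _))
  have hεA : |ε| * A ≤ δ := by
    have := (hεlt.trans_le (min_le_right _ _)).le
    rwa [le_div_iff₀ (by linarith)] at this
  have hFb : ∀ q, ‖L.forcing ε q‖ ≤ δ := fun q => (U.norm_forcing_le ε hεε₁ q).trans hεA
  -- `T'` is the time over which the Grönwall factor `e^{Lf T'}` enlarges `γ` to `δa / 2`; the other
  -- half of `δa` is left for the distance `δ` of the solution from its orbits.
  set T' := Real.log (δa / 2 / γ) / D.Lf with hT'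
  have hT'0 : 0 ≤ T' := div_nonneg (Real.log_nonneg (by rw [le_div_iff₀ hγ]; linarith)) (by linarith)
  have hT'e : Real.exp (D.Lf * T') * γ = δa / 2 := by
    rw [hT', mul_div_cancel₀ _ (by linarith : D.Lf ≠ 0), Real.exp_log (by positivity),
      div_mul_cancel₀ _ hγ.ne']
  have hT'2 : Real.log (δa / 2 / γ) / (2 * D.Lf) = T' / 2 := by
    rw [hT']; field_simp
  -- The choice works with both speed bounds for the phases: the lower speed 1/2 if `t ≥ t₀`, the
  -- upper speed 3/2 if `t < t₀`, where going back by `T' / 2` lowers the phase by at most `3 * T' /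
  -- 4`, up to bounded terms. The term `2 * (σ + 1)` makes up for the lag `σ` and the additive error
  -- 1.
  set τ := t₀ + 2 * (σ + 1) - T' / 2 with hτ
  have horb : ∀ k s, t₀ - T' ≤ s → ‖y01 k s - y02 k s‖ ≤ δa / 2 := fun k s hs => by
    rcases le_total t₀ s with h | h
    · exact (hclose s h k).trans hγlt.le
    · obtain ⟨Hk⟩ := U.hyp k (y01 k) (h01 k)
      have h2 := Hk.norm_sub_le_backward (h02 k).1 (t₀ := t₀) (r := t₀ - s) (b := T')
        (by linarith) (by linarith)
      rw [sub_sub_cancel] at h2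
      refine h2.trans ?_
      rw [← hT'e]
      exact mul_le_mul_of_nonneg_left (hclose t₀ le_rfl k) (Real.exp_pos _).le
  have hd1 : L.IsDriven (fun t => L.forcing ε (y1 t, p1 t)) y1 p1 := h1.solution
  have hgrow : ∀ k t, τ ≤ t → t₀ - T' ≤ Φ1 t k := fun k t ht => by
    obtain ⟨Hk⟩ := U.hyp k (y01 k) (h01 k)
    have P := hphase (L.f k) (y01 k) Hk _ _ (fun t => Φ1 t k) δ (min t t₀)
      (hd1.shadows (fun _ => hFb _) h1.continuous_phase_apply (fun t _ => h1.close t) k)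
      (hδle.trans (min_le_right _ _))
    have hk := hσΦ k
    rcases le_total t₀ t with h | h
    · have h2 := (P.growth t₀ (min_le_right _ _) (t - t₀) (by linarith)).1
      rw [add_sub_cancel] at h2
      linarith
    · have h2 := (P.growth t (min_le_left _ _) (t₀ - t) (by linarith)).2
      rw [add_sub_cancel] at h2
      linarith
  obtain ⟨y2, p2, Φ2, h2, hΦ, hest, huniq⟩ := hε ε hεε₀ L Λ U y01 y02 h01 h02 y1 p1 Φ1 h1 τ
    (fun t ht k => by
      have h3 := norm_sub_le_norm_sub_add_norm_sub (y1 t k) (y01 k (Φ1 t k)) (y02 k (Φ1 t k))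
      linarith [h1.close t k, horb k _ (hgrow k t ht)])
  have hexp : ∀ t, Real.exp (-α * (t - τ)) =
      Real.exp (α * (2 * (σ + 1) - T' / 2)) * Real.exp (-α * (t - t₀)) := fun t => by
    rw [← Real.exp_add]; congr 1; rw [hτ]; ring
  refine ⟨y2, p2, Φ2, h2, hΦ, fun t ht => ?_, fun y p Φ hm hph has => huniq y p Φ hm hph ?_⟩
  · beta_reduce
    rw [hT'2, mul_assoc, ← hexp]
    have hle : C * Real.exp (-α * (t - τ)) ≤
        (C + 8 * V * (σ + 1)) * Real.exp (-α * (t - τ)) := by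
      refine mul_le_mul_of_nonneg_right ?_ (Real.exp_pos _).le
      have : 0 ≤ 8 * V * (σ + 1) := by positivity
      linarith
    -- If `γ` is not small compared with `σ`, then `τ` may exceed `t₀`. The gap is at most `2 * (σ +
    -- 1)`, and the speeds of `y` and `p` of both solutions account for the term `8 * V * (σ + 1)`.
    rcases le_total τ t with h | h
    · exact (hest t h).trans hle
    · have hδ1 : δ ≤ 1 := by linarith
      have hd2 : L.IsDriven (fun t => L.forcing ε (y2 t, p2 t)) y2 p2 := h2.solution
      have s1 := hd1.norm_sub_le U hA hR h01 (fun t => (hFb _).trans hδ1) h1.continuous_phase_apply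
        (fun t k => (h1.close t k).trans hδ1) t τ
      have s2 := hd2.norm_sub_le U hA hR h02 (fun t => (hFb _).trans hδ1) h2.continuous_phase_apply
        (fun t k => (h2.close t k).trans hδ1) τ t
      have hab : |t - τ| ≤ 2 * (σ + 1) := by rw [abs_le]; constructor <;> linarith
      have hab' : |τ - t| ≤ 2 * (σ + 1) := by rwa [abs_sub_comm]
      have m1 := mul_le_mul_of_nonneg_left hab hV0
      have m2 := mul_le_mul_of_nonneg_left hab' hV0
      have h0 := hest τ le_rfl
      rw [sub_self, mul_zero, Real.exp_zero, mul_one] at h0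
      have e1 : y1 t - y2 t = (y1 t - y1 τ) + (y1 τ - y2 τ) + (y2 τ - y2 t) := by abel
      have e2 : p1 t - p2 t = (p1 t - p1 τ) + (p1 τ - p2 τ) + (p2 τ - p2 t) := by abel
      have n1 := norm_add₃_le (a := y1 t - y1 τ) (b := y1 τ - y2 τ) (c := y2 τ - y2 t)
      have n2 := norm_add₃_le (a := p1 t - p1 τ) (b := p1 τ - p2 τ) (c := p2 τ - p2 t)
      rw [← e1] at n1
      rw [← e2] at n2
      have hge : 1 ≤ Real.exp (-α * (t - τ)) := Real.one_le_exp (by linarith only [mul_nonneg hα.le (sub_nonneg.2 h)])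
      refine le_trans ?_ (le_mul_of_one_le_right (by positivity) hge)
      linarith [s1.1, s1.2, s2.1, s2.2]
  · obtain ⟨C', hC'⟩ := has
    refine ⟨C' * Real.exp (-(α * (2 * (σ + 1) - T' / 2))), t₀, fun t ht => (hC' t ht).trans
      (le_of_eq ?_)⟩
    rw [hexp, mul_assoc, ← mul_assoc (Real.exp _) (Real.exp _), ← Real.exp_add, neg_add_cancel,
      Real.exp_zero, one_mul]

end LatticeSystem

/-! ### Quantitative hyperbolic data from a splitting. -/

section Splitting

variable {E : Type*} [NormedAddCommGroup E] [NormedSpace ℝ E]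

/-- The projections of a splitting into two subspaces and a line, with a bound on the components. -/
theorem exists_splitting_projections {N₁ N₂ : Submodule ℝ E} {e : E} {K : ℝ}
    (hspan : N₁ ⊔ N₂ ⊔ Submodule.span ℝ {e} = ⊤)
    (hdir : ∀ s ∈ N₁, ∀ u ∈ N₂, ∀ c : ℝ, ‖s‖ + ‖u‖ + |c| ≤ K * ‖s + u + c • e‖) :
    ∃ (P₁ P₂ : E →L[ℝ] E) (ph : E →L[ℝ] ℝ), (∀ v, P₁ v ∈ N₁) ∧ (∀ v, P₂ v ∈ N₂) ∧
      (∀ v, P₁ v + P₂ v + ph v • e = v) ∧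
      (∀ v, ‖P₁ v‖ ≤ K * ‖v‖ ∧ ‖P₂ v‖ ≤ K * ‖v‖ ∧ |ph v| ≤ K * ‖v‖) ∧
      ∀ s ∈ N₁, ∀ u ∈ N₂, ∀ c : ℝ, P₂ (s + u + c • e) = u ∧ ph (s + u + c • e) = c := by
  have hex : ∀ v : E, ∃ q : E × E × ℝ, q.1 ∈ N₁ ∧ q.2.1 ∈ N₂ ∧ q.1 + q.2.1 + q.2.2 • e = v := by
    intro v
    have hv : v ∈ N₁ ⊔ N₂ ⊔ Submodule.span ℝ {e} := hspan ▸ Submodule.mem_top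
    obtain ⟨w, hw, z, hz, rfl⟩ := Submodule.mem_sup.1 hv
    obtain ⟨s, hs, u, hu, rfl⟩ := Submodule.mem_sup.1 hw
    obtain ⟨c, rfl⟩ := Submodule.mem_span_singleton.1 hz
    exact ⟨(s, u, c), hs, hu, rfl⟩
  choose q h1 h2 h3 using hex
  -- The norm bound on components makes the decomposition unique, and uniqueness makes the chosen
  -- components linear.
  have huniq : ∀ s ∈ N₁, ∀ u ∈ N₂, ∀ c : ℝ, q (s + u + c • e) = (s, u, c) := by
    intro s hs u hu c
    set v := s + u + c • e with hv
    have h4 := hdir _ (N₁.sub_mem (h1 v) hs) _ (N₂.sub_mem (h2 v) hu) ((q v).2.2 - c)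
    have e1 : (q v).1 - s + ((q v).2.1 - u) + ((q v).2.2 - c) • e = 0 := by
      have := h3 v
      rw [sub_smul]
      calc _ = (q v).1 + (q v).2.1 + (q v).2.2 • e - (s + u + c • e) := by abel
        _ = 0 := by rw [this, hv, sub_self]
    rw [e1, norm_zero, mul_zero] at h4
    have n1 := norm_nonneg ((q v).1 - s)
    have n2 := norm_nonneg ((q v).2.1 - u)
    have n3 := abs_nonneg ((q v).2.2 - c)
    have z1 : (q v).1 = s := sub_eq_zero.1 (norm_le_zero_iff.1 (by linarith))
    have z2 : (q v).2.1 = u := sub_eq_zero.1 (norm_le_zero_iff.1 (by linarith))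
    have z3 : (q v).2.2 = c := sub_eq_zero.1 (abs_nonpos_iff.1 (by linarith))
    exact Prod.ext z1 (Prod.ext z2 z3)
  have hadd : ∀ v w, q (v + w) = q v + q w := fun v w => by
    have h4 := huniq _ (N₁.add_mem (h1 v) (h1 w)) _ (N₂.add_mem (h2 v) (h2 w))
      ((q v).2.2 + (q w).2.2)
    have e1 : (q v).1 + (q w).1 + ((q v).2.1 + (q w).2.1) + ((q v).2.2 + (q w).2.2) • e = v + w := by
      rw [add_smul]
      conv_rhs => rw [← h3 v, ← h3 w]
      abel
    rw [e1] at h4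
    exact h4
  have hsmul : ∀ (a : ℝ) v, q (a • v) = a • q v := fun a v => by
    have h4 := huniq _ (N₁.smul_mem a (h1 v)) _ (N₂.smul_mem a (h2 v)) (a * (q v).2.2)
    have e1 : a • (q v).1 + a • (q v).2.1 + (a * (q v).2.2) • e = a • v := by
      conv_rhs => rw [← h3 v]
      rw [smul_add, smul_add, smul_smul]
    rw [e1] at h4
    exact h4
  have hb : ∀ v, ‖(q v).1‖ + ‖(q v).2.1‖ + |(q v).2.2| ≤ K * ‖v‖ := fun v => by
    have := hdir _ (h1 v) _ (h2 v) (q v).2.2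
    rwa [h3 v] at this
  have hb1 : ∀ v, ‖(q v).1‖ ≤ K * ‖v‖ := fun v => by
    linarith [hb v, norm_nonneg (q v).2.1, abs_nonneg (q v).2.2]
  have hb2 : ∀ v, ‖(q v).2.1‖ ≤ K * ‖v‖ := fun v => by
    linarith [hb v, norm_nonneg (q v).1, abs_nonneg (q v).2.2]
  have hb3 : ∀ v, |(q v).2.2| ≤ K * ‖v‖ := fun v => by
    linarith [hb v, norm_nonneg (q v).1, norm_nonneg (q v).2.1]
  refine ⟨LinearMap.mkContinuous ⟨⟨fun v => (q v).1, fun v w => ?_⟩, fun a v => ?_⟩ K hb1,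
    LinearMap.mkContinuous ⟨⟨fun v => (q v).2.1, fun v w => ?_⟩, fun a v => ?_⟩ K hb2,
    LinearMap.mkContinuous ⟨⟨fun v => (q v).2.2, fun v w => ?_⟩, fun a v => ?_⟩ K hb3,
    h1, h2, h3, fun v => ⟨hb1 v, hb2 v, hb3 v⟩, fun s hs u hu c => ⟨?_, ?_⟩⟩
  · simp only [hadd]; rfl
  · simp only [hsmul]; rfl
  · simp only [hadd]; rfl
  · simp only [hsmul]; rfl
  · simp only [hadd]; rfl
  · simp only [hsmul]; rfl
  · show (q _).2.1 = u
    rw [huniq s hs u hu c]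
  · show (q _).2.2 = c
    rw [huniq s hs u hu c]

/-- The fundamental solutions of a linear differential equation with bounded coefficients. -/
theorem exists_linear_flow [CompleteSpace E] {a : ℝ → E →L[ℝ] E} (ha : Continuous a) {M : ℝ}
    (hM : 0 < M) (hb : ∀ t, ‖a t‖ ≤ M) :
    ∃ U : ℝ → ℝ → E →L[ℝ] E, (∀ s v, U s s v = v) ∧
      ∀ s v t, HasDerivAt (fun t => U s t v) (a t (U s t v)) t := by
  -- Solving the equation in the space of operators gives linearity and continuity in the initial
  -- vector for free.
  have hex : ∀ s, ∃ X : ℝ → E →L[ℝ] E, X s = ContinuousLinearMap.id ℝ E ∧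
      ∀ t, HasDerivAt X ((a t).comp (X t)) t := fun s =>
    exists_global_solution (v := fun t X => (a t).comp X) (L := M) (C := M) hM
      (fun t X Y => by
        rw [← ContinuousLinearMap.comp_sub]
        exact (ContinuousLinearMap.opNorm_comp_le _ _).trans
          (mul_le_mul_of_nonneg_right (hb t) (norm_nonneg _)))
      (fun u hu => ha.clm_comp hu) s _ (fun t => by
        rw [ContinuousLinearMap.comp_id]
        exact hb t)
  choose U h1 h2 using hex
  refine ⟨U, fun s v => by rw [h1]; rfl, fun s v t => ?_⟩
  simpa using (h2 s t).clm_apply (hasDerivAt_const t v)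

end Splitting

/-- An orbit in a set with a hyperbolic splitting carries the data of a hyperbolic orbit. -/
theorem IsHyperbolicSplitting.nonempty_hypOrbit {n : ℕ} {f : Vec n → Vec n} {Λ : Set (Vec n)}
    {Ns Nu : Vec n → Submodule ℝ (Vec n)} {K κ : ℝ} (hs : IsHyperbolicSplitting f Λ Ns Nu K κ)
    {D : HypData} (hK : K ≤ D.K) (hKK : K * K ≤ D.K) (hκ : D.κ = κ) (hdiff : Differentiable ℝ f)
    (hf : ∀ z, ‖fderiv ℝ f z‖ ≤ D.Lf)
    (hmod : ∀ ω, 0 < ω → ∀ y z, ‖y - z‖ ≤ D.modulus ω → ‖fderiv ℝ f y - fderiv ℝ f z‖ ≤ ω)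
    (hB : ∀ y ∈ Λ, ‖f y‖ ≤ D.B) {x : ℝ → Vec n} (hx : IsOrbitIn f Λ x) :
    Nonempty (HypOrbit D f x) := by
  have hK0 : 0 ≤ K := by
    have h1 := hs.direct (x 0) (hx.2 0) 0 (zero_mem _) 0 (zero_mem _) 1
    have h2 : 0 < K * ‖(0 : Vec n) + 0 + (1 : ℝ) • f (x 0)‖ := by
      refine lt_of_lt_of_le ?_ h1
      simp
    by_contra h
    exact absurd h2 (not_lt.2 (mul_nonpos_of_nonpos_of_nonneg (not_le.1 h).le (norm_nonneg _)))
  have hxc : Continuous x := continuous_iff_continuousAt.2 fun t => (hx.1 t).continuousAt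
  have hfc : Continuous (fderiv ℝ f) := by
    rw [Metric.continuous_iff]
    intro y ω hω
    refine ⟨D.modulus (ω / 2), D.modulus_pos _ (by positivity), fun z hz => ?_⟩
    rw [dist_eq_norm] at hz ⊢
    exact (hmod (ω / 2) (by positivity) z y hz.le).trans_lt (by linarith)
  obtain ⟨U, hU1, hU2⟩ := exists_linear_flow (a := fun t => fderiv ℝ f (x t)) (hfc.comp hxc)
    (M := D.Lf) (by linarith [D.one_le_Lf]) (fun t => hf _)
  have hlip : ∀ (t : ℝ) (v w : Vec n), ‖fderiv ℝ f (x t) v - fderiv ℝ f (x t) w‖ ≤ D.Lf * ‖v - w‖ :=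
    fun t v w => by
      rw [← map_sub]
      exact ((fderiv ℝ f (x t)).le_opNorm _).trans
        (mul_le_mul_of_nonneg_right (hf _) (norm_nonneg _))
  have huniq : ∀ (v w : ℝ → Vec n) (t₀ : ℝ), (∀ t, HasDerivAt v (fderiv ℝ f (x t) (v t)) t) →
      (∀ t, HasDerivAt w (fderiv ℝ f (x t) (w t)) t) → v t₀ = w t₀ → v = w := fun v w t₀ hv hw h =>
    global_solution_unique (v := fun t v => fderiv ℝ f (x t) v) (by linarith [D.one_le_Lf]) hlip
      hv hw h
  have hvel : ∀ t, HasDerivAt (fun t => f (x t)) (fderiv ℝ f (x t) (f (x t))) t := fun t =>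
    (hdiff (x t)).hasFDerivAt.comp_hasDerivAt t (hx.1 t)
  have hUvel : ∀ s t, U s t (f (x s)) = f (x t) := fun s t =>
    congrFun (huniq (fun t => U s t (f (x s))) (fun t => f (x t)) s (hU2 s _) hvel (hU1 s _)) t
  have hshift : ∀ s v t, HasDerivAt (fun r => U s (s + r) v)
      (fderiv ℝ f (x (s + t)) (U s (s + t) v)) t := fun s v t => (hU2 s v (s + t)).comp_const_add s t
  have hxs : ∀ s, IsOrbitIn f Λ fun r => x (s + r) := fun s =>
    ⟨fun t => (hx.1 (s + t)).comp_const_add s t, fun t => hx.2 _⟩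
  have hst : ∀ s t v, v ∈ Ns (x s) → U s t v ∈ Ns (x t) ∧
      (s ≤ t → ‖U s t v‖ ≤ K * Real.exp (-κ * (t - s)) * ‖v‖) := fun s t v hv => by
    have h1 := hs.stable _ (fun r => U s (s + r) v) (hxs s) (hshift s v) (by simpa [hU1] using hv)
    have h2 := h1.1 (t - s)
    have h3 := h1.2 (t - s)
    simp only [add_sub_cancel, add_zero, hU1] at h2 h3
    exact ⟨h2, fun h => h3 (by linarith)⟩
  have hun : ∀ s t v, v ∈ Nu (x s) → U s t v ∈ Nu (x t) ∧
      (t ≤ s → ‖U s t v‖ ≤ K * Real.exp (κ * (t - s)) * ‖v‖) := fun s t v hv => by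
    have h1 := hs.unstable _ (fun r => U s (s + r) v) (hxs s) (hshift s v) (by simpa [hU1] using hv)
    have h2 := h1.1 (t - s)
    have h3 := h1.2 (t - s)
    simp only [add_sub_cancel, add_zero, hU1] at h2 h3
    exact ⟨h2, fun h => h3 (by linarith)⟩
  choose Ps Pu ph hPs hPu hdec hbd hco using fun t : ℝ =>
    exists_splitting_projections (hs.span (x t) (hx.2 t)) (hs.direct (x t) (hx.2 t))
  have hUdec : ∀ s t v, U s t v = U s t (Ps s v) + U s t (Pu s v) + ph s v • f (x t) := fun s t v => by
    conv_lhs => rw [← hdec s v]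
    rw [map_add, map_add, map_smul, hUvel]
  have hUco := fun s t v => hco t _ (hst s t _ (hPs s v)).1 _ (hun s t _ (hPu s v)).1 (ph s v)
  have hbdK : ∀ {a b : ℝ}, a ≤ K * b → 0 ≤ b → a ≤ D.K * b := fun h hb =>
    h.trans (mul_le_mul_of_nonneg_right hK hb)
  -- One factor `K` comes from the projection and one from the decay along the subspace, whence the
  -- requirement `K * K ≤ D.K`.
  have hKKe : ∀ {a b c e : ℝ}, a ≤ K * e * b → b ≤ K * c → 0 ≤ e → 0 ≤ c → a ≤ D.K * e * c := by
    intro a b c e h1 h2 he hc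
    calc a ≤ K * e * b := h1
      _ ≤ K * e * (K * c) := mul_le_mul_of_nonneg_left h2 (mul_nonneg hK0 he)
      _ = K * K * (e * c) := by ring
      _ ≤ D.K * (e * c) := mul_le_mul_of_nonneg_right hKK (mul_nonneg he hc)
      _ = D.K * e * c := by ring
  refine ⟨{ differentiable := hdiff
            norm_fderiv_le := hf
            fderiv_modulus := hmod
            orbit := hx.1
            norm_vel_le := fun t => hB _ (hx.2 t)
            Ps := Ps
            Pu := Pu
            ph := ph
            decomp := hdec
            norm_Pu_le := fun t v => hbdK (hbd t v).2.1 (norm_nonneg _)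
            norm_ph_le := fun t v => hbdK (hbd t v).2.2 (norm_nonneg _)
            ph_vel := fun t => by
              simpa using (hco t 0 (zero_mem _) 0 (zero_mem _) 1).2
            Pu_vel := fun t => by
              simpa using (hco t 0 (zero_mem _) 0 (zero_mem _) 1).1
            Pu_Pu := fun t v => by
              simpa using (hco t 0 (zero_mem _) _ (hPu t v) 0).1
            U := U
            hasDerivAt_U := hU2
            U_self := hU1
            U_comp := fun s t r v => congrFun (huniq (fun r => U t r (U s t v)) (fun r => U s r v) t
              (hU2 t _) (hU2 s v) (hU1 t _)) r
            U_vel := hUvel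
            Pu_U := fun s t v => by rw [hUdec]; exact (hUco s t v).1
            ph_U := fun s t v => by rw [hUdec]; exact (hUco s t v).2
            norm_U_Ps_le := fun s t v h => ?_
            norm_U_Pu_le := fun s t v h => ?_ }⟩
  · rw [hκ]
    exact hKKe ((hst s t _ (hPs s v)).2 h) (hbd s v).1 (Real.exp_pos _).le (norm_nonneg _)
  · rw [hκ, show -κ * (s - t) = κ * (t - s) by ring]
    exact hKKe ((hun s t _ (hPu s v)).2 h) (hbd s v).2.1 (Real.exp_pos _).le (norm_nonneg _)

/-! ### Uniform constants and time reversal. -/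

section Derivatives

variable {E E' : Type*} [NormedAddCommGroup E] [NormedSpace ℝ E]
  [NormedAddCommGroup E'] [NormedSpace ℝ E']

theorem norm_fderiv_sub_le_norm_iteratedFDeriv_sub (h : E → E') (y z : E) :
    ‖fderiv ℝ h y - fderiv ℝ h z‖ ≤ ‖iteratedFDeriv ℝ 1 h y - iteratedFDeriv ℝ 1 h z‖ := by
  refine ContinuousLinearMap.opNorm_le_bound _ (norm_nonneg _) fun v => ?_
  have h1 := (iteratedFDeriv ℝ 1 h y - iteratedFDeriv ℝ 1 h z).le_opNorm fun _ => v
  simpa [iteratedFDeriv_one_apply] using h1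

theorem norm_sub_le_of_norm_iteratedFDeriv_le {h : E → E'} {C : ℝ} (hd : Differentiable ℝ h)
    (hC : ∀ x, ‖iteratedFDeriv ℝ 1 h x‖ ≤ C) (y z : E) : ‖h y - h z‖ ≤ C * ‖y - z‖ :=
  convex_univ.norm_image_sub_le_of_norm_fderiv_le (fun w _ => hd w)
    (fun w _ => by rw [← norm_iteratedFDeriv_one]; exact hC w) trivial trivial

theorem HasDerivAt.reverse {x : ℝ → E} {v w : E} {t : ℝ} (h : HasDerivAt x v (-t)) (hw : w = -v) :
    HasDerivAt (fun s => x (-s)) w t := by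
  have := h.scomp t (hasDerivAt_neg t)
  rwa [neg_one_smul, ← hw] at this

end Derivatives

/-- The splitting of the time-reversed vector field. -/
theorem IsHyperbolicSplitting.reverse {n : ℕ} {f : Vec n → Vec n} {Λ : Set (Vec n)}
    {Ns Nu : Vec n → Submodule ℝ (Vec n)} {K κ : ℝ} (hs : IsHyperbolicSplitting f Λ Ns Nu K κ) :
    IsHyperbolicSplitting (fun y => -f y) Λ Nu Ns K κ where
  continuous_s := hs.continuous_u
  continuous_u := hs.continuous_s
  span y hy := by
    rw [show ({-f y} : Set (Vec n)) = -{f y} by simp, Submodule.span_neg, sup_comm (Nu y)]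
    exact hs.span y hy
  direct y hy s hs' u hu c := by
    have h1 := hs.direct y hy u hu s hs' (-c)
    rw [abs_neg] at h1
    rw [smul_neg, ← neg_smul, add_comm s u]
    linarith
  stable x v hx hv h0 := by
    have h1 := hs.unstable (fun t => x (-t)) (fun t => v (-t))
      ⟨fun t => (hx.1 (-t)).reverse (neg_neg _).symm, fun t => hx.2 (-t)⟩
      (fun t => (hv (-t)).reverse (by rw [fderiv_fun_neg]; simp)) (by simpa using h0)
    refine ⟨fun t => by simpa using h1.1 (-t), fun t ht => ?_⟩
    have h2 := h1.2 (-t) (by linarith)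
    simpa using h2
  unstable x v hx hv h0 := by
    have h1 := hs.stable (fun t => x (-t)) (fun t => v (-t))
      ⟨fun t => (hx.1 (-t)).reverse (neg_neg _).symm, fun t => hx.2 (-t)⟩
      (fun t => (hv (-t)).reverse (by rw [fderiv_fun_neg]; simp)) (by simpa using h0)
    refine ⟨fun t => by simpa using h1.1 (-t), fun t ht => ?_⟩
    have h2 := h1.2 (-t) (by linarith)
    simpa using h2

namespace LatticeSystem

variable {n m : ℕ}

/-- The time-reversed system. -/
noncomputable def reverse (L : LatticeSystem n m) : LatticeSystem n m where
  f k y := -L.f k y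
  g k y := -L.g k y
  F ε q := -L.F ε q
  G ε q := -L.G ε q

theorem forcing_reverse (L : LatticeSystem n m) (ε : ℝ) (q : SeqVec n × SeqVec m) :
    L.reverse.forcing ε q = -L.forcing ε q := by
  simp [forcing, reverse]

/-- Only values and first derivatives enter. Reversal changes signs and exchanges the stable and
unstable subspaces, which affects no norm; so the same constants serve both directions of time. -/
theorem StandingAssumptions.exists_uniformData {L : LatticeSystem n m} {r : ℕ}
    {Λ : ℤ → Set (Vec n)} (hL : L.StandingAssumptions r Λ) :
    ∃ (D : HypData) (A R ε₁ : ℝ), 1 ≤ A ∧ 0 ≤ R ∧ 0 < ε₁ ∧ L.UniformData D A R ε₁ Λ ∧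
      L.reverse.UniformData D A R ε₁ Λ := by
  obtain ⟨Cf, hCf⟩ := hL.smooth_f.bounded
  obtain ⟨Cf0, hCf0⟩ := hL.smooth_f.bounded_zero
  obtain ⟨Cg, hCg⟩ := hL.smooth_g.bounded
  obtain ⟨Cg0, hCg0⟩ := hL.smooth_g.bounded_zero
  obtain ⟨ε₁, hε₁, CF, hCF⟩ := hL.coupling
  obtain ⟨R, hR⟩ := hL.bounded
  obtain ⟨K, κ, hκ, hhyp⟩ := hL.hyperbolic
  have hr0 : (r : WithTop ℕ∞) ≠ 0 := by
    have := hL.one_le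
    exact_mod_cast (by omega : r ≠ 0)
  have hfd : ∀ k, Differentiable ℝ (L.f k) := fun k =>
    (hL.smooth_f.contDiff k).differentiable hr0
  have hgd : ∀ k, Differentiable ℝ (L.g k) := fun k =>
    (hL.smooth_g.contDiff k).differentiable hr0
  have heq := Metric.uniformEquicontinuous_iff.1 (hL.smooth_f.equicontinuous 1 le_rfl hL.one_le)
  choose! mod hmod hmod' using heq
  set A := max 1 (max Cg (max Cg0 CF)) with hA
  have hA1 : 1 ≤ A := le_max_left _ _
  have hAg : Cg ≤ A := (le_max_left _ _).trans (le_max_right _ _)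
  have hAg0 : Cg0 ≤ A := (le_max_left _ _).trans ((le_max_right _ _).trans (le_max_right _ _))
  have hAF : CF ≤ A := (le_max_right _ _).trans ((le_max_right _ _).trans (le_max_right _ _))
  set Lf := max 1 Cf with hLf
  set R' := max 0 R with hR'
  set D : HypData := {
    Lf := Lf
    B := max 1 (Cf0 + Lf * R')
    K := max 1 (max K (K * K))
    κ := κ
    -- Halved because uniform equicontinuity speaks of distances strictly below `mod ω`.
    modulus := fun ω => mod ω / 2
    one_le_Lf := le_max_left _ _
    one_le_B := le_max_left _ _
    one_le_K := le_max_left _ _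
    κ_pos := hκ
    modulus_pos := fun ω hω => half_pos (hmod ω hω) } with hD
  have hfderiv : ∀ k z, ‖fderiv ℝ (L.f k) z‖ ≤ D.Lf := fun k z => by
    rw [← norm_iteratedFDeriv_one]
    exact (hCf k 1 le_rfl hL.one_le z).trans (le_max_right _ _)
  have hfmod : ∀ k ω, 0 < ω → ∀ y z, ‖y - z‖ ≤ D.modulus ω →
      ‖fderiv ℝ (L.f k) y - fderiv ℝ (L.f k) z‖ ≤ ω := fun k ω hω y z h => by
    refine (norm_fderiv_sub_le_norm_iteratedFDeriv_sub _ y z).trans ?_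
    rw [← dist_eq_norm]
    refine (hmod' ω hω y z ?_ k).le
    rw [dist_eq_norm]
    exact h.trans_lt (half_lt_self (hmod ω hω))
  have hspeed : ∀ k, ∀ y ∈ Λ k, ‖L.f k y‖ ≤ D.B := fun k y hy => by
    have h1 := norm_sub_le_of_norm_iteratedFDeriv_le (hfd k)
      (fun z => hCf k 1 le_rfl hL.one_le z) y 0
    have h2 := norm_add_le (L.f k y - L.f k 0) (L.f k 0)
    rw [sub_add_cancel] at h2
    rw [sub_zero] at h1
    have h3 : Cf * ‖y‖ ≤ Lf * R' := mul_le_mul (le_max_right _ _)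
      ((hR k y hy).trans (le_max_right _ _)) (norm_nonneg _) (zero_le_one.trans (le_max_left _ _))
    refine le_trans ?_ (le_max_right _ _)
    linarith [hCf0 k]
  have hK1 : K ≤ D.K := (le_max_left _ _).trans (le_max_right _ _)
  have hK2 : K * K ≤ D.K := (le_max_right _ _).trans (le_max_right _ _)
  have hRR : ∀ k, ∀ y ∈ Λ k, ‖y‖ ≤ R' := fun k y hy => (hR k y hy).trans (le_max_right _ _)
  have hglip : ∀ k y z, ‖L.g k y - L.g k z‖ ≤ A * ‖y - z‖ := fun k y z =>
    norm_sub_le_of_norm_iteratedFDeriv_le (hgd k)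
      (fun z => (hCg k 1 le_rfl hL.one_le z).trans hAg) y z
  have hFb : ∀ ε, |ε| < ε₁ → ∀ q, ‖L.forcing ε q‖ ≤ |ε| * A := fun ε hε q => by
    have h1 := (hCF ε hε).1.bounded 0 (Nat.zero_le _) q
    have h2 := (hCF ε hε).2.bounded 0 (Nat.zero_le _) q
    rw [norm_iteratedFDeriv_zero] at h1 h2
    refine (Prod.norm_def _).trans_le (max_le ?_ ?_)
    · exact (norm_smul _ _).trans_le
        (mul_le_mul_of_nonneg_left (h1.trans hAF) (norm_nonneg _))
    · exact (norm_smul _ _).trans_le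
        (mul_le_mul_of_nonneg_left (h2.trans hAF) (norm_nonneg _))
  have hFl : ∀ ε, |ε| < ε₁ → ∀ q q', ‖L.forcing ε q - L.forcing ε q'‖ ≤ |ε| * A * ‖q - q'‖ :=
    fun ε hε q q' => by
      have h1 := norm_sub_le_of_norm_iteratedFDeriv_le
        ((hCF ε hε).1.contDiff.differentiable hr0)
        (fun z => ((hCF ε hε).1.bounded 1 hL.one_le z).trans hAF) q q'
      have h2 := norm_sub_le_of_norm_iteratedFDeriv_le
        ((hCF ε hε).2.contDiff.differentiable hr0)
        (fun z => ((hCF ε hε).2.bounded 1 hL.one_le z).trans hAF) q q'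
      rw [mul_assoc]
      refine (Prod.norm_def _).trans_le (max_le ?_ ?_)
      · show ‖ε • L.F ε q - ε • L.F ε q'‖ ≤ _
        rw [← smul_sub]
        exact (norm_smul _ _).trans_le (mul_le_mul_of_nonneg_left h1 (norm_nonneg _))
      · show ‖ε • L.G ε q - ε • L.G ε q'‖ ≤ _
        rw [← smul_sub]
        exact (norm_smul _ _).trans_le (mul_le_mul_of_nonneg_left h2 (norm_nonneg _))
  refine ⟨D, A, R', ε₁, hA1, le_max_left _ _, hε₁, ?_, ?_⟩
  · refine ⟨fun k x hx => ?_, hRR, fun k => (hCg0 k).trans hAg0, hglip, hFb, hFl⟩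
    obtain ⟨Ns, Nu, hs⟩ := hhyp k
    exact hs.nonempty_hypOrbit hK1 hK2 rfl (hfd k) (hfderiv k) (hfmod k) (hspeed k) hx
  · refine ⟨fun k x hx => ?_, hRR, fun k => ?_, fun k y z => ?_, fun ε hε q => ?_,
      fun ε hε q q' => ?_⟩
    · obtain ⟨Ns, Nu, hs⟩ := hhyp k
      have hfd' : ∀ z, fderiv ℝ (fun y => -L.f k y) z = -fderiv ℝ (L.f k) z := fun z =>
        fderiv_fun_neg
      exact hs.reverse.nonempty_hypOrbit hK1 hK2 rfl (hfd k).fun_neg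
        (fun z => by rw [hfd', norm_neg]; exact hfderiv k z)
        (fun ω hω y z h => by
          rw [hfd', hfd', neg_sub_neg, norm_sub_rev]
          exact hfmod k ω hω y z h)
        (fun y hy => by rw [norm_neg]; exact hspeed k y hy) hx
    · show ‖-L.g k 0‖ ≤ A
      rw [norm_neg]
      exact (hCg0 k).trans hAg0
    · show ‖-L.g k y - -L.g k z‖ ≤ _
      rw [neg_sub_neg, norm_sub_rev]
      exact hglip k y z
    · rw [forcing_reverse, norm_neg]
      exact hFb ε hε q
    · rw [forcing_reverse, forcing_reverse, neg_sub_neg, norm_sub_rev]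
      exact hFl ε hε q q'

end LatticeSystem

namespace LatticeSystem

variable {n m : ℕ}

theorem reverse_reverse (L : LatticeSystem n m) : L.reverse.reverse = L := by
  simp [reverse]

theorem IsOrbitOfProduct.reverse {L : LatticeSystem n m} {Λ : ℤ → Set (Vec n)}
    {y0 : ℤ → ℝ → Vec n} (h : L.IsOrbitOfProduct Λ y0) :
    L.reverse.IsOrbitOfProduct Λ fun k t => y0 k (-t) := fun k =>
  ⟨fun t => ((h k).1 (-t)).reverse rfl, fun t => (h k).2 (-t)⟩

/-- The reversed orbit at phase `-Φ (-t)` is the original orbit at phase `Φ (-t)`, so phases change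
sign along with time. -/
theorem IsSolutionOnManifold.reverse {L : LatticeSystem n m} {ε δ : ℝ} {y0 : ℤ → ℝ → Vec n}
    {y : ℝ → SeqVec n} {p : ℝ → SeqVec m} {Φ : ℝ → PhaseSpace}
    (h : L.IsSolutionOnManifold ε δ y0 y p Φ) :
    L.reverse.IsSolutionOnManifold ε δ (fun k t => y0 k (-t)) (fun t => y (-t)) (fun t => p (-t))
      fun t => -Φ (-t) where
  solution t := by
    obtain ⟨v, w, hv, hw, hvk, hwk⟩ := h.solution (-t)
    refine ⟨-v, -w, hv.reverse rfl, hw.reverse rfl, fun k => ?_, fun k => ?_⟩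
    · rw [lp.coeFn_neg, Pi.neg_apply, hvk, neg_add]
      exact congrArg _ (smul_neg ε _).symm
    · rw [lp.coeFn_neg, Pi.neg_apply, hwk, neg_add]
      exact congrArg _ (smul_neg ε _).symm
  continuous_phase := (h.continuous_phase.comp continuous_neg).neg
  close t k := by
    rw [lp.coeFn_neg, Pi.neg_apply, neg_neg]
    exact h.close (-t) k

theorem IsSolutionOnManifold.of_reverse {L : LatticeSystem n m} {ε δ : ℝ} {y0 : ℤ → ℝ → Vec n}
    {y : ℝ → SeqVec n} {p : ℝ → SeqVec m} {Φ : ℝ → PhaseSpace}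
    (h : L.reverse.IsSolutionOnManifold ε δ (fun k t => y0 k (-t)) y p Φ) :
    L.IsSolutionOnManifold ε δ y0 (fun t => y (-t)) (fun t => p (-t)) fun t => -Φ (-t) := by
  have := h.reverse
  simp only [neg_neg] at this
  rwa [reverse_reverse] at this

/-- The asymptotic phase property of the time-reversed system, in terms of the original one. -/
theorem ForwardAsymptotics.of_reverse {L : LatticeSystem n m} {Λ : ℤ → Set (Vec n)}
    {α ρ δ ε γ : ℝ} {C : ℝ → ℝ → ℝ} (h : L.reverse.ForwardAsymptotics Λ α ρ C δ ε γ)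
    {y01 y02 : ℤ → ℝ → Vec n} (h01 : L.IsOrbitOfProduct Λ y01) (h02 : L.IsOrbitOfProduct Λ y02)
    {t₀ : ℝ} (hclose : ∀ t, t ≤ t₀ → ∀ k, ‖y01 k t - y02 k t‖ ≤ γ) {y1 : ℝ → SeqVec n}
    {p1 : ℝ → SeqVec m} {Φ1 : ℝ → PhaseSpace} (h1 : L.IsSolutionOnManifold ε δ y01 y1 p1 Φ1)
    {σ : ℝ} (hσ : 0 ≤ σ) (hσΦ : ∀ k, Φ1 t₀ k ≤ t₀ + σ) :
    ∃ (y2 : ℝ → SeqVec n) (p2 : ℝ → SeqVec m) (Φ2 : ℝ → PhaseSpace),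
      L.IsSolutionOnManifold ε δ y02 y2 p2 Φ2 ∧
      (∀ᶠ t in atBot, ‖Φ1 t - Φ2 t‖ ≤ ρ) ∧
      (∀ t, t ≤ t₀ →
        ‖y1 t - y2 t‖ + ‖p1 t - p2 t‖ ≤ C σ γ * Real.exp (-α * |t - t₀|)) ∧
      ∀ (y : ℝ → SeqVec n) (p : ℝ → SeqVec m) (Φ : ℝ → PhaseSpace),
        L.IsSolutionOnManifold ε δ y02 y p Φ →
        (∀ᶠ t in atBot, ‖Φ1 t - Φ t‖ ≤ ρ) →
        (∃ C' : ℝ, ∀ t, t ≤ t₀ →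
          ‖y1 t - y t‖ + ‖p1 t - p t‖ ≤ C' * Real.exp (-α * |t - t₀|)) →
        y = y2 ∧ p = p2 := by
  obtain ⟨y2, p2, Φ2, h2, hΦ, hest, huniq⟩ := h _ _ h01.reverse h02.reverse (-t₀)
    (fun t ht k => hclose (-t) (by linarith) k) _ _ _ h1.reverse σ hσ (fun k => by
      have := hσΦ k
      rw [lp.coeFn_neg, Pi.neg_apply, neg_neg]
      linarith)
  refine ⟨_, _, _, h2.of_reverse, ?_, fun t ht => ?_, fun y p Φ hm hph has => ?_⟩
  · filter_upwards [tendsto_neg_atBot_atTop.eventually hΦ] with t ht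
    rwa [neg_neg, ← norm_neg, neg_sub, sub_neg_eq_add, add_comm, ← sub_neg_eq_add] at ht
  · have h3 := hest (-t) (by linarith)
    rw [neg_neg] at h3
    rwa [abs_of_nonpos (by linarith : t - t₀ ≤ 0), neg_sub, show t₀ - t = -t - -t₀ by ring]
  · obtain ⟨C', hC'⟩ := has
    obtain ⟨hy, hp⟩ := huniq _ _ _ hm.reverse
      (by
        filter_upwards [tendsto_neg_atTop_atBot.eventually hph] with t ht
        rwa [neg_sub_neg, norm_sub_rev])
      ⟨C', fun t ht => by
        have h3 := hC' (-t) (by linarith)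
        rwa [abs_of_nonpos (by linarith : -t - t₀ ≤ 0), show -(-t - t₀) = t - -t₀ by ring] at h3⟩
    refine ⟨?_, ?_⟩
    · rw [← hy]; simp only [neg_neg]
    · rw [← hp]; simp only [neg_neg]

end LatticeSystem
theorem theorem5 {n m : ℕ} (L : LatticeSystem n m) (r : ℕ) (Λ : ℤ → Set (Vec n))
    (hL : L.StandingAssumptions r Λ) :
    ∃ α > (0 : ℝ), ∃ γbar > (0 : ℝ), ∃ ρ > (0 : ℝ), ∃ δ₀ > (0 : ℝ), ∃ C : ℝ → ℝ → ℝ,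
      (∀ σ : ℝ, 0 ≤ σ → Tendsto (C σ) (𝓝[>] 0) (𝓝 0)) ∧
      ∀ δ : ℝ, 0 < δ → δ ≤ δ₀ → ∃ ε₀ > (0 : ℝ), ∀ ε : ℝ, |ε| < ε₀ →
      ∀ γ : ℝ, 0 < γ → γ < γbar →
      ∀ y01 y02 : ℤ → ℝ → Vec n, L.IsOrbitOfProduct Λ y01 → L.IsOrbitOfProduct Λ y02 →
      ∀ t₀ : ℝ,
        -- forward time
        ((∀ t, t₀ ≤ t → ∀ k, ‖y01 k t - y02 k t‖ ≤ γ) →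
          ∀ (y1 : ℝ → SeqVec n) (p1 : ℝ → SeqVec m) (Φ1 : ℝ → PhaseSpace),
          L.IsSolutionOnManifold ε δ y01 y1 p1 Φ1 →
          ∀ σ : ℝ, 0 ≤ σ → (∀ k, t₀ - σ ≤ Φ1 t₀ k) →
          ∃ (y2 : ℝ → SeqVec n) (p2 : ℝ → SeqVec m) (Φ2 : ℝ → PhaseSpace),
            L.IsSolutionOnManifold ε δ y02 y2 p2 Φ2 ∧
            (∀ᶠ t in atTop, ‖Φ1 t - Φ2 t‖ ≤ ρ) ∧
            (∀ t, t₀ ≤ t →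
              ‖y1 t - y2 t‖ + ‖p1 t - p2 t‖ ≤ C σ γ * Real.exp (-α * (t - t₀))) ∧
            ∀ (y : ℝ → SeqVec n) (p : ℝ → SeqVec m) (Φ : ℝ → PhaseSpace),
              L.IsSolutionOnManifold ε δ y02 y p Φ →
              (∀ᶠ t in atTop, ‖Φ1 t - Φ t‖ ≤ ρ) →
              (∃ C' : ℝ, ∀ t, t₀ ≤ t →
                ‖y1 t - y t‖ + ‖p1 t - p t‖ ≤ C' * Real.exp (-α * (t - t₀))) →
              y = y2 ∧ p = p2) ∧
        -- backward time
        ((∀ t, t ≤ t₀ → ∀ k, ‖y01 k t - y02 k t‖ ≤ γ) →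
          ∀ (y1 : ℝ → SeqVec n) (p1 : ℝ → SeqVec m) (Φ1 : ℝ → PhaseSpace),
          L.IsSolutionOnManifold ε δ y01 y1 p1 Φ1 →
          ∀ σ : ℝ, 0 ≤ σ → (∀ k, Φ1 t₀ k ≤ t₀ + σ) →
          ∃ (y2 : ℝ → SeqVec n) (p2 : ℝ → SeqVec m) (Φ2 : ℝ → PhaseSpace),
            L.IsSolutionOnManifold ε δ y02 y2 p2 Φ2 ∧
            (∀ᶠ t in atBot, ‖Φ1 t - Φ2 t‖ ≤ ρ) ∧
            (∀ t, t ≤ t₀ →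
              ‖y1 t - y2 t‖ + ‖p1 t - p2 t‖ ≤ C σ γ * Real.exp (-α * |t - t₀|)) ∧
            ∀ (y : ℝ → SeqVec n) (p : ℝ → SeqVec m) (Φ : ℝ → PhaseSpace),
              L.IsSolutionOnManifold ε δ y02 y p Φ →
              (∀ᶠ t in atBot, ‖Φ1 t - Φ t‖ ≤ ρ) →
              (∃ C' : ℝ, ∀ t, t ≤ t₀ →
                ‖y1 t - y t‖ + ‖p1 t - p t‖ ≤ C' * Real.exp (-α * |t - t₀|)) →
              y = y2 ∧ p = p2) := by
  obtain ⟨D, A, R, ε₁, hA, hR, hε₁, U, U'⟩ := hL.exists_uniformData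
  obtain ⟨α, hα, γbar, hγbar, ρ, hρ, δ₀, hδ₀, C, hC, h⟩ :=
    LatticeSystem.exists_forward_constants n m D hA hR hε₁
  refine ⟨α, hα, γbar, hγbar, ρ, hρ, δ₀, hδ₀, C, hC, fun δ hδ hδle => ?_⟩
  obtain ⟨ε₀, hε₀, hε⟩ := h δ hδ hδle
  refine ⟨ε₀, hε₀, fun ε hεlt γ hγ hγlt y01 y02 h01 h02 t₀ => ⟨fun hclose y1 p1 Φ1 h1 σ hσ hσΦ => ?_,
    fun hclose y1 p1 Φ1 h1 σ hσ hσΦ => ?_⟩⟩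
  · exact hε ε hεlt γ hγ hγlt L Λ U y01 y02 h01 h02 t₀ hclose y1 p1 Φ1 h1 σ hσ hσΦ
  -- The constants were fixed before the system, so the forward statement applies to the reversed
  -- system with the same ones.
  · exact (hε ε hεlt γ hγ hγlt L.reverse Λ U').of_reverse h01 h02 hclose h1 hσ hσΦ
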